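/- Let $(X_t)_{t\in\mathbb R}$ be a centered real Gaussian process with continuous paths on a probability space $(\Omega,\mathcal F,P)$, let $R(s,t)=E(X_sX_t)$, and fix $-\infty<a<b<\infty$. Assume that (a) or (b) holds. (a) The following four conditions hold: 1. There are real numbers $r_{mn}$ with $R(s,t)=\sum_{m,n\ge 0} r_{mn}s^mt^n$ for all $s,t\in\mathbb R$ (an unconditionally convergent double power series). 2. For every compact interval $[c,d]$ and every Borel probability measure $\nu$ on $[c,d]$, $\iint R\,d\nu\,d\nu>0$. 3. The sample paths are almost surely infinitely differentiable, and the covariance matrix of any finite sub-collection of $(X^{(n)}_t:t\in\mathbb R,\ n\ge 0)$ is non-singular. 4. $\limsup_{t\to\infty}R(s,t)\le 0$ for every fixed $s\in[a,b]$. (b) The process is stationary, and its spectral measure $F$ (the finite symmetric Borel measure with $R(s,t)=\int e^{i(t-s)x}F(dx)$) satisfies $\int e^{tx}F(dx)<\infty$ for all $t\in\mathbb R$; moreover the support of $F$ has at least one accumulation point. Then the functional $\nu\mapsto\int_a^b\int_a^b R(s,t)\,\nu(ds)\,\nu(dt)$ attains its minimum over the Borel probability measures on $[a,b]$. Let $\nu_*$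 be a minimizer, let $S$ be its support, and suppose that the function $\mu(t)=E(X_t\mid X_s=1\text{ for all }s\in S)$, $t\in\mathbb R$ (the value at $(1,\dots,1)$ of the continuous version of the regression of $X_t$ on the random variables $X_s$, $s\in S$, for finite $S$), satisfies $$\mu''(t)>0\quad\text{for all }t\in S\cap(a,b).$$ (This includes the requirement that $\mu$ be defined, i.e. that $S$ be finite.) Then $\nu_*$ is the unique minimizer. Further, let $T_*$ be the leftmost point of $[a,b]$ at which $X$ attains its minimum over $[a,b]$. Then $T_*$ is a random variable, $P(\min_{[a,b]}X>u)>0$ for all large $u$, and, as $u\to\infty$, $$P\Bigl(T_*\in\cdot\ \Big|\ \min_{s\in[a,b]}X_s>u\Bigr)\Rightarrow\nu_*\quad\text{weakly.}$$ -/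

import Mathlib

open MeasureTheory ProbabilityTheory Filter Topology
open scoped BoundedContinuousFunction

noncomputable section

namespace HighMinima

/-- The covariance function `R(s,t) = E(X_s X_t)` of a (centered) process. -/
def covFun {Ω : Type*} [MeasurableSpace Ω] (P : Measure Ω) (X : ℝ → Ω → ℝ) (s t : ℝ) : ℝ :=
  ∫ ω, X s ω * X t ω ∂P

/-- The functional `ν ↦ ∫∫ R(s,t) ν(ds) ν(dt)`. -/
def energy (R : ℝ → ℝ → ℝ) (ν : Measure ℝ) : ℝ :=
  ∫ s, ∫ t, R s t ∂ν ∂ν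

/-- `ν` is a Borel probability measure on `[a,b]`, regarded as a measure on the line. -/
def IsProbOn (a b : ℝ) (ν : Measure ℝ) : Prop :=
  IsProbabilityMeasure ν ∧ ν (Set.Icc a b) = 1

/-- `ν` minimizes the energy over all Borel probability measures on `[a,b]`. -/
def IsMinimizer (R : ℝ → ℝ → ℝ) (a b : ℝ) (ν : Measure ℝ) : Prop :=
  IsProbOn a b ν ∧ ∀ ν' : Measure ℝ, IsProbOn a b ν' → energy R ν ≤ energy R ν'

/-- `X` is a centered real Gaussian process on the line with continuous paths. -/
structure IsCenteredContinuousGaussian {Ω : Type*} [MeasurableSpace Ω] (P : Measure Ω)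
    (X : ℝ → Ω → ℝ) : Prop where
  measurable : ∀ t, Measurable (X t)
  gaussian : IsGaussianProcess X P
  centered : ∀ t, ∫ ω, X t ω ∂P = 0
  continuous : ∀ ω, Continuous fun t => X t ω

/-- `R` has a (doubly infinite, unconditionally convergent) power expansion on the plane. -/
def HasPowerExpansion (R : ℝ → ℝ → ℝ) : Prop :=
  ∃ r : ℕ → ℕ → ℝ, ∀ s t : ℝ,
    HasSum (fun p : ℕ × ℕ => r p.1 p.2 * s ^ p.1 * t ^ p.2) (R s t)

/-- Non-negative non-degeneracy on every compact interval. -/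
def NonnegNondegenerate (R : ℝ → ℝ → ℝ) : Prop :=
  ∀ c d : ℝ, ∀ ν : Measure ℝ, IsProbOn c d ν → 0 < energy R ν

/-- The `n`-th path derivative at time `t`, as a function on the sample space. -/
def pathDeriv {Ω : Type*} (X : ℝ → Ω → ℝ) (n : ℕ) (t : ℝ) (ω : Ω) : ℝ :=
  iteratedDeriv n (fun s => X s ω) t

/-- The paths are (almost surely) infinitely differentiable, and the covariance matrix of
finitely many distinct members of the family `X_t^{(n)}` is always non-singular. -/
def SmoothNondegenerate {Ω : Type*} [MeasurableSpace Ω] (P : Measure Ω)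
    (X : ℝ → Ω → ℝ) : Prop :=
  (∀ᵐ ω ∂P, ContDiff ℝ (⊤ : ℕ∞) fun t => X t ω) ∧
  ∀ T : Finset (ℝ × ℕ),
    (Matrix.of fun i j : T =>
      covariance (pathDeriv X i.1.2 i.1.1) (pathDeriv X j.1.2 j.1.1) P).det ≠ 0

/-- `limsup_{t → ∞} R(s,t) ≤ 0` for every fixed `s ∈ [a,b]`; the upper limit is taken in the
extended reals. -/
def LimsupNonpos (R : ℝ → ℝ → ℝ) (a b : ℝ) : Prop :=
  ∀ s ∈ Set.Icc a b, limsup (fun t : ℝ => ((R s t : ℝ) : EReal)) atTop ≤ 0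

/-- `F` is the spectral measure of a stationary covariance function `R`: a finite symmetric
Borel measure with `R(s,t) = ∫ exp(i(t-s)x) F(dx)`. -/
structure IsSpectralMeasure (R : ℝ → ℝ → ℝ) (F : Measure ℝ) : Prop where
  finite : IsFiniteMeasure F
  symmetric : F.map (fun x => -x) = F
  repr : ∀ s t : ℝ, ((R s t : ℝ) : ℂ) =
    ∫ x : ℝ, Complex.exp (Complex.I * (((t - s) * x : ℝ) : ℂ)) ∂F

/-- The general assumption: smoothness, non-degeneracy and the `limsup` condition. -/
structure AssumptionA {Ω : Type*} [MeasurableSpace Ω] (P : Measure Ω) (X : ℝ → Ω → ℝ)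
    (a b : ℝ) : Prop where
  power : HasPowerExpansion (covFun P X)
  nonneg_nondegenerate : NonnegNondegenerate (covFun P X)
  smooth_nondegenerate : SmoothNondegenerate P X
  limsup_nonpos : LimsupNonpos (covFun P X) a b

/-- The stationary assumption. For a centered Gaussian process stationarity is invariance of
the covariance function, which is the content of its spectral representation. The spectral
measure has all exponential moments, and its support has an accumulation point. -/
def AssumptionB {Ω : Type*} [MeasurableSpace Ω] (P : Measure Ω) (X : ℝ → Ω → ℝ) : Prop :=
  ∃ F : Measure ℝ, IsSpectralMeasure (covFun P X) F ∧
    (∀ t : ℝ, Integrable (fun x => Real.exp (t * x)) F) ∧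
    ∃ x : ℝ, AccPt x (𝓟 F.support)

/-- `c` is the value `E(X_t | X_s = 1 for all s ∈ S)` for a finite set `S`: there is a
continuous `m` with `E(X_t | X_s, s ∈ S) = m((X_s)_{s ∈ S})` almost surely, and `c` is the value
of `m` at the point with all coordinates equal to `1`. If `(X_s)_{s ∈ S}` is a non-degenerate
Gaussian vector, its law has full support, so that `m` exists and is unique. -/
def IsCondMeanAtOne {Ω : Type*} [MeasurableSpace Ω] (P : Measure Ω) (X : ℝ → Ω → ℝ)
    (S : Finset ℝ) (t c : ℝ) : Prop :=
  ∃ m : (S → ℝ) → ℝ, Continuous m ∧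
    condExp (MeasurableSpace.comap (fun (ω : Ω) (s : S) => X s ω) MeasurableSpace.pi) P (X t)
      =ᵐ[P] (fun ω => m fun s => X s ω) ∧
    c = m fun _ => 1

/-- The function `μ(t) = E(X_t | X_s = 1 for all s ∈ S)` for a finite set `S` of times.
(It is constant, by convention, if `S` is infinite.) -/
def condMeanAtOne {Ω : Type*} [MeasurableSpace Ω] (P : Measure Ω) (X : ℝ → Ω → ℝ)
    (S : Set ℝ) (t : ℝ) : ℝ :=
  Classical.epsilon fun c : ℝ => ∃ F : Finset ℝ, (F : Set ℝ) = S ∧ IsCondMeanAtOne P X F t c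

/-- The minimum of a continuous function over `[a,b]`. -/
def minOn (a b : ℝ) (x : ℝ → ℝ) : ℝ := sInf (x '' Set.Icc a b)

/-- The set of points of `[a,b]` at which `x` attains its minimum over `[a,b]`. -/
def argminSet (a b : ℝ) (x : ℝ → ℝ) : Set ℝ :=
  {t | t ∈ Set.Icc a b ∧ ∀ s ∈ Set.Icc a b, x t ≤ x s}

/-- The leftmost location of the minimum of `x` over `[a,b]`. -/
def leftArgmin (a b : ℝ) (x : ℝ → ℝ) : ℝ := sInf (argminSet a b x)

/-- For a continuous function the leftmost location of the minimum is one. -/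
theorem leftArgmin_isLeast {a b : ℝ} (hab : a ≤ b) {x : ℝ → ℝ} (hx : Continuous x) :
    IsLeast (argminSet a b x) (leftArgmin a b x) := by
  have hne : (argminSet a b x).Nonempty := by
    obtain ⟨t, ht, hmin⟩ := isCompact_Icc.exists_isMinOn (Set.nonempty_Icc.mpr hab)
      hx.continuousOn
    exact ⟨t, ht, fun s hs => hmin hs⟩
  have hcl : IsClosed (argminSet a b x) := by
    have : argminSet a b x = Set.Icc a b ∩ ⋂ s ∈ Set.Icc a b, {t | x t ≤ x s} := by
      ext t; simp [argminSet]
    rw [this]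
    exact isClosed_Icc.inter
      (isClosed_biInter fun s _ => isClosed_le hx continuous_const)
  have hbd : BddBelow (argminSet a b x) := ⟨a, fun t ht => ht.1.1⟩
  exact ⟨hcl.csInf_mem hne hbd, fun t ht => csInf_le hbd ht⟩

/-- The event `{min_{t ∈ [a,b]} X_t > u}`. -/
def highEvent {Ω : Type*} (X : ℝ → Ω → ℝ) (a b u : ℝ) : Set Ω :=
  {ω | u < minOn a b fun t => X t ω}

/-- The leftmost location of the minimum of the process over `[a,b]`. -/
def argminLoc {Ω : Type*} (X : ℝ → Ω → ℝ) (a b : ℝ) (ω : Ω) : ℝ :=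
  leftArgmin a b fun t => X t ω

end HighMinima

end

/-! View the process as a continuous curve `x` in L², so that the energy of a measure is the squared
norm of its barycenter. Compactness gives a minimizer `ν`. With `w` its barycenter, the first order
condition says that `⟨x t, w⟩ ≥ ‖w‖²` on `[a,b]`, with equality on the support. When the support is
a finite set `F`, let `A_i(t)` be the regression coefficients of `X_t` on `(X_i)_{i ∈ F}`; the
excess `q(t) = Σ A_i(t) - 1` equals `⟨x t, w⟩ / ‖w‖² - 1`. It is therefore nonnegative on `[a,b]`
and zero on `F`. It is analytic and not identically zero, so it has finitely many zeros in `[a,b]`;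
linear independence of the process at these zeros then makes `ν` unique.

For the limit law write `X_t = Σ A_i(t) X_i + Y_t`, where the residual `Y` is independent of `(X_i)`
and vanishes on `F`, and substitute `X_i = u + v_i / u`. The rescaled path `u (X_t - u)` becomes `u²
q(t) + u Y_t + Σ v_i A_i(t)`. Up to a factor depending only on `u`, the Gaussian density of `v`
becomes `exp(-l · v)` times a factor tending to one, where `l = G⁻¹ 1` for the Gram matrix `G`. By
the equality on the support, `l_i = ν{i} / ‖w‖²`.

Fix `Y`. Near an interior point `i` of `F`, where `q'' > 0`, the minimum of `u² q + u Y` converges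
to `-c_i`, with `c_i = Y'(i)² / (2 q''(i))`, so the rescaled path has a local minimum close to `v_i
- c_i`. End points are treated case by case. At a zero of `q` outside `F` the sign of `Y` decides:
either the path is large there or the exceedance fails. The minimum is thus located by a race
between the numbers `v_i - c_i`, all required to be positive. For exponential densities, the lack of
memory makes the weight of a win at `j` equal to `J · l_j`, where `J` depends on `Y` but not on `j`
(`integral_raceSet`). Hence averaging over `Y` leaves the proportions `l_j`, that is, `ν`. The
average of `J` is positive because the variables deciding the signs form a nondegenerate Gaussian
vector.

Both assumptions enter only through `IsRegular`: an analytic covariance, almost sure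
differentiability at each time, linear independence of values and first derivatives, and
nonconstancy of `⟨x s, w⟩`. Under (a) these come almost directly from the hypotheses. Under (b) they
come from the isometry between the process and the waves `x ↦ exp(i t x)` in L² of the spectral
measure. -/

namespace HighMinima

/-! ### Localized asymptotics of minima -/

/-- Near `z`, the functions `g u` are eventually larger than `m` on `K`. -/
def LocalLower (g : ℝ → ℝ → ℝ) (K : Set ℝ) (z m : ℝ) : Prop :=
  ∀ᶠ p : ℝ × ℝ in atTop ×ˢ 𝓝[K] z, m < g p.1 p.2

/-- In each neighbourhood of `z` in `K`, the functions `g u` eventually take values below `m`. -/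
def LocalUpper (g : ℝ → ℝ → ℝ) (K : Set ℝ) (z m : ℝ) : Prop :=
  ∀ N ∈ 𝓝[K] z, ∀ᶠ u in atTop, ∃ t ∈ N, g u t < m

/-- The local minimum of `g u` near `z` converges to `l`. -/
def LocalLimit (g : ℝ → ℝ → ℝ) (K : Set ℝ) (z l : ℝ) : Prop :=
  (∀ m < l, LocalLower g K z m) ∧ ∀ m > l, LocalUpper g K z m

lemma LocalLower.mono {g : ℝ → ℝ → ℝ} {K : Set ℝ} {z m m' : ℝ} (h : LocalLower g K z m)
    (hm : m' ≤ m) : LocalLower g K z m' := by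
  filter_upwards [h] with p hp using hm.trans_lt hp

lemma LocalLower.add_continuous {g : ℝ → ℝ → ℝ} {K : Set ℝ} {z : ℝ} {α : ℝ → ℝ}
    (hα : ContinuousWithinAt α K z) {m l : ℝ} (hl : LocalLower g K z l) (hm : m < l + α z) :
    LocalLower (fun u t => g u t + α t) K z m := by
  have h1 : ∀ᶠ t in 𝓝[K] z, m - l < α t := hα.eventually_const_lt (by linarith)
  have h2 : ∀ᶠ p : ℝ × ℝ in atTop ×ˢ 𝓝[K] z, m - l < α p.2 := tendsto_snd.eventually h1
  filter_upwards [hl, h2] with p h3 h4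
  linarith

lemma LocalUpper.add_continuous {g : ℝ → ℝ → ℝ} {K : Set ℝ} {z : ℝ} {α : ℝ → ℝ}
    (hα : ContinuousWithinAt α K z) {m l : ℝ} (hl : LocalUpper g K z l) (hm : l + α z < m) :
    LocalUpper (fun u t => g u t + α t) K z m := by
  intro N hN
  have h1 : ∀ᶠ t in 𝓝[K] z, α t < m - l := hα.eventually_lt_const (by linarith)
  filter_upwards [hl _ (inter_mem hN h1)] with u hu
  obtain ⟨t, ⟨htN, ht⟩, hlt⟩ := hu
  refine ⟨t, htN, ?_⟩
  simp only [Set.mem_ofPred_eq] at ht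
  linarith

/-- This reduces the rescaled path to `u² q + u y`: the remaining term `Σ v_i A_i(t)` is continuous
and does not depend on `u`. -/
lemma LocalLimit.add_continuous {g : ℝ → ℝ → ℝ} {K : Set ℝ} {z l : ℝ} {α : ℝ → ℝ}
    (hα : ContinuousWithinAt α K z) (h : LocalLimit g K z l) :
    LocalLimit (fun u t => g u t + α t) K z (l + α z) := by
  refine ⟨fun m hm => ?_, fun m hm => ?_⟩
  · exact (h.1 ((l + m - α z) / 2) (by linarith)).add_continuous hα (by linarith)
  · exact (h.2 ((l + m - α z) / 2) (by linarith)).add_continuous hα (by linarith)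

/-- If the local minima of `g u` have a unique smallest limit, which is positive, then eventually
`g u` is positive and is minimal only close to the corresponding point. -/
lemma eventually_pos_and_argmin_near {g : ℝ → ℝ → ℝ} {K : Set ℝ} (hK : IsCompact K) {z l : ℝ}
    (hz : z ∈ K) (hl : 0 < l) (hlim : LocalLimit g K z l)
    (hother : ∀ y ∈ K, y ≠ z → ∃ m > l, LocalLower g K y m) :
    (∀ᶠ u in atTop, ∀ t ∈ K, 0 < g u t) ∧
    ∀ N ∈ 𝓝 z, ∀ᶠ u in atTop, ∀ t ∈ K, (∀ s ∈ K, g u t ≤ g u s) → t ∈ N := by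
  constructor
  · have h : ∀ y ∈ K, ∃ t ∈ 𝓝[K] y, ∀ᶠ u in atTop, ∀ s ∈ t, 0 < g u s := by
      intro y hy
      have : LocalLower g K y 0 := by
        by_cases hyz : y = z
        · subst hyz; exact hlim.1 0 hl
        · obtain ⟨m, hm, h⟩ := hother y hy hyz
          exact h.mono (by linarith)
      obtain ⟨pa, ha, pb, hb, hab⟩ := eventually_prod_iff.mp this
      exact ⟨{s | pb s}, hb, ha.mono fun u hu s hs => hab hu hs⟩
    refine hK.induction_on (p := fun t => ∀ᶠ u in atTop, ∀ s ∈ t, 0 < g u s) (by simp)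
      (fun s t hst ht => ht.mono fun u hu x hx => hu x (hst hx))
      (fun s t hs ht => by
        filter_upwards [hs, ht] with u h1 h2 x hx using hx.elim (h1 x) (h2 x)) h
  · intro N hN
    obtain ⟨O, hON, hO, hzO⟩ := mem_nhds_iff.mp hN
    have hK' : IsCompact (K \ O) := hK.diff hO
    -- By compactness the margins at the individual points merge into one margin away from `z`.
    have h : ∃ m > l, ∀ᶠ u in atTop, ∀ s ∈ K \ O, m < g u s := by
      refine hK'.induction_on (p := fun t => ∃ m > l, ∀ᶠ u in atTop, ∀ s ∈ t, m < g u s)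
        ⟨l + 1, by simp, by simp⟩
        (fun s t hst ⟨m, hm, ht⟩ => ⟨m, hm, ht.mono fun u hu x hx => hu x (hst hx)⟩)
        (fun s t ⟨m, hm, hs⟩ ⟨m', hm', ht⟩ => ⟨min m m', lt_min hm hm', by
          filter_upwards [hs, ht] with u h1 h2 x hx
          exact hx.elim (fun h => (min_le_left _ _).trans_lt (h1 x h))
            (fun h => (min_le_right _ _).trans_lt (h2 x h))⟩) ?_
      rintro y ⟨hy, hyO⟩
      obtain ⟨m, hm, h⟩ := hother y hy (fun h => hyO (h ▸ hzO))
      obtain ⟨pa, ha, pb, hb, hab⟩ := eventually_prod_iff.mp h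
      exact ⟨{s | pb s}, nhdsWithin_mono _ Set.sdiff_subset hb, m, hm,
        ha.mono fun u hu s hs => hab hu hs⟩
    obtain ⟨m, hm, h⟩ := h
    have hU := hlim.2 m hm K self_mem_nhdsWithin
    filter_upwards [h, hU] with u h1 ⟨s, hsK, hs⟩ t ht hmin
    by_contra htN
    have := h1 t ⟨ht, fun hh => htN (hON hh)⟩
    have := hmin s hsK
    linarith

/-! ### Local minima of `u² q + u y` near a point -/

section Cost

variable {q y : ℝ → ℝ} {K : Set ℝ} {z : ℝ}

lemma localLower_of_pos (hq : ContinuousWithinAt q K z) (hy : ContinuousWithinAt y K z)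
    (hqz : 0 < q z) (m : ℝ) : LocalLower (fun u t => u ^ 2 * q t + u * y t) K z m := by
  have h1 : ∀ᶠ t in 𝓝[K] z, q z / 2 < q t := hq.eventually_const_lt (by linarith)
  have h2 : ∀ᶠ t in 𝓝[K] z, y z - 1 < y t := hy.eventually_const_lt (by linarith)
  have h3 : Tendsto (fun u : ℝ => u * (u * (q z / 2) + (y z - 1))) atTop atTop :=
    tendsto_id.atTop_mul_atTop₀ (tendsto_atTop_add_const_right _ _
      (tendsto_id.atTop_mul_const (by linarith)))
  filter_upwards [tendsto_snd.eventually h1, tendsto_snd.eventually h2,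
    tendsto_fst.eventually (h3.eventually_gt_atTop m),
    tendsto_fst.eventually (eventually_gt_atTop (0 : ℝ))] with p h1 h2 h3 h4
  have := mul_lt_mul_of_pos_left h1 (pow_pos h4 2)
  have := mul_lt_mul_of_pos_left h2 h4
  nlinarith

/-- At a zero of `q` the linear term decides: for `y z > 0` it forces divergence to `+∞`, while `y z
< 0` rules out an exceedance. -/
lemma localLower_of_nonneg_of_pos (hq : ∀ t ∈ K, 0 ≤ q t) (hy : ContinuousWithinAt y K z)
    (hyz : 0 < y z) (m : ℝ) : LocalLower (fun u t => u ^ 2 * q t + u * y t) K z m := by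
  have h2 : ∀ᶠ t in 𝓝[K] z, y z / 2 < y t := hy.eventually_const_lt (by linarith)
  have h3 : Tendsto (fun u : ℝ => u * (y z / 2)) atTop atTop :=
      (tendsto_id.atTop_mul_const (by linarith))
  have h1 : ∀ᶠ t in 𝓝[K] z, t ∈ K := self_mem_nhdsWithin
  filter_upwards [tendsto_snd.eventually h1, tendsto_snd.eventually h2,
    tendsto_fst.eventually (h3.eventually_gt_atTop m),
    tendsto_fst.eventually (eventually_gt_atTop (0 : ℝ))] with p h1 h2 h3 h4
  have := mul_nonneg (pow_pos h4 2).le (hq _ h1)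
  have := mul_lt_mul_of_pos_left h2 h4
  linarith

lemma localUpper_of_neg (hz : z ∈ K) (hqz : q z = 0) (hyz : y z < 0) (m : ℝ) :
    LocalUpper (fun u t => u ^ 2 * q t + u * y t) K z m := by
  intro N hN
  have h3 : Tendsto (fun u : ℝ => u * y z) atTop atBot :=
      (tendsto_id.atTop_mul_const_of_neg (by linarith))
  filter_upwards [h3.eventually_lt_atBot m] with u hu
  exact ⟨z, mem_of_mem_nhdsWithin hz hN, by simpa [hqz] using hu⟩

/-- Blow-up of the local minimum at scale `1/u`. -/
lemma localUpper_of_scaling (q1 κ Z x : ℝ)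
    (hq : (fun t => q t - (q1 * (t - z) + κ / 2 * (t - z) ^ 2)) =o[𝓝[K] z] fun t => (t - z) ^ 2)
    (hy : (fun t => y t - Z * (t - z)) =o[𝓝[K] z] fun t => t - z)
    (hx : ∀ᶠ u in atTop, z + x / u ∈ K) (hq1 : q1 * x = 0) (m : ℝ)
    (hm : κ / 2 * x ^ 2 + Z * x < m) :
    LocalUpper (fun u t => u ^ 2 * q t + u * y t) K z m := by
  have hlim : Tendsto (fun u : ℝ => z + x / u) atTop (𝓝[K] z) := by
    refine tendsto_nhdsWithin_iff.mpr ⟨?_, hx⟩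
    simpa using (tendsto_const_nhds (x := x)).div_atTop tendsto_id |>.const_add z
  -- At `z + x / u` the two remainders contribute at most `η (x² + |x|)` after scaling, which this
  -- choice keeps below the gap to `m`.
  set η := (m - (κ / 2 * x ^ 2 + Z * x)) / (2 * (x ^ 2 + |x| + 1)) with hη
  have hD : 0 < x ^ 2 + |x| + 1 := by positivity
  have hη0 : 0 < η := div_pos (by linarith) (by positivity)
  have hη1 : η * (x ^ 2 + |x|) < m - (κ / 2 * x ^ 2 + Z * x) := by
    have h2 : η * (2 * (x ^ 2 + |x| + 1)) = m - (κ / 2 * x ^ 2 + Z * x) := by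
      rw [hη]; field_simp
    nlinarith [abs_nonneg x, sq_nonneg x]
  intro N hN
  filter_upwards [hlim.eventually (hq.bound hη0), hlim.eventually (hy.bound hη0),
    hlim.eventually hN, eventually_gt_atTop 0] with u h1 h2 h3 h4
  refine ⟨_, h3, ?_⟩
  simp only [Real.norm_eq_abs, add_sub_cancel_left, abs_pow, abs_div, abs_of_pos h4]
    at h1 h2
  have e1 := (abs_le.mp h1).2
  have e2 := (abs_le.mp h2).2
  have e1' := mul_le_mul_of_nonneg_left e1 (pow_pos h4 2).le
  have e2' := mul_le_mul_of_nonneg_left e2 h4.le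
  have f1 : u ^ 2 * (η * (|x| / u) ^ 2) = η * x ^ 2 := by
    rw [div_pow, sq_abs]; field_simp
  have f2 : u * (η * (|x| / u)) = η * |x| := by field_simp
  have f3 : u ^ 2 * (q1 * (x / u) + κ / 2 * (x / u) ^ 2) = κ / 2 * x ^ 2 := by
    have : q1 * (x / u) = 0 := by rw [← mul_div_assoc, hq1, zero_div]
    rw [this]; field_simp; ring
  have f4 : u * (Z * (x / u)) = Z * x := by field_simp
  rw [mul_sub, f1, f3] at e1'
  rw [mul_sub, f2, f4] at e2'
  nlinarith

/-- The local minimum at a quadratic zero of `q`. -/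
lemma localLimit_of_quadratic (κ Z : ℝ) (hκ : 0 < κ)
    (hq : (fun t => q t - (0 * (t - z) + κ / 2 * (t - z) ^ 2)) =o[𝓝[K] z] fun t => (t - z) ^ 2)
    (hy : (fun t => y t - Z * (t - z)) =o[𝓝[K] z] fun t => t - z)
    (hx : ∀ᶠ u in atTop, z + (- Z / κ) / u ∈ K) :
    LocalLimit (fun u t => u ^ 2 * q t + u * y t) K z (-(Z ^ 2 / (2 * κ))) := by
  constructor
  · intro m hm
    -- With relative errors `η` in both expansions, completing the square bounds the function below
    -- by minus this quotient.
    have hc : Tendsto (fun η : ℝ => (|Z| + η) ^ 2 / (2 * (κ - 2 * η))) (𝓝[>] 0)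
        (𝓝 (Z ^ 2 / (2 * κ))) := by
      have : ContinuousAt (fun η : ℝ => (|Z| + η) ^ 2 / (2 * (κ - 2 * η))) 0 := by
        refine ContinuousAt.div (by fun_prop) (by fun_prop) (by simp; linarith)
      have h := this.tendsto
      simp only [add_zero, mul_zero, sub_zero, sq_abs] at h
      exact h.mono_left nhdsWithin_le_nhds
    have hsmall : ∀ᶠ η : ℝ in 𝓝[>] 0, η < κ / 2 :=
      nhdsWithin_le_nhds (eventually_lt_nhds (by linarith))
    obtain ⟨η, hη, hη2, hη0⟩ := ((hc.eventually_lt_const (show Z ^ 2 / (2 * κ) < -m by linarith)).and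
      (hsmall.and self_mem_nhdsWithin)).exists
    have hη0 : 0 < η := hη0
    filter_upwards [tendsto_snd.eventually (hq.bound hη0), tendsto_snd.eventually (hy.bound hη0),
      tendsto_fst.eventually (eventually_gt_atTop (0 : ℝ))] with p h1 h2 h4
    set h := p.2 - z
    set u := p.1
    simp only [Real.norm_eq_abs, abs_pow, sq_abs] at h1 h2
    have e1 := mul_le_mul_of_nonneg_left (abs_le.mp h1).1 (pow_pos h4 2).le
    have e2 := mul_le_mul_of_nonneg_left (abs_le.mp h2).1 h4.le
    have hD : 0 < 2 * (κ - 2 * η) := by linarith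
    rw [div_lt_iff₀ hD] at hη
    have hZ : -(|Z| * |h|) ≤ Z * h := by rw [← abs_mul]; exact neg_abs_le _
    have hZ' := mul_le_mul_of_nonneg_left hZ h4.le
    have hs : (κ - 2 * η) * (u * |h|) * ((κ - 2 * η) * (u * |h|)) + (|Z| + η) ^ 2
        ≥ 2 * ((κ - 2 * η) * (u * |h|)) * (|Z| + η) := by
      nlinarith [sq_nonneg ((κ - 2 * η) * (u * |h|) - (|Z| + η))]
    have hh : |h| * |h| = h ^ 2 := by rw [← sq, sq_abs]
    have key : -(|Z| + η) ^ 2 ≤ (2 * (κ - 2 * η)) *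
        (u ^ 2 * ((κ / 2 - η) * h ^ 2) - u * ((|Z| + η) * |h|)) := by
      rw [← hh]; nlinarith
    have key2 : u ^ 2 * ((κ / 2 - η) * h ^ 2) - u * ((|Z| + η) * |h|)
        ≤ u ^ 2 * q p.2 + u * y p.2 := by
      nlinarith
    have : (2 * (κ - 2 * η)) * m < (2 * (κ - 2 * η)) * (u ^ 2 * q p.2 + u * y p.2) := by
      have := mul_le_mul_of_nonneg_left key2 hD.le
      linarith
    exact lt_of_mul_lt_mul_left this hD.le
  · intro m hm
    refine localUpper_of_scaling 0 κ Z (-Z / κ) hq hy hx (by simp) m ?_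
    have : κ / 2 * (-Z / κ) ^ 2 + Z * (-Z / κ) = -(Z ^ 2 / (2 * κ)) := by field_simp; ring
    linarith

lemma localUpper_zero (hz : z ∈ K) (hqz : q z = 0) (hyz : y z = 0) {m : ℝ} (hm : 0 < m) :
    LocalUpper (fun u t => u ^ 2 * q t + u * y t) K z m := fun N hN =>
  Eventually.of_forall fun u => ⟨z, mem_of_mem_nhdsWithin hz hN, by simpa [hqz, hyz] using hm⟩

/-- At an end point, where `e = ±1` is the inward direction. -/
lemma localLimit_zero_of_inward (e Z : ℝ) (hz : z ∈ K) (hqz : q z = 0) (hyz : y z = 0)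
    (hK : ∀ t ∈ K, 0 ≤ e * (t - z)) (he : e * e = 1) (hq : ∀ t ∈ K, 0 ≤ q t)
    (hy : (fun t => y t - Z * (t - z)) =o[𝓝[K] z] fun t => t - z) (hZ : 0 < e * Z) :
    LocalLimit (fun u t => u ^ 2 * q t + u * y t) K z 0 := by
  refine ⟨fun m hm => ?_, fun m hm => localUpper_zero hz hqz hyz hm⟩
  have h1 : ∀ᶠ t in 𝓝[K] z, t ∈ K := self_mem_nhdsWithin
  filter_upwards [tendsto_snd.eventually h1, tendsto_snd.eventually (hy.bound hZ),
    tendsto_fst.eventually (eventually_gt_atTop (0 : ℝ))] with p h1 h2 h4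
  have e2 := (abs_le.mp h2).1
  have habs : |p.2 - z| = e * (p.2 - z) := by
    rw [← abs_of_nonneg (hK _ h1), abs_mul]
    have : |e| = 1 := by
      have : |e| * |e| = 1 := by rw [← abs_mul, he, abs_one]
      nlinarith [abs_nonneg e]
    rw [this, one_mul]
  rw [Real.norm_eq_abs, habs] at e2
  have : e * Z * (e * (p.2 - z)) = Z * (p.2 - z) := by
    linear_combination Z * (p.2 - z) * he
  have h5 : 0 ≤ y p.2 := by linarith
  have := mul_nonneg (pow_pos h4 2).le (hq _ h1)
  have := mul_nonneg h4.le h5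
  linarith

/-- The first order growth of `u² q` into `K` beats that of `u y`, whatever the sign of `Z`, as soon
as `u e q1 / 2 > |Z| + 1`. The minimum is then attained at `z` itself. -/
lemma localLimit_zero_of_slope (e Z q1 : ℝ) (hz : z ∈ K) (hqz : q z = 0) (hyz : y z = 0)
    (hK : ∀ t ∈ K, 0 ≤ e * (t - z)) (he : e * e = 1)
    (hq : (fun t => q t - q1 * (t - z)) =o[𝓝[K] z] fun t => t - z)
    (hy : (fun t => y t - Z * (t - z)) =o[𝓝[K] z] fun t => t - z) (hq1 : 0 < e * q1) :
    LocalLimit (fun u t => u ^ 2 * q t + u * y t) K z 0 := by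
  refine ⟨fun m hm => ?_, fun m hm => localUpper_zero hz hqz hyz hm⟩
  have h1 : ∀ᶠ t in 𝓝[K] z, t ∈ K := self_mem_nhdsWithin
  filter_upwards [tendsto_snd.eventually h1, tendsto_snd.eventually (hy.bound one_pos),
    tendsto_snd.eventually (hq.bound (half_pos hq1)),
    tendsto_fst.eventually (eventually_gt_atTop ((|Z| + 1) / (e * q1 / 2))),
    tendsto_fst.eventually (eventually_gt_atTop (0 : ℝ))] with p h1 h2 h3 h4 h5
  have e2 := (abs_le.mp h2).1
  have e3 := (abs_le.mp h3).1
  have e1 : |e| = 1 := by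
    have : |e| * |e| = 1 := by rw [← abs_mul, he, abs_one]
    nlinarith [abs_nonneg e]
  have habs : |p.2 - z| = e * (p.2 - z) := by
    rw [← abs_of_nonneg (hK _ h1), abs_mul, e1, one_mul]
  have h0 := hK _ h1
  have hZ : -(|Z| * |p.2 - z|) ≤ Z * (p.2 - z) := by rw [← abs_mul]; exact neg_abs_le _
  rw [Real.norm_eq_abs, habs] at e2 e3
  rw [habs] at hZ
  have r1 : e * q1 * (e * (p.2 - z)) = q1 * (p.2 - z) := by
    linear_combination q1 * (p.2 - z) * he
  have h6 : e * q1 / 2 * (e * (p.2 - z)) ≤ q p.2 := by linarith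
  have h7 : -((|Z| + 1) * (e * (p.2 - z))) ≤ y p.2 := by linarith
  rw [div_lt_iff₀ (half_pos hq1)] at h4
  have h8 := mul_le_mul_of_nonneg_left h6 (pow_pos h5 2).le
  have h9 := mul_le_mul_of_nonneg_left h7 h5.le
  have h10 := mul_nonneg (mul_nonneg h5.le h0) (sub_nonneg.mpr h4.le)
  nlinarith

/-- The local minimum at a zero of `q` and `y` in an end point. -/
lemma endpoint_cost (e Z q1 κ : ℝ) (hz : z ∈ K) (hqz : q z = 0) (hyz : y z = 0)
    (hK : ∀ t ∈ K, 0 ≤ e * (t - z)) (he : e * e = 1)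
    (hK' : ∀ x ≥ 0, ∀ᶠ u in atTop, z + (e * x) / u ∈ K)
    (hq0 : ∀ t ∈ K, 0 ≤ q t)
    (hq : (fun t => q t - (q1 * (t - z) + κ / 2 * (t - z) ^ 2)) =o[𝓝[K] z] fun t => (t - z) ^ 2)
    (hq' : (fun t => q t - q1 * (t - z)) =o[𝓝[K] z] fun t => t - z)
    (hy : (fun t => y t - Z * (t - z)) =o[𝓝[K] z] fun t => t - z)
    (hZ : Z ≠ 0) (hq1 : 0 ≤ e * q1) (hκ : q1 = 0 → 0 ≤ κ) :
    (∃ c, 0 ≤ c ∧ LocalLimit (fun u t => u ^ 2 * q t + u * y t) K z (-c)) ∨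
    (e * Z < 0 ∧ ∀ m, LocalUpper (fun u t => u ^ 2 * q t + u * y t) K z m) := by
  have he0 : e ≠ 0 := by rintro rfl; simp at he
  -- `e * Z` is the inward slope of `y`. Only a negative one can push the minimum below zero, and
  -- then the first nonvanishing coefficient of `q` decides by how much.
  rcases lt_trichotomy (e * Z) 0 with hneg | h0 | hpos
  · rcases hq1.eq_or_lt with h | h
    · have hq10 : q1 = 0 := by simpa [he0] using h.symm
      subst hq10
      rcases (hκ rfl).eq_or_lt with h2 | h2
      · right
        refine ⟨hneg, fun m => ?_⟩
        subst h2
        -- The displacement is chosen so that `Z * x = -(|m| + 1)`; with `q` flat to second order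
        -- nothing compensates it.
        refine localUpper_of_scaling 0 0 Z (e * ((|m| + 1) / (-(e * Z)))) hq hy
          (hK' _ (div_nonneg (by positivity) (by linarith))) (by simp) m ?_
        have : Z * (e * ((|m| + 1) / -(e * Z))) = -(|m| + 1) := by
          have : e * Z ≠ 0 := hneg.ne
          field_simp
        rw [this]
        have := neg_abs_le m
        linarith
      · left
        refine ⟨Z ^ 2 / (2 * κ), by positivity, localLimit_of_quadratic κ Z h2 hq hy ?_⟩
        have := hK' (-(e * Z) / κ) (div_nonneg (by linarith) h2.le)
        have h3 : e * (-(e * Z) / κ) = -Z / κ := by linear_combination (-Z / κ) * he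
        rwa [h3] at this
    · left
      exact ⟨0, le_rfl, by
        simpa using localLimit_zero_of_slope e Z q1 hz hqz hyz hK he hq' hy h⟩
  · exact absurd h0 (mul_ne_zero he0 hZ)
  · left
    exact ⟨0, le_rfl, by simpa using localLimit_zero_of_inward e Z hz hqz hyz hK he hq0 hy hpos⟩

end Cost

/-! ### A race between independent exponential variables -/

section Race

variable {ι : Type*} [Fintype ι]

/-- The open positive orthant. -/
def orthant (ι : Type*) : Set (ι → ℝ) := {v | ∀ i, 0 < v i}

lemma measurableSet_orthant : MeasurableSet (orthant ι) := by
  have : orthant ι = ⋂ i, {v : ι → ℝ | 0 < v i} := by ext; simp [orthant]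
  rw [this]
  exact MeasurableSet.iInter fun i => measurableSet_lt measurable_const (measurable_pi_apply i)

/-- The points where `v - c` is positive and has its unique smallest coordinate at `j`. -/
def raceSet (c : ι → ℝ) (j : ι) : Set (ι → ℝ) :=
  {v | c j < v j ∧ ∀ i, i ≠ j → v j - c j < v i - c i}

lemma measurableSet_raceSet (c : ι → ℝ) (j : ι) : MeasurableSet (raceSet c j) := by
  have : raceSet c j = {v : ι → ℝ | c j < v j} ∩
      ⋂ i, ⋂ (_ : i ≠ j), {v : ι → ℝ | v j - c j < v i - c i} := by ext; simp [raceSet]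
  rw [this]
  refine (measurableSet_lt (by fun_prop) (by fun_prop)).inter ?_
  exact MeasurableSet.iInter fun i => MeasurableSet.iInter fun _ =>
    measurableSet_lt (by fun_prop) (by fun_prop)

lemma indicator_orthant_exp_eq_prod (l v : ι → ℝ) :
    (orthant ι).indicator (fun v => Real.exp (-∑ i, l i * v i)) v =
      ∏ i, (Set.Ioi (0 : ℝ)).indicator (fun x => Real.exp (-l i * x)) (v i) := by
  by_cases h : v ∈ orthant ι
  · rw [Set.indicator_of_mem h, ← Finset.sum_neg_distrib, Real.exp_sum]
    refine Finset.prod_congr rfl fun i _ => ?_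
    rw [Set.indicator_of_mem (show v i ∈ Set.Ioi 0 from h i), neg_mul]
  · rw [Set.indicator_of_notMem h]
    simp only [orthant, Set.mem_ofPred_eq, not_forall] at h
    obtain ⟨i, hi⟩ := h
    exact (Finset.prod_eq_zero (Finset.mem_univ i) (Set.indicator_of_notMem hi _)).symm

lemma integrable_indicator_orthant_exp {l : ι → ℝ} (hl : ∀ i, 0 < l i) :
    Integrable ((orthant ι).indicator fun v => Real.exp (-∑ i, l i * v i)) := by
  have : (orthant ι).indicator (fun v => Real.exp (-∑ i, l i * v i)) =
    fun v => ∏ i, (Set.Ioi (0 : ℝ)).indicator (fun x => Real.exp (-l i * x)) (v i) :=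
    funext fun v => indicator_orthant_exp_eq_prod l v
  rw [this]
  refine Integrable.fintype_prod
    (f := fun i => (Set.Ioi (0 : ℝ)).indicator (fun x => Real.exp (-l i * x))) fun i => ?_
  exact (integrable_indicator_iff measurableSet_Ioi).mpr
    (integrableOn_exp_mul_Ioi (by simpa using hl i) 0)

lemma integral_indicator_orthant_exp {l : ι → ℝ} (hl : ∀ i, 0 < l i) :
    ∫ v, (orthant ι).indicator (fun v => Real.exp (-∑ i, l i * v i)) v = ∏ i, (l i)⁻¹ := by
  simp_rw [indicator_orthant_exp_eq_prod]
  rw [integral_fintype_prod_volume_eq_prod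
    (f := fun i => (Set.Ioi (0 : ℝ)).indicator (fun x => Real.exp (-l i * x)))]
  refine Finset.prod_congr rfl fun i _ => ?_
  rw [integral_indicator measurableSet_Ioi, integral_exp_mul_Ioi (by simpa using hl i)]
  simp

/-- Almost every vector stays clear of ties. -/
lemma ae_no_ties (c : ι → ℝ) :
    ∀ᵐ v : ι → ℝ, (∀ i, v i ≠ c i) ∧ ∀ i j, i ≠ j → v i - c i ≠ v j - c j := by
  classical
  refine (ae_all_iff.mpr fun i => ?_).and
    (ae_all_iff.mpr fun i => ae_all_iff.mpr fun j => ?_)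
  · have := Measure.pi_hyperplane (fun _ : ι => (volume : Measure ℝ)) i (c i)
    rw [ae_iff]
    simpa [volume_pi] using this
  · by_cases hij : i = j
    · simp [hij]
    simp only [ne_eq, hij, not_false_eq_true, true_imp_iff]
    -- The set of ties is a translate of this proper subspace.
    set W : Submodule ℝ (ι → ℝ) :=
      LinearMap.ker (LinearMap.proj (R := ℝ) (φ := fun _ : ι => ℝ) i - LinearMap.proj j) with hW
    have hWt : W ≠ ⊤ := by
      intro h
      have : (Pi.single i 1 : ι → ℝ) ∈ W := by rw [h]; trivial
      simp [hW, Ne.symm hij] at this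
    have h0 : volume (W : Set (ι → ℝ)) = 0 := Measure.addHaar_submodule _ _ hWt
    have h1 := measure_preimage_add_right (volume : Measure (ι → ℝ)) (-c) (W : Set (ι → ℝ))
    rw [h0] at h1
    rw [ae_iff]
    convert h1 using 2
    ext v
    simp only [not_not, Set.mem_ofPred_eq, Set.mem_preimage, SetLike.mem_coe, hW,
      LinearMap.mem_ker, LinearMap.sub_apply, LinearMap.proj_apply, Pi.add_apply, Pi.neg_apply,
      sub_eq_zero]
    simp only [sub_eq_add_neg]

variable [DecidableEq ι]

/-- The shear adding the coordinate `j` to all other coordinates. -/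
def shearMatrix (j : ι) : Matrix ι ι ℝ :=
  1 + Matrix.replicateCol Unit (fun i => if i = j then (0 : ℝ) else 1) *
    Matrix.replicateRow Unit (Pi.single j (1 : ℝ))

lemma det_shearMatrix (j : ι) : (shearMatrix j).det = 1 := by
  rw [shearMatrix, Matrix.det_one_add_replicateCol_mul_replicateRow]
  simp

lemma shearMatrix_mulVec (j : ι) (v : ι → ℝ) (i : ι) :
    (shearMatrix j).mulVec v i = v i + if i = j then 0 else v j := by
  simp [shearMatrix, Matrix.mulVec, dotProduct, Matrix.mul_apply,
    Pi.single_apply, Matrix.one_apply, add_mul, Finset.sum_add_distrib]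

lemma measurePreserving_shear (j : ι) :
    MeasurePreserving (Matrix.toLin' (shearMatrix j)) volume volume := by
  refine ⟨(LinearMap.continuous_of_finiteDimensional _).measurable, ?_⟩
  rw [Real.map_matrix_volume_pi_eq_smul_volume_pi (by rw [det_shearMatrix]; exact one_ne_zero),
    det_shearMatrix]
  simp

/-- The probability that an exponential variable is the smallest one of an independent family. -/
lemma integral_raceSet {l : ι → ℝ} (hl : ∀ i, 0 < l i) (c : ι → ℝ) (j : ι) :
    ∫ v, (raceSet c j).indicator (fun v => Real.exp (-∑ i, l i * v i)) v =
      Real.exp (-∑ i, l i * c i) * (∏ i, (l i)⁻¹) / (∑ i, l i) * l j := by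
  have hS : 0 < ∑ i, l i := Finset.sum_pos (fun i _ => hl i) ⟨j, Finset.mem_univ j⟩
  set F := (raceSet c j).indicator (fun v => Real.exp (-∑ i, l i * v i)) with hF
  have hFm : Measurable F :=
    (Real.measurable_exp.comp (by fun_prop)).indicator (measurableSet_raceSet c j)
  -- The substitution `v_j = c_j + w_j`, `v_i = c_i + w_i + w_j` for `i ≠ j` preserves volume and
  -- identifies the orthant with the race set.
  have h1 : ∫ v, F v = ∫ w, F (Matrix.toLin' (shearMatrix j) w + c) := by
    rw [← integral_add_right_eq_self (μ := volume) F c,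
      ← (measurePreserving_shear j).map_eq, integral_map, (measurePreserving_shear j).map_eq]
    · exact (measurePreserving_shear j).measurable.aemeasurable
    · exact (hFm.comp (measurable_add_const c)).aestronglyMeasurable
  -- Since `w_j` enters every coordinate of `v`, it carries the total rate. The missing factor `(l
  -- j)⁻¹` is what makes the result proportional to `l j`.
  set l' : ι → ℝ := Function.update l j (∑ i, l i) with hl'
  have hl'0 : ∀ i, 0 < l' i := by
    intro i
    rcases eq_or_ne i j with rfl | h
    · simpa [hl'] using hS
    · simpa [hl', h] using hl i
  have h2 : ∀ w, F (Matrix.toLin' (shearMatrix j) w + c) = Real.exp (-∑ i, l i * c i) *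
      (orthant ι).indicator (fun v => Real.exp (-∑ i, l' i * v i)) w := by
    intro w
    have hmem : (Matrix.toLin' (shearMatrix j) w + c) ∈ raceSet c j ↔ w ∈ orthant ι := by
      simp only [raceSet, orthant, Set.mem_ofPred_eq, Matrix.toLin'_apply, Pi.add_apply,
        shearMatrix_mulVec, if_true]
      constructor
      · rintro ⟨h1, h2⟩ i
        rcases eq_or_ne i j with rfl | h
        · linarith
        · have := h2 i h
          simp only [h, if_false] at this
          linarith
      · intro h
        refine ⟨by linarith [h j], fun i hi => ?_⟩
        simp only [hi, if_false]
        linarith [h i]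
    by_cases h : w ∈ orthant ι
    · rw [hF, Set.indicator_of_mem (hmem.mpr h), Set.indicator_of_mem h, ← Real.exp_add]
      congr 1
      have e1 : ∀ i, l i * (Matrix.toLin' (shearMatrix j) w + c) i =
          l i * w i + l i * w j + l i * c i - if i = j then l i * w j else 0 := by
        intro i
        simp only [Matrix.toLin'_apply, Pi.add_apply, shearMatrix_mulVec]
        split_ifs <;> ring
      have e2 : ∀ i, l' i * w i = l i * w i + if i = j then (∑ k, l k) * w j - l j * w j else 0 := by
        intro i
        rcases eq_or_ne i j with rfl | h
        · simp [hl']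
        · simp [hl', h]
      simp_rw [e1, e2, Finset.sum_sub_distrib, Finset.sum_add_distrib, Finset.sum_ite_eq',
        Finset.mem_univ, if_true, ← Finset.sum_mul]
      ring
    · rw [hF, Set.indicator_of_notMem (fun h' => h (hmem.mp h')), Set.indicator_of_notMem h,
        mul_zero]
  rw [h1]
  simp_rw [h2]
  rw [integral_const_mul, integral_indicator_orthant_exp hl'0]
  have h3 : ∏ i, (l' i)⁻¹ = (∏ i, (l i)⁻¹) / (∑ i, l i) * l j := by
    rw [← Finset.mul_prod_erase _ _ (Finset.mem_univ j),
      ← Finset.mul_prod_erase Finset.univ (fun i => (l i)⁻¹) (Finset.mem_univ j)]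
    have : ∏ i ∈ Finset.univ.erase j, (l' i)⁻¹ = ∏ i ∈ Finset.univ.erase j, (l i)⁻¹ :=
      Finset.prod_congr rfl fun i hi => by simp [hl', Finset.ne_of_mem_erase hi]
    rw [this]
    have := (hl j).ne'
    simp only [hl', Function.update_self]
    field_simp
  rw [h3]
  ring

end Race

/-! ### Almost sure limits of centered Gaussian variables -/

section GaussianLimit

variable {Ω : Type*} [MeasurableSpace Ω] {P : Measure Ω}

lemma charFun_map_of_centered_gaussian {ξ : Ω → ℝ} (hξ : HasGaussianLaw ξ P)
    (h0 : ∫ ω, ξ ω ∂P = 0) (θ : ℝ) :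
    charFun (P.map ξ) θ = ((Real.exp (-(Var[ξ; P] * θ ^ 2 / 2)) : ℝ) : ℂ) := by
  rw [hξ.map_eq_gaussianReal, charFun_gaussianReal, h0]
  push_cast
  rw [Real.coe_toNNReal _ (variance_nonneg _ _)]
  congr 1
  simp

/-- An almost sure limit of centered Gaussian variables is one, and the variances converge. -/
lemma hasGaussianLaw_of_tendsto {ξ : ℕ → Ω → ℝ} {η : Ω → ℝ} [IsProbabilityMeasure P]
    (hξ : ∀ n, HasGaussianLaw (ξ n) P) (h0 : ∀ n, ∫ ω, ξ n ω ∂P = 0)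
    (hlim : ∀ᵐ ω ∂P, Tendsto (fun n => ξ n ω) atTop (𝓝 (η ω))) :
    HasGaussianLaw η P ∧ ∫ ω, η ω ∂P = 0 ∧
      Tendsto (fun n => Var[ξ n; P]) atTop (𝓝 Var[η; P]) := by
  have hη : AEMeasurable η P := aemeasurable_of_tendsto_metrizable_ae atTop
    (fun n => (hξ n).aemeasurable) hlim
  have : IsProbabilityMeasure (P.map η) := Measure.isProbabilityMeasure_map hη
  have hchar : ∀ θ : ℝ, Tendsto (fun n => charFun (P.map (ξ n)) θ) atTop
      (𝓝 (charFun (P.map η) θ)) := by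
    intro θ
    simp_rw [charFun_apply_real]
    have e : ∀ ζ : Ω → ℝ, AEMeasurable ζ P → ∫ x, Complex.exp (θ * x * Complex.I) ∂(P.map ζ) =
        ∫ ω, Complex.exp (θ * ζ ω * Complex.I) ∂P := fun ζ hζ =>
      integral_map hζ (by fun_prop)
    simp_rw [fun n => e (ξ n) (hξ n).aemeasurable, e η hη]
    refine tendsto_integral_of_dominated_convergence (fun _ => 1) (fun n => ?_)
      (integrable_const _) (fun n => ?_) ?_
    · have := (hξ n).aemeasurable
      exact (by fun_prop : AEMeasurable _ P).aestronglyMeasurable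
    · filter_upwards with ω
      rw [← Complex.ofReal_mul, Complex.norm_exp_ofReal_mul_I]
    · filter_upwards [hlim] with ω hω
      have hc : Continuous fun x : ℝ => Complex.exp (θ * x * Complex.I) := by fun_prop
      exact (hc.tendsto _).comp hω
  -- a point where the limiting characteristic function does not vanish
  obtain ⟨θ, hθ0, hθ⟩ : ∃ θ : ℝ, 0 < θ ∧ charFun (P.map η) θ ≠ 0 := by
    have hc : ContinuousAt (charFun (P.map η)) 0 := continuous_charFun.continuousAt
    have h1 : ∀ᶠ θ in 𝓝 (0 : ℝ), charFun (P.map η) θ ≠ 0 :=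
      hc.eventually_ne (by simp)
    have h2 : ∀ᶠ θ in 𝓝[>] (0 : ℝ), charFun (P.map η) θ ≠ 0 := nhdsWithin_le_nhds h1
    obtain ⟨θ, h, h'⟩ := (h2.and self_mem_nhdsWithin).exists
    exact ⟨θ, h', h⟩
  have hre : ∀ θ : ℝ, Tendsto (fun n => Real.exp (-(Var[ξ n; P] * θ ^ 2 / 2))) atTop
      (𝓝 ((charFun (P.map η) θ).re)) := by
    intro θ
    have := (Complex.continuous_re.tendsto _).comp (hchar θ)
    refine this.congr fun n => ?_
    simp only [Function.comp_apply, charFun_map_of_centered_gaussian (hξ n) (h0 n)]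
    exact Complex.ofReal_re _
  have him : ∀ θ : ℝ, (charFun (P.map η) θ) = (((charFun (P.map η) θ).re : ℝ) : ℂ) := by
    intro θ
    have h1 := (Complex.continuous_ofReal.tendsto _).comp (hre θ)
    refine tendsto_nhds_unique (hchar θ) (h1.congr fun n => ?_)
    simp only [Function.comp_apply, charFun_map_of_centered_gaussian (hξ n) (h0 n)]
  have hne : (charFun (P.map η) θ).re ≠ 0 := by
    intro h
    apply hθ
    rw [him, h, Complex.ofReal_zero]
  -- The variance is recovered from the logarithm of the characteristic function at `θ`, where the
  -- limit does not vanish.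
  obtain ⟨v, hv⟩ : ∃ v, Tendsto (fun n => Var[ξ n; P]) atTop (𝓝 v) := by
    have h1 := ((Real.continuousAt_log hne).tendsto.comp (hre θ)).mul_const (-2 / θ ^ 2)
    refine ⟨_, h1.congr fun n => ?_⟩
    simp only [Function.comp_apply, Real.log_exp]
    field_simp
  have hv0 : 0 ≤ v := ge_of_tendsto' hv fun n => variance_nonneg _ _
  have hlaw : P.map η = gaussianReal 0 v.toNNReal := by
    apply Measure.ext_of_charFun
    ext θ
    rw [him, charFun_gaussianReal, Real.coe_toNNReal _ hv0]
    have h1 : Tendsto (fun n => Real.exp (-(Var[ξ n; P] * θ ^ 2 / 2))) atTop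
        (𝓝 (Real.exp (-(v * θ ^ 2 / 2)))) := by
      refine (Real.continuous_exp.tendsto _).comp ?_
      exact ((hv.mul_const _).div_const _).neg
    rw [tendsto_nhds_unique (hre θ) h1]
    push_cast
    congr 1
    simp
  have hvar : Var[η; P] = v := by
    have := variance_id_map hη
    rw [hlaw, variance_id_gaussianReal, Real.coe_toNNReal _ hv0] at this
    exact this.symm
  refine ⟨⟨by rw [hlaw]; infer_instance⟩, ?_, hvar ▸ hv⟩
  have h1 : ∫ x, x ∂(P.map η) = ∫ ω, η ω ∂P := integral_map hη (by fun_prop)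
  rw [← h1, hlaw, integral_id_gaussianReal]

lemma hasGaussianLaw_pi_of_forall {ι : Type*} [Fintype ι] {ξ : Ω → ι → ℝ} (hm : AEMeasurable ξ P)
    (h : ∀ L : StrongDual ℝ (ι → ℝ), HasGaussianLaw (fun ω => L (ξ ω)) P) : HasGaussianLaw ξ P := by
  refine ⟨isGaussian_of_isGaussian_map fun L => ?_⟩
  rw [AEMeasurable.map_map_of_aemeasurable (by fun_prop) hm]
  exact (h L).isGaussian_map

/-- An almost sure limit of centered Gaussian processes is a Gaussian process. -/
lemma isGaussianProcess_of_tendsto {T : Type*} {X : ℕ → T → Ω → ℝ} {Y : T → Ω → ℝ}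
    [IsProbabilityMeasure P]
    (hX : ∀ n, IsGaussianProcess (X n) P) (h0 : ∀ n t, ∫ ω, X n t ω ∂P = 0)
    (hlim : ∀ t, ∀ᵐ ω ∂P, Tendsto (fun n => X n t ω) atTop (𝓝 (Y t ω))) :
    IsGaussianProcess Y P := by
  refine ⟨fun I => ?_⟩
  have hY : ∀ t, AEMeasurable (Y t) P := fun t => aemeasurable_of_tendsto_metrizable_ae atTop
    (fun n => (hX n).aemeasurable t) (hlim t)
  refine hasGaussianLaw_pi_of_forall (aemeasurable_pi_lambda _ fun t => hY t) fun L => ?_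
  refine (hasGaussianLaw_of_tendsto (ξ := fun n ω => L (I.restrict (X n · ω)))
    (fun n => ((hX n).hasGaussianLaw I).map_fun L) (fun n => ?_) ?_).1
  · rw [L.integral_comp_comm ((hX n).hasGaussianLaw I).integrable]
    have : ∫ ω, I.restrict (X n · ω) ∂P = 0 := by
      ext t
      rw [eval_integral fun i => (((hX n).hasGaussianLaw I).eval i).integrable]
      simpa using h0 n t
    rw [this, map_zero]
  · have : ∀ᵐ ω ∂P, ∀ t : I, Tendsto (fun n => X n t ω) atTop (𝓝 (Y t ω)) :=
      ae_all_iff.mpr fun t => hlim t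
    filter_upwards [this] with ω hω
    exact (L.continuous.tendsto _).comp (tendsto_pi_nhds.mpr hω)

end GaussianLimit

/-! ### Densities of nondegenerate Gaussian vectors -/

section Density

open scoped MatrixOrder

variable {ι : Type*} [Fintype ι]

lemma pi_gaussianReal_eq_withDensity :
    Measure.pi (fun _ : ι => gaussianReal 0 1) =
      volume.withDensity fun x : ι → ℝ => ENNReal.ofReal (∏ i, gaussianPDFReal 0 1 (x i)) := by
  refine Measure.pi_eq fun s hs => ?_
  have hm : MeasurableSet (Set.univ.pi s) := MeasurableSet.univ_pi hs
  have e1 : ∀ x : ι → ℝ, (Set.univ.pi s).indicator (fun x => ∏ i, gaussianPDFReal 0 1 (x i)) x =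
      ∏ i, (s i).indicator (gaussianPDFReal 0 1) (x i) := by
    intro x
    by_cases h : x ∈ Set.univ.pi s
    · rw [Set.indicator_of_mem h]
      exact Finset.prod_congr rfl fun i _ => (Set.indicator_of_mem (h i trivial) _).symm
    · rw [Set.indicator_of_notMem h]
      simp only [Set.mem_pi, Set.mem_univ, true_imp_iff, not_forall] at h
      obtain ⟨i, hi⟩ := h
      exact (Finset.prod_eq_zero (Finset.mem_univ i) (Set.indicator_of_notMem hi _)).symm
  have hint : Integrable fun x : ι → ℝ => ∏ i, gaussianPDFReal 0 1 (x i) :=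
    Integrable.fintype_prod (f := fun _ : ι => gaussianPDFReal 0 1)
      fun _ => integrable_gaussianPDFReal 0 1
  rw [withDensity_apply _ hm, ← ofReal_integral_eq_lintegral_ofReal hint.integrableOn
    (ae_of_all _ fun x => Finset.prod_nonneg fun i _ => gaussianPDFReal_nonneg _ _ _),
    ← integral_indicator hm]
  simp_rw [e1]
  rw [integral_fintype_prod_volume_eq_prod (f := fun i => (s i).indicator (gaussianPDFReal 0 1)),
    ENNReal.ofReal_prod_of_nonneg]
  · refine Finset.prod_congr rfl fun i _ => ?_
    rw [integral_indicator (hs i), gaussianReal_apply_eq_integral _ one_ne_zero]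
  · intro i _
    exact integral_nonneg fun x => Set.indicator_nonneg (fun _ _ => gaussianPDFReal_nonneg _ _ _) _

lemma prod_gaussianPDFReal (x : ι → ℝ) :
    ∏ i, gaussianPDFReal 0 1 (x i) =
      (√(2 * Real.pi))⁻¹ ^ Fintype.card ι * Real.exp (-(x ⬝ᵥ x) / 2) := by
  simp only [gaussianPDFReal_def, NNReal.coe_one, mul_one, sub_zero, Finset.prod_mul_distrib,
    Finset.prod_const, Finset.card_univ, ← Real.exp_sum]
  congr 2
  rw [dotProduct, ← Finset.sum_neg_distrib, Finset.sum_div]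
  exact Finset.sum_congr rfl fun i _ => by ring

variable {Ω : Type*} [MeasurableSpace Ω] {P : Measure Ω}

/-- The Gram matrix of linearly independent variables is positive definite. -/
lemma posDef_gram {ξ : ι → Ω → ℝ} (hL2 : ∀ i, MemLp (ξ i) 2 P) {G : Matrix ι ι ℝ}
    (hG : ∀ i j, ∫ ω, ξ i ω * ξ j ω ∂P = G i j)
    (hlin : ∀ c : ι → ℝ, (∀ᵐ ω ∂P, ∑ i, c i * ξ i ω = 0) → c = 0) : G.PosDef := by
  have hquad : ∀ c : ι → ℝ, c ⬝ᵥ G.mulVec c = ∫ ω, (∑ i, c i * ξ i ω) ^ 2 ∂P := by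
    intro c
    have e : ∀ ω, (∑ i, c i * ξ i ω) ^ 2 = ∑ k, ∑ l, c k * c l * (ξ k ω * ξ l ω) := by
      intro ω
      rw [sq, Finset.sum_mul_sum]
      exact Finset.sum_congr rfl fun k _ => Finset.sum_congr rfl fun l _ => by ring
    have hi : ∀ k l, Integrable (fun ω => c k * c l * (ξ k ω * ξ l ω)) P := fun k l =>
      ((hL2 k).integrable_mul (hL2 l)).const_mul _
    simp_rw [e]
    rw [integral_finsetSum _ fun k _ => integrable_finsetSum _ fun l _ => hi k l]
    simp only [dotProduct, Matrix.mulVec, Finset.mul_sum]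
    refine Finset.sum_congr rfl fun k _ => ?_
    rw [integral_finsetSum _ fun l _ => hi _ _]
    refine Finset.sum_congr rfl fun l _ => ?_
    rw [integral_const_mul, hG]
    ring
  rw [Matrix.posDef_iff_dotProduct_mulVec]
  refine ⟨?_, fun c hc => ?_⟩
  · ext i j
    simp only [Matrix.conjTranspose_apply, star_trivial, ← hG]
    exact integral_congr_ae (ae_of_all _ fun ω => mul_comm _ _)
  · rw [star_trivial, hquad]
    refine lt_of_le_of_ne (integral_nonneg fun ω => sq_nonneg _) fun h => hc (hlin c ?_)
    have hint : Integrable (fun ω => (∑ i, c i * ξ i ω) ^ 2) P := by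
      have : MemLp (fun ω => ∑ i, c i * ξ i ω) 2 P :=
        memLp_finsetSum _ fun i _ => (hL2 i).const_mul _
      exact this.integrable_sq
    have := (integral_eq_zero_iff_of_nonneg (fun ω => sq_nonneg _) hint).mp h.symm
    filter_upwards [this] with ω hω
    simpa using hω

variable [DecidableEq ι]

lemma map_toLin'_withDensity {B : Matrix ι ι ℝ} (hB : B.det ≠ 0) {f : (ι → ℝ) → ENNReal}
    (hf : Measurable f) :
    (volume.withDensity f).map (Matrix.toLin' B) =
      volume.withDensity fun x => ENNReal.ofReal |B.det⁻¹| * f (B⁻¹.mulVec x) := by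
  have hm : Measurable (Matrix.toLin' B) :=
    (LinearMap.continuous_of_finiteDimensional _).measurable
  have hm' : Measurable (fun x => B⁻¹.mulVec x) :=
    (LinearMap.continuous_of_finiteDimensional (Matrix.toLin' B⁻¹)).measurable
  ext s hs
  rw [Measure.map_apply hm hs, withDensity_apply _ (hm hs), withDensity_apply _ hs,
    ← lintegral_indicator (hm hs), ← lintegral_indicator hs]
  have h2 := Real.map_matrix_volume_pi_eq_smul_volume_pi hB
  have hmeas : Measurable (s.indicator fun x => f (B⁻¹.mulVec x)) := (hf.comp hm').indicator hs
  have h3 : ∫⁻ y, s.indicator (fun x => f (B⁻¹.mulVec x)) y ∂(volume.map (Matrix.toLin' B)) =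
      ENNReal.ofReal |B.det⁻¹| * ∫⁻ y, s.indicator (fun x => f (B⁻¹.mulVec x)) y := by
    rw [h2, lintegral_smul_measure, smul_eq_mul]
  rw [lintegral_map hmeas hm] at h3
  rw [← lintegral_const_mul _ hmeas] at h3
  convert h3 using 2
  · refine funext fun x => ?_
    simp only [Set.indicator, Set.mem_preimage, Matrix.toLin'_apply, Matrix.mulVec_mulVec,
      Matrix.nonsing_inv_mul _ (isUnit_iff_ne_zero.mpr hB), Matrix.one_mulVec]
    rfl
  · refine funext fun x => ?_
    simp only [Set.indicator]
    split_ifs <;> simp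

/-- The density of a non-degenerate centered Gaussian vector. -/
theorem exists_gaussian_density [IsProbabilityMeasure P] {ξ : ι → Ω → ℝ}
    (hξ : HasGaussianLaw (fun ω i => ξ i ω) P) (h0 : ∀ i, ∫ ω, ξ i ω ∂P = 0)
    {G : Matrix ι ι ℝ} (hG : ∀ i j, ∫ ω, ξ i ω * ξ j ω ∂P = G i j) (hpd : G.PosDef) :
    ∃ C > 0, P.map (fun ω i => ξ i ω) = volume.withDensity fun x : ι → ℝ =>
      ENNReal.ofReal (C * Real.exp (-(x ⬝ᵥ G⁻¹.mulVec x) / 2)) := by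
  -- Whitening: `B⁻¹ ξ` has identity covariance, hence independent standard normal coordinates by
  -- joint Gaussianity, and the density is transported back by `B`.
  set B := CFC.sqrt G with hB
  have hBB : B * B = G := CFC.sqrt_mul_sqrt_self _ hpd.posSemidef.nonneg
  have hBT : B.transpose = B := by
    have : IsSelfAdjoint B := (CFC.sqrt_nonneg G).isSelfAdjoint
    simpa [IsSelfAdjoint, Matrix.star_eq_conjTranspose] using this
  have hdet : B.det ≠ 0 := by
    intro h
    have := hpd.det_pos
    rw [← hBB, Matrix.det_mul, h, mul_zero] at this
    exact lt_irrefl _ this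
  have hu : IsUnit B.det := isUnit_iff_ne_zero.mpr hdet
  have hm : AEMeasurable (fun ω i => ξ i ω) P := hξ.aemeasurable
  set N : ι → Ω → ℝ := fun i ω => B⁻¹.mulVec (fun j => ξ j ω) i with hN
  have hNG : HasGaussianLaw (fun ω i => N i ω) P :=
    hξ.map_fun (LinearMap.toContinuousLinearMap (Matrix.toLin' B⁻¹))
  have hL2 : ∀ i, MemLp (ξ i) 2 P := fun i => (hξ.eval i).memLp_two
  have hN0 : ∀ i, ∫ ω, N i ω ∂P = 0 := by
    intro i
    simp only [hN, Matrix.mulVec, dotProduct]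
    rw [integral_finsetSum _ fun j _ => ((hL2 j).integrable (by norm_num)).const_mul _]
    simp [integral_const_mul, h0]
  have hNN : ∀ i j, ∫ ω, N i ω * N j ω ∂P = (1 : Matrix ι ι ℝ) i j := by
    intro i j
    have e : ∀ ω, N i ω * N j ω = ∑ k, ∑ l, B⁻¹ i k * B⁻¹ j l * (ξ k ω * ξ l ω) := by
      intro ω
      simp only [hN, Matrix.mulVec, dotProduct, Finset.sum_mul_sum]
      exact Finset.sum_congr rfl fun k _ => Finset.sum_congr rfl fun l _ => by ring
    have hi : ∀ k l, Integrable (fun ω => B⁻¹ i k * B⁻¹ j l * (ξ k ω * ξ l ω)) P := fun k l =>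
      ((hL2 k).integrable_mul (hL2 l)).const_mul _
    simp_rw [e]
    rw [integral_finsetSum _ fun k _ => integrable_finsetSum _ fun l _ => hi k l]
    have : (1 : Matrix ι ι ℝ) = B⁻¹ * G * (B⁻¹).transpose := by
      rw [Matrix.transpose_nonsing_inv, hBT, ← hBB, ← Matrix.mul_assoc, Matrix.nonsing_inv_mul _ hu,
        Matrix.one_mul, Matrix.mul_nonsing_inv _ hu]
    rw [this, Matrix.mul_apply]
    simp_rw [Matrix.mul_apply, Finset.sum_mul, Matrix.transpose_apply]
    rw [Finset.sum_comm]
    refine Finset.sum_congr rfl fun k _ => ?_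
    rw [integral_finsetSum _ fun l _ => hi _ _]
    refine Finset.sum_congr rfl fun l _ => ?_
    rw [integral_const_mul, hG]
    ring
  have hL2N : ∀ i, MemLp (N i) 2 P := fun i => (hNG.eval i).memLp_two
  have hcov : ∀ i j, cov[N i, N j; P] = (1 : Matrix ι ι ℝ) i j := by
    intro i j
    rw [covariance_eq_sub (hL2N i) (hL2N j), hN0, zero_mul, sub_zero]
    exact hNN i j
  have hind : iIndepFun N P := hNG.iIndepFun_of_covariance_eq_zero fun i j hij => by
    rw [hcov, Matrix.one_apply_ne hij]
  have hlawN : P.map (fun ω i => N i ω) = Measure.pi fun _ : ι => gaussianReal 0 1 := by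
    rw [hind.map_fun_eq_pi_map fun i => (hNG.eval i).aemeasurable]
    congr 1
    ext1 i
    rw [(hNG.eval i).map_eq_gaussianReal, hN0]
    congr 1
    rw [← covariance_self (hNG.eval i).aemeasurable, hcov, Matrix.one_apply_eq]
    simp
  have hlaw : P.map (fun ω i => ξ i ω) = (P.map (fun ω i => N i ω)).map (Matrix.toLin' B) := by
    rw [AEMeasurable.map_map_of_aemeasurable
      (LinearMap.continuous_of_finiteDimensional _).measurable.aemeasurable hNG.aemeasurable]
    congr 1
    ext ω i
    have : (fun i => N i ω) = B⁻¹.mulVec (fun j => ξ j ω) := rfl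
    rw [Function.comp_apply, this, Matrix.toLin'_apply, Matrix.mulVec_mulVec,
      Matrix.mul_nonsing_inv _ hu, Matrix.one_mulVec]
  have hmeas : Measurable fun x : ι → ℝ => ENNReal.ofReal (∏ i, gaussianPDFReal 0 1 (x i)) := by
    have := measurable_gaussianPDFReal 0 1
    fun_prop
  refine ⟨|B.det⁻¹| * (√(2 * Real.pi))⁻¹ ^ Fintype.card ι, by positivity, ?_⟩
  rw [hlaw, hlawN, pi_gaussianReal_eq_withDensity, map_toLin'_withDensity hdet hmeas]
  congr 1
  ext1 x
  rw [prod_gaussianPDFReal, ← ENNReal.ofReal_mul (abs_nonneg _), mul_assoc]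
  congr 5
  rw [← hBB, Matrix.mul_inv_rev, ← Matrix.mulVec_mulVec, Matrix.dotProduct_mulVec x,
    ← Matrix.mulVec_transpose, Matrix.transpose_nonsing_inv, hBT]

/-- The density is strictly positive. This serves to identify continuous versions of a regression
everywhere, and to give open sets positive probability. -/
lemma volume_absolutelyContinuous_gaussian [IsProbabilityMeasure P] {ξ : ι → Ω → ℝ}
    (hξ : HasGaussianLaw (fun ω i => ξ i ω) P) (h0 : ∀ i, ∫ ω, ξ i ω ∂P = 0)
    {G : Matrix ι ι ℝ} (hG : ∀ i j, ∫ ω, ξ i ω * ξ j ω ∂P = G i j) (hpd : G.PosDef) :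
    (volume : Measure (ι → ℝ)) ≪ P.map (fun ω i => ξ i ω) := by
  obtain ⟨C, hC, h⟩ := exists_gaussian_density hξ h0 hG hpd
  rw [h]
  refine withDensity_absolutelyContinuous' ?_ (ae_of_all _ fun x => ?_)
  · have : Continuous fun x : ι → ℝ => x ⬝ᵥ G⁻¹.mulVec x := by
      simp only [dotProduct, Matrix.mulVec]
      fun_prop
    exact (by fun_prop : Measurable _).aemeasurable
  · simp only [ne_eq, ENNReal.ofReal_eq_zero, not_le]
    positivity

end Density

/-! ### Minimal energy as a projection problem in a Hilbert space -/

section Minimizers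

variable {R : ℝ → ℝ → ℝ} {a b : ℝ} {ν ν' : Measure ℝ}

lemma IsProbOn.ae_mem (h : IsProbOn a b ν) : ∀ᵐ t ∂ν, t ∈ Set.Icc a b := by
  have := h.1
  exact (mem_ae_iff_prob_eq_one measurableSet_Icc).mpr h.2

lemma IsProbOn.integrable {F : Type*} [NormedAddCommGroup F] (h : IsProbOn a b ν) {f : ℝ → F}
    (hf : Continuous f) : Integrable f ν := by
  have := h.1
  rw [← Measure.restrict_eq_self_of_ae_mem h.ae_mem]
  exact hf.continuousOn.integrableOn_compact isCompact_Icc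

variable {E : Type*} [NormedAddCommGroup E] [InnerProductSpace ℝ E] [CompleteSpace E] {x : ℝ → E}

/-- The inner product commutes with both integrals, so minimizing the energy means finding the
barycenter of least norm. -/
lemma energy_eq_norm_sq (hx : Continuous x) (hR : ∀ s t, R s t = inner ℝ (x s) (x t))
    (h : IsProbOn a b ν) : energy R ν = ‖∫ t, x t ∂ν‖ ^ 2 := by
  simp only [energy, hR]
  have h1 : ∀ s, ∫ t, inner ℝ (x s) (x t) ∂ν = inner ℝ (x s) (∫ t, x t ∂ν) := fun s =>
    integral_inner (h.integrable hx) _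
  simp_rw [h1]
  rw [← real_inner_self_eq_norm_sq, ← integral_inner (h.integrable hx)]
  exact integral_congr_ae (ae_of_all _ fun s => real_inner_comm _ _)

/-- Existence of a minimizer of the energy. -/
theorem exists_isMinimizer (hx : Continuous x) (hR : ∀ s t, R s t = inner ℝ (x s) (x t))
    (hab : a ≤ b) : ∃ ν, IsMinimizer R a b ν := by
  -- The dummy index puts the support condition in the form of a tightness condition with constant
  -- compact sets and bounds.
  set K : Set (ProbabilityMeasure ℝ) := {μ | ∀ _ : ℕ, μ (Set.Icc a b)ᶜ ≤ 0} with hK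
  have hKc : IsCompact K := isCompact_setOfPred_probabilityMeasure_mass_eq_compl_isCompact_le
    (u := fun _ => 0) (K := fun _ => Set.Icc a b) tendsto_const_nhds (fun _ => isCompact_Icc)
    (Or.inr monotone_const)
  have hKiff : ∀ μ : ProbabilityMeasure ℝ, μ ∈ K ↔ IsProbOn a b (μ : Measure ℝ) := by
    intro μ
    simp only [hK, Set.mem_ofPred_eq, forall_const, nonpos_iff_eq_zero, IsProbOn]
    rw [and_iff_right (inferInstance : IsProbabilityMeasure (μ : Measure ℝ)),
      ← prob_compl_eq_zero_iff measurableSet_Icc]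
    exact ProbabilityMeasure.null_iff_toMeasure_null _ _
  have hKne : K.Nonempty := by
    refine ⟨⟨Measure.dirac a, inferInstance⟩, (hKiff _).mpr ⟨Measure.dirac.isProbabilityMeasure, ?_⟩⟩
    simp [hab]
  have hlsc : LowerSemicontinuousOn (fun μ : ProbabilityMeasure ℝ => energy R (μ : Measure ℝ)) K := by
    intro μ hμ y hy
    have hμ' := (hKiff μ).mp hμ
    set w := ∫ t, x t ∂(μ : Measure ℝ) with hw
    -- Weak convergence tests only `⟨w, ·⟩`, extended boundedly beyond `[a,b]`. This suffices for
    -- lower semicontinuity, since `‖w'‖² ≥ 2⟨w, w'⟩ - ‖w‖²`.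
    have hφc : Continuous fun s => inner ℝ w (x (Set.projIcc a b hab s)) := by fun_prop
    have hφb : ∃ C, ∀ s t, dist (inner ℝ w (x (Set.projIcc a b hab s)))
        (inner ℝ w (x (Set.projIcc a b hab t))) ≤ C := by
      have hc : Continuous fun s : Set.Icc a b => inner ℝ w (x s) := by fun_prop
      obtain ⟨C, hC⟩ := Metric.isBounded_iff.mp (isCompact_range hc).isBounded
      exact ⟨C, fun s t => hC ⟨_, rfl⟩ ⟨_, rfl⟩⟩
    let φ : ℝ →ᵇ ℝ := ⟨⟨_, hφc⟩, hφb⟩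
    have hφ : ∀ μ' ∈ K, ∫ s, φ s ∂((μ' : ProbabilityMeasure ℝ) : Measure ℝ) =
        inner ℝ w (∫ t, x t ∂(μ' : Measure ℝ)) := by
      intro μ' h'
      have h'' := (hKiff μ').mp h'
      rw [← integral_inner (h''.integrable hx)]
      refine integral_congr_ae ?_
      filter_upwards [h''.ae_mem] with s hs
      simp [φ, Set.projIcc_of_mem hab hs]
    have hcont : Tendsto (fun μ' : ProbabilityMeasure ℝ => ∫ s, φ s ∂(μ' : Measure ℝ)) (𝓝[K] μ)
        (𝓝 (∫ s, φ s ∂(μ : Measure ℝ))) :=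
      (ProbabilityMeasure.tendsto_iff_forall_integral_tendsto.mp tendsto_id φ).mono_left
        nhdsWithin_le_nhds
    have hy' : y < ‖w‖ ^ 2 := by 
      change y < energy R (μ : Measure ℝ) at hy
      rwa [energy_eq_norm_sq hx hR hμ'] at hy
    rw [hφ μ hμ, ← hw, real_inner_self_eq_norm_sq] at hcont
    filter_upwards [hcont.eventually_const_lt (show (y + ‖w‖ ^ 2) / 2 < ‖w‖ ^ 2 by linarith),
      self_mem_nhdsWithin] with μ' h1 h2
    change y < energy R (μ' : Measure ℝ)
    rw [energy_eq_norm_sq hx hR ((hKiff μ').mp h2)]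
    rw [hφ μ' h2] at h1
    have := norm_sub_sq_real w (∫ t, x t ∂(μ' : Measure ℝ))
    nlinarith [sq_nonneg ‖w - ∫ t, x t ∂(μ' : Measure ℝ)‖]
  obtain ⟨μ, hμ, hmin⟩ := hlsc.exists_isMinOn hKne hKc
  refine ⟨μ, (hKiff μ).mp hμ, fun ν' hν' => ?_⟩
  have := hν'.1
  exact hmin (show (⟨ν', this⟩ : ProbabilityMeasure ℝ) ∈ K from (hKiff _).mpr hν')

/-- The first order condition for a minimizer. -/
lemma IsMinimizer.norm_sq_le_inner (hx : Continuous x) (hR : ∀ s t, R s t = inner ℝ (x s) (x t))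
    (h : IsMinimizer R a b ν) (h' : IsProbOn a b ν') :
    ‖∫ t, x t ∂ν‖ ^ 2 ≤ inner ℝ (∫ t, x t ∂ν') (∫ t, x t ∂ν) := by
  set w := ∫ t, x t ∂ν with hw
  set w' := ∫ t, x t ∂ν' with hw'
  have := h.1.1
  have := h'.1
  -- This is minimality against the mixture `(1 - ε) ν + ε ν'`, divided by `ε`.
  have key : ∀ ε ∈ Set.Ioc (0 : ℝ) 1, 0 ≤ 2 * inner ℝ w (w' - w) + ε * ‖w' - w‖ ^ 2 := by
    rintro ε ⟨hε0, hε1⟩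
    set μ : Measure ℝ := ENNReal.ofReal (1 - ε) • ν + ENNReal.ofReal ε • ν' with hμ
    have hsum : ENNReal.ofReal (1 - ε) + ENNReal.ofReal ε = 1 := by
      rw [← ENNReal.ofReal_add (by linarith) hε0.le]; simp
    have hμp : IsProbOn a b μ := by
      refine ⟨⟨?_⟩, ?_⟩
      · simp [hμ, hsum]
      · simp [hμ, h.1.2, h'.2, hsum]
    have hm : ∫ t, x t ∂μ = w + ε • (w' - w) := by
      rw [hμ, integral_add_measure, integral_smul_measure, integral_smul_measure,
        ENNReal.toReal_ofReal (by linarith), ENNReal.toReal_ofReal hε0.le, ← hw, ← hw']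
      · module
      · exact (h.1.integrable hx).smul_measure ENNReal.ofReal_ne_top
      · exact (h'.integrable hx).smul_measure ENNReal.ofReal_ne_top
    have h1 := h.2 μ hμp
    rw [energy_eq_norm_sq hx hR h.1, energy_eq_norm_sq hx hR hμp, hm, norm_add_sq_real,
      inner_smul_right, norm_smul, Real.norm_of_nonneg hε0.le] at h1
    have h2 : 0 ≤ ε * (2 * inner ℝ w (w' - w) + ε * ‖w' - w‖ ^ 2) := by nlinarith
    exact nonneg_of_mul_nonneg_right h2 hε0
  have hlim : Tendsto (fun ε : ℝ => 2 * inner ℝ w (w' - w) + ε * ‖w' - w‖ ^ 2) (𝓝[>] 0)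
      (𝓝 (2 * inner ℝ w (w' - w) + 0 * ‖w' - w‖ ^ 2)) := by
    refine Tendsto.mono_left (Continuous.tendsto (by fun_prop) _) nhdsWithin_le_nhds
  have h0 := ge_of_tendsto hlim (by
    filter_upwards [Ioc_mem_nhdsGT (zero_lt_one (α := ℝ))] with ε hε using key ε hε)
  rw [inner_sub_right, real_inner_self_eq_norm_sq] at h0
  rw [real_inner_comm]
  linarith

lemma IsMinimizer.norm_sq_le (hx : Continuous x) (hR : ∀ s t, R s t = inner ℝ (x s) (x t))
    (h : IsMinimizer R a b ν) {s : ℝ} (hs : s ∈ Set.Icc a b) :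
    ‖∫ t, x t ∂ν‖ ^ 2 ≤ inner ℝ (x s) (∫ t, x t ∂ν) := by
  have h1 : IsProbOn a b (Measure.dirac s) := ⟨inferInstance, by simp [hs.1, hs.2]⟩
  simpa using h.norm_sq_le_inner hx hR h1

/-- The function `⟨x s, w⟩ - ‖w‖²` is nonnegative on `[a,b]` and has `ν`-integral zero, so it
vanishes almost everywhere; continuity extends this to the support. -/
lemma IsMinimizer.eq_on_support (hx : Continuous x) (hR : ∀ s t, R s t = inner ℝ (x s) (x t))
    (h : IsMinimizer R a b ν) {s : ℝ} (hs : s ∈ ν.support) :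
    inner ℝ (x s) (∫ t, x t ∂ν) = ‖∫ t, x t ∂ν‖ ^ 2 := by
  have := h.1.1
  set w := ∫ t, x t ∂ν with hw
  have hc : Continuous fun s => inner ℝ (x s) w := by fun_prop
  have hint : ∫ s, (inner ℝ (x s) w - ‖w‖ ^ 2) ∂ν = 0 := by
    rw [integral_sub (h.1.integrable hc) (integrable_const _)]
    simp_rw [real_inner_comm w]
    rw [integral_inner (h.1.integrable hx), ← hw, real_inner_self_eq_norm_sq]
    simp
  have hnn : 0 ≤ᵐ[ν] fun s => inner ℝ (x s) w - ‖w‖ ^ 2 := by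
    filter_upwards [h.1.ae_mem] with s hs
    exact sub_nonneg.mpr (h.norm_sq_le hx hR hs)
  have hae := (integral_eq_zero_iff_of_nonneg_ae hnn
    ((h.1.integrable hc).sub (integrable_const _))).mp hint
  have hcl : IsClosed {s | inner ℝ (x s) w = ‖w‖ ^ 2} := isClosed_eq hc continuous_const
  refine Measure.support_subset_of_isClosed hcl ?_ hs
  filter_upwards [hae] with s hs
  simpa [sub_eq_zero] using hs

/-- Barycenters form a convex set, in which the element of least norm is unique. -/
lemma IsMinimizer.barycenter_eq (hx : Continuous x) (hR : ∀ s t, R s t = inner ℝ (x s) (x t))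
    (h : IsMinimizer R a b ν) (h' : IsMinimizer R a b ν') :
    ∫ t, x t ∂ν' = ∫ t, x t ∂ν := by
  have h1 := h.norm_sq_le_inner hx hR h'.1
  have h2 := h.2 ν' h'.1
  have h3 := h'.2 ν h.1
  rw [energy_eq_norm_sq hx hR h.1, energy_eq_norm_sq hx hR h'.1] at h2 h3
  have h4 := norm_sub_sq_real (∫ t, x t ∂ν') (∫ t, x t ∂ν)
  have h5 : ‖(∫ t, x t ∂ν') - ∫ t, x t ∂ν‖ ^ 2 ≤ 0 := by linarith
  have h6 : ‖(∫ t, x t ∂ν') - ∫ t, x t ∂ν‖ = 0 := by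
    nlinarith [norm_nonneg ((∫ t, x t ∂ν') - ∫ t, x t ∂ν)]
  exact sub_eq_zero.mp (norm_eq_zero.mp h6)

end Minimizers

/-! ### The process as a curve in L² -/

section Curve

variable {Ω : Type*} [MeasurableSpace Ω] {P : Measure Ω} {X : ℝ → Ω → ℝ}

lemma IsCenteredContinuousGaussian.memLp (hX : IsCenteredContinuousGaussian P X) (t : ℝ) :
    MemLp (X t) 2 P :=
  (hX.gaussian.hasGaussianLaw_eval t).memLp_two

/-- The process as a curve in `L²`. -/
def IsCenteredContinuousGaussian.curve (hX : IsCenteredContinuousGaussian P X) (t : ℝ) :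
    Lp ℝ 2 P := (hX.memLp t).toLp (X t)

lemma inner_toLp {f g : Ω → ℝ} (hf : MemLp f 2 P) (hg : MemLp g 2 P) :
    inner ℝ (hf.toLp f) (hg.toLp g) = ∫ ω, f ω * g ω ∂P := by
  rw [L2.inner_def]
  refine integral_congr_ae ?_
  filter_upwards [hf.coeFn_toLp, hg.coeFn_toLp] with ω h1 h2
  simp [h1, h2, mul_comm]

lemma IsCenteredContinuousGaussian.covFun_eq_inner (hX : IsCenteredContinuousGaussian P X)
    (s t : ℝ) : covFun P X s t = inner ℝ (hX.curve s) (hX.curve t) :=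
  (inner_toLp (hX.memLp s) (hX.memLp t)).symm

lemma norm_toLp_sq {f : Ω → ℝ} (hf : MemLp f 2 P) : ‖hf.toLp f‖ ^ 2 = ∫ ω, f ω ^ 2 ∂P := by
  rw [← real_inner_self_eq_norm_sq, inner_toLp]
  simp_rw [sq]

lemma variance_eq_norm_sq {f : Ω → ℝ} (hf : MemLp f 2 P) (h0 : ∫ ω, f ω ∂P = 0) :
    Var[f; P] = ‖hf.toLp f‖ ^ 2 := by
  rw [variance_of_integral_eq_zero hf.aestronglyMeasurable.aemeasurable h0, norm_toLp_sq]

/-- Path continuity makes increments tend to zero almost surely, and for centered Gaussian variables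
this forces their variances to zero. -/
lemma IsCenteredContinuousGaussian.continuous_curve [IsProbabilityMeasure P]
    (hX : IsCenteredContinuousGaussian P X) : Continuous hX.curve := by
  refine continuous_iff_seqContinuous.mpr fun s t hs => ?_
  rw [tendsto_iff_norm_sub_tendsto_zero]
  have hg : ∀ n, HasGaussianLaw (fun ω => X (s n) ω - X t ω) P := fun n =>
    hX.gaussian.hasGaussianLaw_fun_sub
  have h0 : ∀ n, ∫ ω, (X (s n) ω - X t ω) ∂P = 0 := fun n => by
    rw [integral_sub ((hX.memLp _).integrable (by norm_num)) ((hX.memLp _).integrable (by norm_num)),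
      hX.centered, hX.centered, sub_zero]
  have h1 := (hasGaussianLaw_of_tendsto hg h0 (η := fun _ => 0) (ae_of_all _ fun ω => by
    have := ((hX.continuous ω).tendsto t).comp hs
    simpa using this.sub_const (X t ω))).2.2
  have h2 : Var[fun _ : Ω => (0 : ℝ); P] = 0 := by
    exact variance_zero P
  rw [h2] at h1
  have h3 : ∀ n, Var[fun ω => X (s n) ω - X t ω; P] = ‖hX.curve (s n) - hX.curve t‖ ^ 2 := by
    intro n
    rw [variance_eq_norm_sq (hg n).memLp_two (h0 n)]
    rfl
  simp_rw [h3] at h1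
  have h4 := (Real.continuous_sqrt.tendsto _).comp h1
  simpa [Function.comp_def, Real.sqrt_sq] using h4

end Curve

/-! ### Minimum and leftmost minimizer: measurability -/

section MinOn

variable {a b : ℝ} {x y : ℝ → ℝ}

lemma lt_minOn_iff (hab : a ≤ b) (hx : Continuous x) {c : ℝ} :
    c < minOn a b x ↔ ∀ t ∈ Set.Icc a b, c < x t := by
  have hne : (Set.Icc a b).Nonempty := Set.nonempty_Icc.mpr hab
  constructor
  · intro h t ht
    exact h.trans_le (csInf_le (isCompact_Icc.image hx).bddBelow ⟨t, ht, rfl⟩)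
  · intro h
    obtain ⟨t, ht, hmin⟩ := (isCompact_Icc.image hx).sInf_mem (hne.image x)
    rw [minOn, ← hmin]
    exact h t ht

lemma minOn_lt_iff (hab : a ≤ b) (hx : Continuous x) {c : ℝ} :
    minOn a b x < c ↔ ∃ t ∈ Set.Icc a b, x t < c := by
  rw [minOn, csInf_lt_iff (isCompact_Icc.image hx).bddBelow
    ((Set.nonempty_Icc.mpr hab).image x)]
  simp

lemma leftArgmin_congr (h : ∀ s ∈ Set.Icc a b, ∀ t ∈ Set.Icc a b, x s ≤ x t ↔ y s ≤ y t) :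
    leftArgmin a b x = leftArgmin a b y := by
  have : argminSet a b x = argminSet a b y := by
    ext t
    simp only [argminSet, Set.mem_ofPred_eq]
    exact and_congr_right fun ht => forall₂_congr fun s hs => h t ht s hs
  rw [leftArgmin, leftArgmin, this]

/-- Expresses the location through minima alone, which are measurable because a countable dense set
of times determines them. -/
lemma leftArgmin_le_iff (hx : Continuous x) {t : ℝ} (ht : t ∈ Set.Icc a b) :
    leftArgmin a b x ≤ t ↔ minOn a t x ≤ minOn a b x := by
  have hab : a ≤ b := ht.1.trans ht.2
  obtain ⟨⟨hmem, hmin⟩, hleast⟩ := leftArgmin_isLeast hab hx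
  rw [← not_lt, ← not_lt, not_iff_not, lt_minOn_iff ht.1 hx]
  constructor
  · intro h s hs
    rw [minOn_lt_iff hab hx]
    have hs' : s ∈ Set.Icc a b := ⟨hs.1, hs.2.trans ht.2⟩
    by_contra hcon
    push Not at hcon
    exact absurd (hleast ⟨hs', hcon⟩) (not_le.mpr (hs.2.trans_lt h))
  · intro h
    by_contra hcon
    have h1 := h _ ⟨hmem.1, not_lt.mp hcon⟩
    obtain ⟨s, hs, hlt⟩ := (minOn_lt_iff hab hx).mp h1
    exact absurd (hmin s hs) (not_le.mpr hlt)

variable {Θ : Type*} [MeasurableSpace Θ] {Z : ℝ → Θ → ℝ}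

lemma measurable_minOn (hab : a ≤ b) (hZ : ∀ t, Measurable (Z t))
    (hc : ∀ θ, Continuous fun t => Z t θ) : Measurable fun θ => minOn a b fun t => Z t θ := by
  obtain ⟨D, hDc, hD⟩ := TopologicalSpace.exists_countable_dense (Set.Icc a b)
  refine measurable_of_Iio fun c => ?_
  have : (fun θ => minOn a b fun t => Z t θ) ⁻¹' Set.Iio c = ⋃ t ∈ D, {θ | Z t θ < c} := by
    ext θ
    simp only [Set.mem_preimage, Set.mem_Iio, minOn_lt_iff hab (hc θ), Set.mem_iUnion,
      Set.mem_ofPred_eq, exists_prop]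
    constructor
    · rintro ⟨t, ht, h⟩
      have ho : IsOpen {s : Set.Icc a b | Z s θ < c} :=
        isOpen_lt ((hc θ).comp continuous_subtype_val) continuous_const
      obtain ⟨s, hs, hsD⟩ := hD.inter_open_nonempty _ ho ⟨⟨t, ht⟩, h⟩
      exact ⟨s, hsD, hs⟩
    · rintro ⟨t, _, h⟩
      exact ⟨t, t.2, h⟩
  rw [this]
  exact MeasurableSet.biUnion hDc fun t _ => measurableSet_lt (hZ _) measurable_const

lemma measurable_leftArgmin (hab : a ≤ b) (hZ : ∀ t, Measurable (Z t))
    (hc : ∀ θ, Continuous fun t => Z t θ) : Measurable fun θ => leftArgmin a b fun t => Z t θ := by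
  refine measurable_of_Iic fun t => ?_
  have hmem := fun θ => (leftArgmin_isLeast hab (hc θ)).1.1
  rcases lt_or_ge t a with h | hta
  · convert MeasurableSet.empty
    ext θ
    simpa using h.trans_le (hmem θ).1
  rcases lt_or_ge b t with h | htb
  · convert MeasurableSet.univ
    ext θ
    simpa using (hmem θ).2.trans h.le
  have : (fun θ => leftArgmin a b fun t => Z t θ) ⁻¹' Set.Iic t =
      {θ | minOn a t (fun t => Z t θ) ≤ minOn a b fun t => Z t θ} := by
    ext θ
    exact leftArgmin_le_iff (hc θ) ⟨hta, htb⟩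
  rw [this]
  exact measurableSet_le (measurable_minOn hta hZ hc) (measurable_minOn hab hZ hc)

/-- The value of `f` at the leftmost minimum if the minimum exceeds `c`, zero otherwise. -/
noncomputable def exceedanceValue (a b c : ℝ) (f : ℝ → ℝ) (x : ℝ → ℝ) : ℝ :=
  open Classical in if c < minOn a b x then f (leftArgmin a b x) else 0

lemma measurable_exceedanceValue (hab : a ≤ b) (hZ : ∀ t, Measurable (Z t))
    (hc : ∀ θ, Continuous fun t => Z t θ) (c : ℝ) {f : ℝ → ℝ} (hf : Measurable f) :
    Measurable fun θ => exceedanceValue a b c f fun t => Z t θ := by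
  classical
  refine Measurable.ite (measurableSet_lt measurable_const (measurable_minOn hab hZ hc))
    (hf.comp (measurable_leftArgmin hab hZ hc)) measurable_const

lemma abs_exceedanceValue_le {c : ℝ} {f : ℝ → ℝ} {C : ℝ} (hf : ∀ t, |f t| ≤ C) :
    |exceedanceValue a b c f x| ≤ C := by
  unfold exceedanceValue
  split_ifs
  · exact hf _
  · simpa using (abs_nonneg _).trans (hf 0)

/-- An increasing affine change of the values keeps the location of the minimum and turns the level
`c` into `0`. -/
lemma exceedanceValue_affine (hab : a ≤ b) (hx : Continuous x) {u c : ℝ} (hu : 0 < u)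
    (f : ℝ → ℝ) : exceedanceValue a b c f x = exceedanceValue a b 0 f fun t => u * (x t - c) := by
  have h1 : c < minOn a b x ↔ 0 < minOn a b fun t => u * (x t - c) := by
    rw [lt_minOn_iff hab hx, lt_minOn_iff hab (by fun_prop)]
    exact forall₂_congr fun t _ => by rw [mul_pos_iff_of_pos_left hu, sub_pos]
  have h2 : leftArgmin a b x = leftArgmin a b fun t => u * (x t - c) :=
    leftArgmin_congr fun s _ t _ => by
      rw [mul_le_mul_iff_right₀ hu, sub_le_sub_iff_right]
  simp only [exceedanceValue, h1, h2]

end MinOn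

/-! ### The limit for a fixed residual path -/

section InnerLimit

variable {a b : ℝ} {F : Finset ℝ} {q y : ℝ → ℝ} {A : ℝ → F → ℝ} {l : F → ℝ} {Q : (F → ℝ) → ℝ}

/-- Deterministic data for the behaviour of the rescaled paths. -/
structure RescaledSetup (a b : ℝ) (F : Finset ℝ) (q y : ℝ → ℝ) (A : ℝ → F → ℝ) (l : F → ℝ)
    (Q : (F → ℝ) → ℝ) : Prop where
  lt : a < b
  mem_Icc : ∀ i ∈ F, i ∈ Set.Icc a b
  continuous_q : Continuous q
  continuous_y : Continuous y
  continuous_A : ∀ i, Continuous fun t => A t i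
  q_nonneg : ∀ t ∈ Set.Icc a b, 0 ≤ q t
  q_eq_zero : ∀ i : F, q i = 0
  y_eq_zero : ∀ i : F, y i = 0
  A_apply : ∀ i j : F, A i j = if j = i then 1 else 0
  rate_pos : ∀ i, 0 < l i
  Q_nonneg : ∀ v, 0 ≤ Q v
  measurable_Q : Measurable Q

/-- The rescaled path. -/
noncomputable def rescaledPath (q y : ℝ → ℝ) (A : ℝ → F → ℝ) (u : ℝ) (v : F → ℝ) (t : ℝ) : ℝ :=
  u ^ 2 * q t + u * y t + ∑ i, v i * A t i

/-- The integrand of the conditional expectation given the residual path. -/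
noncomputable def innerIntegrand (a b : ℝ) (q y : ℝ → ℝ) (A : ℝ → F → ℝ) (l : F → ℝ)
    (Q : (F → ℝ) → ℝ) (f : ℝ → ℝ) (u : ℝ) (v : F → ℝ) : ℝ :=
  exceedanceValue a b 0 f (rescaledPath q y A u v) *
    (Real.exp (-∑ i, l i * v i) * Real.exp (-(Q v) / (2 * u ^ 2)))

lemma RescaledSetup.path_apply_mem (h : RescaledSetup a b F q y A l Q) (u : ℝ) (v : F → ℝ)
    (i : F) : rescaledPath q y A u v i = v i := by
  simp [rescaledPath, h.q_eq_zero, h.y_eq_zero, h.A_apply]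

lemma RescaledSetup.continuous_path (h : RescaledSetup a b F q y A l Q) (u : ℝ) (v : F → ℝ) :
    Continuous (rescaledPath q y A u v) := by
  have hq := h.continuous_q
  have hy := h.continuous_y
  have hAc := h.continuous_A
  unfold rescaledPath
  fun_prop

lemma RescaledSetup.measurable_innerIntegrand (h : RescaledSetup a b F q y A l Q) {f : ℝ → ℝ}
    (hf : Measurable f) (u : ℝ) : Measurable (innerIntegrand a b q y A l Q f u) := by
  have hQ := h.measurable_Q
  refine Measurable.mul ?_ (by fun_prop)
  refine measurable_exceedanceValue (Z := fun t v => rescaledPath q y A u v t) h.lt.le (fun t => ?_)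
    (fun v => h.continuous_path u v) 0 hf
  unfold rescaledPath
  fun_prop

/-- At `i ∈ F` the rescaled path equals `v i`, so an exceedance forces `v` into the orthant. The
resulting bound is uniform in `u` and in the residual. -/
lemma RescaledSetup.abs_innerIntegrand_le (hs : RescaledSetup a b F q y A l Q)
    {f : ℝ → ℝ} {C : ℝ} (hf : ∀ t, |f t| ≤ C) (u : ℝ) (v : F → ℝ) :
    |innerIntegrand a b q y A l Q f u v| ≤
      C * (orthant F).indicator (fun v => Real.exp (-∑ i, l i * v i)) v := by
  have hC : 0 ≤ C := (abs_nonneg _).trans (hf 0)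
  by_cases h : v ∈ orthant F
  · rw [Set.indicator_of_mem h, innerIntegrand, abs_mul]
    refine mul_le_mul (abs_exceedanceValue_le hf) ?_ (abs_nonneg _) hC
    rw [abs_of_pos (by positivity)]
    refine mul_le_of_le_one_right (Real.exp_pos _).le (Real.exp_le_one_iff.mpr ?_)
    rw [neg_div]
    have := div_nonneg (hs.Q_nonneg v) (by positivity : 0 ≤ 2 * u ^ 2)
    linarith
  · rw [Set.indicator_of_notMem h, innerIntegrand, exceedanceValue, if_neg]
    · simp
    · intro h0
      refine h fun i => ?_
      have := (lt_minOn_iff hs.lt.le (hs.continuous_path u v)).mp h0 i (hs.mem_Icc i i.2)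
      rwa [hs.path_apply_mem] at this

/-- Near `z` the path eventually takes a negative value, which excludes an exceedance. -/
lemma RescaledSetup.tendsto_innerIntegrand_zero (hs : RescaledSetup a b F q y A l Q) {z : ℝ} {v : F → ℝ} {m : ℝ}
    (h : LocalUpper (fun u t => u ^ 2 * q t + u * y t) (Set.Icc a b) z m)
    (hm : m + ∑ i, v i * A z i < 0) (f : ℝ → ℝ) :
    Tendsto (fun u => innerIntegrand a b q y A l Q f u v) atTop (𝓝 0) := by
  have hα : ContinuousWithinAt (fun t => ∑ i, v i * A t i) (Set.Icc a b) z :=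
    (continuous_finsetSum _ fun i _ => (hs.continuous_A i).const_mul (v i)).continuousWithinAt
  have h1 := h.add_continuous hα hm _ self_mem_nhdsWithin
  refine tendsto_const_nhds.congr' ?_
  filter_upwards [h1] with u ⟨t, ht, hlt⟩
  rw [innerIntegrand, exceedanceValue, if_neg, zero_mul]
  rw [lt_minOn_iff hs.lt.le (hs.continuous_path u v)]
  intro h0
  exact absurd (h0 t ht) (not_lt.mpr hlt.le)

/-- The local minima have limits `v i - c i` at `F`, and the path diverges to `+∞` elsewhere. In the
absence of ties the smallest limit decides both the exceedance and the location. -/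
lemma RescaledSetup.tendsto_innerIntegrand_of_cost (hs : RescaledSetup a b F q y A l Q) {c : F → ℝ}
    (hc : ∀ i : F, LocalLimit (fun u t => u ^ 2 * q t + u * y t) (Set.Icc a b) i (-c i))
    (hz : ∀ z ∈ Set.Icc a b, z ∉ F → q z = 0 → 0 < y z) {v : F → ℝ}
    (hv1 : ∀ i, v i ≠ c i) (hv2 : ∀ i j, i ≠ j → v i - c i ≠ v j - c j)
    (hF : Nonempty F) (f : ℝ →ᵇ ℝ) :
    Tendsto (fun u => innerIntegrand a b q y A l Q f u v) atTop
      (𝓝 (∑ j : F, f j * (raceSet c j).indicator (fun v => Real.exp (-∑ i, l i * v i)) v)) := by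
  have hα : ∀ z, ContinuousWithinAt (fun t => ∑ i, v i * A t i) (Set.Icc a b) z := fun z =>
    (continuous_finsetSum _ fun i _ => (hs.continuous_A i).const_mul (v i)).continuousWithinAt
  have hαF : ∀ i : F, ∑ j, v j * A i j = v i := fun i => by simp [hs.A_apply]
  obtain ⟨j, -, hj⟩ := Finset.exists_min_image Finset.univ (fun i => v i - c i)
    (Finset.univ_nonempty (α := F))
  have hj' : ∀ i, i ≠ j → v j - c j < v i - c i := fun i hi =>
    lt_of_le_of_ne (hj i (Finset.mem_univ i)) (hv2 j i hi.symm)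
  have hsum : ∑ k : F, f k * (raceSet c k).indicator (fun v => Real.exp (-∑ i, l i * v i)) v =
      f j * (raceSet c j).indicator (fun v => Real.exp (-∑ i, l i * v i)) v := by
    refine Finset.sum_eq_single j (fun k _ hk => ?_) (by simp)
    rw [Set.indicator_of_notMem, mul_zero]
    intro hmem
    exact absurd (hmem.2 j hk.symm) (not_lt.mpr (hj' k hk).le)
  rw [hsum]
  rcases lt_or_gt_of_ne (hv1 j) with hlt | hgt
  · rw [Set.indicator_of_notMem (fun hmem => absurd hmem.1 (not_lt.mpr hlt.le)), mul_zero]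
    refine hs.tendsto_innerIntegrand_zero
      (z := j) ((hc j).2 ((-c j - v j) / 2) (by linarith)) ?_ f
    rw [hαF]
    linarith
  · rw [Set.indicator_of_mem (show v ∈ raceSet c j from ⟨hgt, hj'⟩)]
    obtain ⟨hpos, hnear⟩ := eventually_pos_and_argmin_near (g := fun u => rescaledPath q y A u v)
      isCompact_Icc (hs.mem_Icc j j.2) (l := v j - c j) (by linarith) (by
        have := (hc j).add_continuous (hα j)
        rw [hαF, neg_add_eq_sub] at this
        exact this) (by
        intro z hzm hzj
        by_cases hzF : z ∈ F
        · refine ⟨((v j - c j) + (v ⟨z, hzF⟩ - c ⟨z, hzF⟩)) / 2, ?_, ?_⟩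
          · have := hj' ⟨z, hzF⟩ (fun h => hzj (congrArg Subtype.val h))
            simp only [gt_iff_lt]
            linarith
          · have h1 := ((hc ⟨z, hzF⟩).add_continuous (hα z)).1
            refine h1 _ ?_
            have h2 := hαF ⟨z, hzF⟩
            simp only at h2
            rw [h2]
            have := hj' ⟨z, hzF⟩ (fun h => hzj (congrArg Subtype.val h))
            linarith
        · refine ⟨v j - c j + 1, by simp, ?_⟩
          have hlow : ∀ m, LocalLower (fun u t => u ^ 2 * q t + u * y t) (Set.Icc a b) z m := by
            rcases (hs.q_nonneg z hzm).eq_or_lt with h0 | h0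
            · exact localLower_of_nonneg_of_pos hs.q_nonneg hs.continuous_y.continuousWithinAt (hz z hzm hzF h0.symm)
            · exact localLower_of_pos hs.continuous_q.continuousWithinAt hs.continuous_y.continuousWithinAt h0
          exact (hlow (v j - c j + 1 - (∑ i, v i * A z i) + 1)).add_continuous (hα z)
            (by linarith))
    have hT : Tendsto (fun u => leftArgmin a b (rescaledPath q y A u v)) atTop (𝓝 j) := by
      refine tendsto_def.mpr fun N hN => ?_
      filter_upwards [hnear N hN] with u hu
      have := (leftArgmin_isLeast hs.lt.le (hs.continuous_path u v)).1
      exact hu _ this.1 this.2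
    have hfT := (f.continuous.tendsto (j : ℝ)).comp hT
    have hexp : Tendsto (fun u : ℝ => Real.exp (-∑ i, l i * v i) *
        Real.exp (-(Q v) / (2 * u ^ 2))) atTop (𝓝 (Real.exp (-∑ i, l i * v i) * 1)) := by
      refine Tendsto.const_mul _ ?_
      rw [← Real.exp_zero]
      refine (Real.continuous_exp.tendsto _).comp ?_
      refine tendsto_const_nhds.div_atTop ?_
      exact (tendsto_pow_atTop two_ne_zero).const_mul_atTop two_pos
    rw [mul_one] at hexp
    refine (hfT.mul hexp).congr' ?_
    filter_upwards [hpos] with u hu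
    rw [innerIntegrand, exceedanceValue, if_pos]
    · rfl
    · exact (lt_minOn_iff hs.lt.le (hs.continuous_path u v)).mpr hu

/-- The limit of the conditional integrals given the residual path. -/
theorem RescaledSetup.exists_tendsto_integral (hs : RescaledSetup a b F q y A l Q) (hF : Nonempty F)
    (hcost : ∀ i : F,
      (∃ c, LocalLimit (fun u t => u ^ 2 * q t + u * y t) (Set.Icc a b) i (-c)) ∨
      ∀ m, LocalUpper (fun u t => u ^ 2 * q t + u * y t) (Set.Icc a b) i m)
    (hyz : ∀ z ∈ Set.Icc a b, z ∉ F → q z = 0 → y z ≠ 0) :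
    ∃ J : ℝ, 0 ≤ J ∧
      (((∀ z ∈ Set.Icc a b, z ∉ F → q z = 0 → 0 < y z) ∧ ∀ i : F, ∃ c,
        LocalLimit (fun u t => u ^ 2 * q t + u * y t) (Set.Icc a b) i (-c)) → 0 < J) ∧
      ∀ f : ℝ →ᵇ ℝ, Tendsto (fun u => ∫ v, innerIntegrand a b q y A l Q f u v) atTop
        (𝓝 (J * ∑ i : F, l i * f i)) := by
  classical
  have hDCT : ∀ (f : ℝ →ᵇ ℝ) (g : (F → ℝ) → ℝ),
      (∀ᵐ v, Tendsto (fun u => innerIntegrand a b q y A l Q f u v) atTop (𝓝 (g v))) →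
      Tendsto (fun u => ∫ v, innerIntegrand a b q y A l Q f u v) atTop (𝓝 (∫ v, g v)) := by
    intro f g hg
    refine tendsto_integral_filter_of_dominated_convergence
      (fun v => ‖f‖ * (orthant F).indicator (fun v => Real.exp (-∑ i, l i * v i)) v)
      (Eventually.of_forall fun u => (hs.measurable_innerIntegrand
        f.continuous.measurable u).aestronglyMeasurable)
      (Eventually.of_forall fun u => ae_of_all _ fun v => ?_)
      ((integrable_indicator_orthant_exp hs.rate_pos).const_mul _) hg
    exact hs.abs_innerIntegrand_le
      (fun t => f.norm_coe_le_norm t) u v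
  by_cases hgood : (∀ z ∈ Set.Icc a b, z ∉ F → q z = 0 → 0 < y z) ∧ ∀ i : F, ∃ c,
        LocalLimit (fun u t => u ^ 2 * q t + u * y t) (Set.Icc a b) i (-c)
  · obtain ⟨hz, hc⟩ := hgood
    choose c hc using hc
    have hS : 0 < ∑ i, l i := Finset.sum_pos (fun i _ => hs.rate_pos i) Finset.univ_nonempty
    have hJ : 0 < Real.exp (-∑ i, l i * c i) * (∏ i, (l i)⁻¹) / (∑ i, l i) := by
      have : 0 < ∏ i, (l i)⁻¹ := Finset.prod_pos fun i _ => inv_pos.mpr (hs.rate_pos i)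
      positivity
    refine ⟨_, hJ.le, fun _ => hJ, fun f => ?_⟩
    have h1 := hDCT f (fun v => ∑ j : F, f j *
      (raceSet c j).indicator (fun v => Real.exp (-∑ i, l i * v i)) v) (by
        filter_upwards [ae_no_ties c] with v hv
        exact hs.tendsto_innerIntegrand_of_cost hc hz hv.1 hv.2 hF f)
    have hint : ∀ j, Integrable
        ((raceSet c j).indicator fun v : F → ℝ => Real.exp (-∑ i, l i * v i)) := by
      intro j
      -- A non-integrable function has integral zero by convention, contradicting the positive value
      -- of the race integral.
      by_contra hni
      have h0 := integral_raceSet hs.rate_pos c j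
      rw [integral_undef hni] at h0
      have := mul_pos hJ (hs.rate_pos j)
      linarith
    rw [integral_finsetSum _ fun j _ => (hint j).const_mul _] at h1
    simp_rw [integral_const_mul, integral_raceSet hs.rate_pos] at h1
    convert h1 using 2
    rw [Finset.mul_sum]
    exact Finset.sum_congr rfl fun i _ => by ring
  · refine ⟨0, le_rfl, fun h => absurd h hgood, fun f => ?_⟩
    rw [zero_mul]
    have := hDCT f (fun _ => 0) (ae_of_all _ fun v => ?_)
    · simpa using this
    -- Failure of the good case produces a point where the path is pushed to `-∞`: a contact point
    -- outside `F` with `y z < 0`, or a point of `F` with unbounded cost.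
    have key : ∃ z ∈ Set.Icc a b,
        ∀ m, LocalUpper (fun u t => u ^ 2 * q t + u * y t) (Set.Icc a b) z m := by
      rw [not_and_or] at hgood
      rcases hgood with h | h
      · push Not at h
        obtain ⟨z, hz, hzF, hqz, hyz'⟩ := h
        exact ⟨z, hz, fun m => localUpper_of_neg hz hqz
          (lt_of_le_of_ne hyz' (hyz z hz hzF hqz)) m⟩
      · obtain ⟨i, hi⟩ := not_forall.mp h
        exact ⟨i, hs.mem_Icc i i.2, (hcost i).resolve_left hi⟩
    obtain ⟨z, hz, h⟩ := key
    exact hs.tendsto_innerIntegrand_zero (h (-(∑ i, v i * A z i) - 1)) (by linarith) f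

end InnerLimit

/-! ### Integration over independent elements -/

section Independence

/-- Fubini for independent random elements. -/
lemma integral_of_indepFun {α β Ω : Type*} [MeasurableSpace α] [MeasurableSpace β]
    [MeasurableSpace Ω] {P : Measure Ω} [IsProbabilityMeasure P] {ξ : Ω → α} {η : Ω → β}
    (hξ : Measurable ξ) (hη : Measurable η) (hind : IndepFun ξ η P) {H : α × β → ℝ}
    (hH : Measurable H) {C : ℝ} (hC : ∀ p, |H p| ≤ C) :
    Measurable (fun ω => ∫ x, H (x, η ω) ∂(P.map ξ)) ∧
    ∫ ω, H (ξ ω, η ω) ∂P = ∫ ω, ∫ x, H (x, η ω) ∂(P.map ξ) ∂P := by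
  have : IsProbabilityMeasure (P.map ξ) := Measure.isProbabilityMeasure_map hξ.aemeasurable
  have : IsProbabilityMeasure (P.map η) := Measure.isProbabilityMeasure_map hη.aemeasurable
  have hm : StronglyMeasurable fun y => ∫ x, H (x, y) ∂(P.map ξ) :=
    hH.stronglyMeasurable.integral_prod_left'
  refine ⟨hm.measurable.comp hη, ?_⟩
  have h1 := (indepFun_iff_map_prod_eq_prod_map_map hξ.aemeasurable hη.aemeasurable).mp hind
  have h2 : ∫ ω, H (ξ ω, η ω) ∂P = ∫ p, H p ∂(P.map fun ω => (ξ ω, η ω)) :=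
    (integral_map (hξ.prodMk hη).aemeasurable hH.aestronglyMeasurable).symm
  have hint : Integrable H ((P.map ξ).prod (P.map η)) :=
    Integrable.of_bound hH.aestronglyMeasurable C (ae_of_all _ hC)
  rw [h2, h1, integral_prod_symm _ hint, integral_map hη.aemeasurable hm.aestronglyMeasurable]

end Independence

/-! ### Joint Gaussianity of the process and its derivative -/

section LinearCombinations

variable {Ω : Type*} [MeasurableSpace Ω] {P : Measure Ω}

lemma isGaussianProcess_of_sum {S T : Type*} {X : T → Ω → ℝ} {Y : S → Ω → ℝ}
    (hX : IsGaussianProcess X P)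
    (h : ∀ s, ∃ (I : Finset T) (c : T → ℝ), ∀ ω, Y s ω = ∑ t ∈ I, c t * X t ω) :
    IsGaussianProcess Y P := by
  refine hX.of_isGaussianProcess fun s => ?_
  obtain ⟨I, c, hI⟩ := h s
  refine ⟨I, ∑ i : I, c i • ContinuousLinearMap.proj i, fun ω => ?_⟩
  rw [hI, ← Finset.sum_coe_sort]
  simp

variable {X : ℝ → Ω → ℝ} [IsProbabilityMeasure P]

lemma tendsto_difference_quotient {x : ℝ → ℝ} {t : ℝ} (hx : DifferentiableAt ℝ x t) :
    Tendsto (fun n : ℕ => ((n : ℝ) + 1) * (x (t + 1 / ((n : ℝ) + 1)) - x t)) atTop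
      (𝓝 (deriv x t)) := by
  have h := hx.hasDerivAt.tendsto_slope_zero_right
  have h1 : Tendsto (fun n : ℕ => 1 / ((n : ℝ) + 1)) atTop (𝓝[>] 0) :=
    tendsto_nhdsWithin_iff.mpr ⟨tendsto_one_div_add_atTop_nhds_zero_nat,
      Eventually.of_forall fun n => by simp only [Set.mem_Ioi]; positivity⟩
  refine (h.comp h1).congr fun n => ?_
  simp

/-- A process with its derivatives is jointly Gaussian and centered. -/
lemma IsCenteredContinuousGaussian.with_deriv (hX : IsCenteredContinuousGaussian P X)
    (hd : ∀ t, ∀ᵐ ω ∂P, DifferentiableAt ℝ (fun s => X s ω) t) :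
    IsGaussianProcess (Sum.elim X fun t ω => deriv (fun s => X s ω) t) P ∧
      ∀ t, ∫ ω, deriv (fun s => X s ω) t ∂P = 0 := by
  set D : ℕ → ℝ → Ω → ℝ := fun n t ω => ((n : ℝ) + 1) * (X (t + 1 / ((n : ℝ) + 1)) ω - X t ω)
    with hD
  have hi : ∀ t, Integrable (X t) P := fun t => (hX.memLp t).integrable (by norm_num)
  have hD0 : ∀ n t, ∫ ω, D n t ω ∂P = 0 := fun n t => by
    rw [hD, integral_const_mul, integral_sub (hi _) (hi _), hX.centered, hX.centered]
    simp
  have hDlim : ∀ t, ∀ᵐ ω ∂P, Tendsto (fun n => D n t ω) atTop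
      (𝓝 (deriv (fun s => X s ω) t)) := fun t => by
    filter_upwards [hd t] with ω hω using tendsto_difference_quotient hω
  have hDX : ∀ n, IsGaussianProcess (Sum.elim X (D n)) P := by
    intro n
    classical
    refine isGaussianProcess_of_sum hX.gaussian ?_
    rintro (t | t)
    · exact ⟨{t}, fun _ => 1, fun ω => by simp⟩
    · have hne : t + 1 / ((n : ℝ) + 1) ≠ t := by
        have : 0 < 1 / ((n : ℝ) + 1) := by positivity
        linarith
      refine ⟨{t + 1 / ((n : ℝ) + 1), t},
        fun s => if s = t then -((n : ℝ) + 1) else (n : ℝ) + 1, fun ω => ?_⟩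
      rw [Finset.sum_pair hne]
      simp only [hne, if_true, if_false, Sum.elim_inr, hD]
      ring
  -- Derivatives are almost sure limits of difference quotients, which are linear combinations of
  -- the process.
  refine ⟨isGaussianProcess_of_tendsto (X := fun n => Sum.elim X (D n)) hDX ?_ ?_, fun t => ?_⟩
  · rintro n (t | t)
    · exact hX.centered t
    · exact hD0 n t
  · rintro (t | t)
    · exact ae_of_all _ fun ω => tendsto_const_nhds
    · exact hDlim t
  · exact (hasGaussianLaw_of_tendsto (fun n => (hDX n).hasGaussianLaw_eval (Sum.inr t))
      (fun n => hD0 n t) (hDlim t)).2.1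

end LinearCombinations

/-! ### Regular processes -/

/-- The properties of the process used in the analysis of its high minima. -/
structure IsRegular {Ω : Type*} [MeasurableSpace Ω] (P : Measure Ω) (X : ℝ → Ω → ℝ)
    (a b : ℝ) : Prop where
  gaussian : IsCenteredContinuousGaussian P X
  analytic : ∀ t, AnalyticOnNhd ℝ (fun s => covFun P X s t) Set.univ
  differentiable : ∀ t, ∀ᵐ ω ∂P, DifferentiableAt ℝ (fun s => X s ω) t
  indep : ∀ (T : Finset ℝ) (c d : ℝ → ℝ),
    (∀ᵐ ω ∂P, ∑ t ∈ T, (c t * X t ω + d t * deriv (fun s => X s ω) t) = 0) →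
      ∀ t ∈ T, c t = 0 ∧ d t = 0
  nonconst : ∀ (T : Finset ℝ) (p : ℝ → ℝ), (∀ t ∈ T, t ∈ Set.Icc a b) → (∀ t ∈ T, 0 < p t) →
    ∑ t ∈ T, p t = 1 → ∀ c > 0, ∃ s, ∑ t ∈ T, p t * covFun P X s t ≠ c

/-- Conditional expectation of the sum of a measurable and an independent variable. -/
lemma condExp_add_indep {Ω : Type*} {m mΩ : MeasurableSpace Ω} {P : Measure Ω}
    [IsProbabilityMeasure P] (hle : m ≤ mΩ) {f g : Ω → ℝ} (hf : StronglyMeasurable[m] f)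
    (hfi : Integrable f P) (hg : Measurable g) (hgi : Integrable g P)
    (hind : Indep (MeasurableSpace.comap g inferInstance) m P) :
    condExp m P (f + g) =ᵐ[P] fun ω => f ω + ∫ ω, g ω ∂P := by
  have h1 := condExp_add hfi hgi m
  rw [condExp_of_stronglyMeasurable hle hf hfi] at h1
  have h2 : condExp m P g =ᵐ[P] fun _ => ∫ ω, g ω ∂P :=
    condExp_indep_eq hg.comap_le hle (comap_measurable _).stronglyMeasurable hind
  filter_upwards [h1, h2] with ω e1 e2
  rw [e1, Pi.add_apply, e2]

/-! ### Regression on finitely many values and its residual -/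

section Residual

variable {Ω : Type*} [MeasurableSpace Ω] (P : Measure Ω) (X : ℝ → Ω → ℝ) (F : Finset ℝ)

/-- The covariance matrix of `(X_s)_{s ∈ F}`. -/
noncomputable def gramMatrix : Matrix F F ℝ := Matrix.of fun i j => covFun P X i j

/-- The coefficients of the regression of `X_t` on `(X_s)_{s ∈ F}`. -/
noncomputable def regCoeff (t : ℝ) (i : F) : ℝ :=
  (gramMatrix P X F)⁻¹.mulVec (fun j => covFun P X t j) i

/-- The residual of the regression of `X_t` on `(X_s)_{s ∈ F}`. -/
noncomputable def residual (t : ℝ) (ω : Ω) : ℝ := X t ω - ∑ i : F, regCoeff P X F t i * X i ω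

variable {P X F} {a b : ℝ}

lemma covFun_comm (s t : ℝ) : covFun P X s t = covFun P X t s := by
  simp only [covFun, mul_comm]

lemma regCoeff_eq_sum (t : ℝ) (i : F) :
    regCoeff P X F t i = ∑ j : F, (gramMatrix P X F)⁻¹ i j * covFun P X t j := rfl

variable [IsProbabilityMeasure P] (h : IsRegular P X a b)
include h

omit [IsProbabilityMeasure P] in
lemma IsRegular.posDef : (gramMatrix P X F).PosDef := by
  refine posDef_gram (ξ := fun i : F => X i) (fun i => h.gaussian.memLp i) (fun i j => rfl)
    fun c hc => ?_
  have h1 := h.indep F (fun t => if ht : t ∈ F then c ⟨t, ht⟩ else 0) (fun _ => 0) (by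
    filter_upwards [hc] with ω hω
    refine Eq.trans ?_ hω
    rw [← Finset.sum_coe_sort]
    refine Finset.sum_congr rfl fun i _ => ?_
    simp)
  ext i
  simpa using (h1 i i.2).1

omit [IsProbabilityMeasure P] in
lemma IsRegular.isUnit_det : IsUnit (gramMatrix P X F).det :=
  isUnit_iff_ne_zero.mpr h.posDef.det_pos.ne'

omit [IsProbabilityMeasure P] in
lemma IsRegular.regCoeff_apply_mem (j i : F) :
    regCoeff P X F j i = if i = j then 1 else 0 := by
  have h1 : (fun k : F => covFun P X j k) = (gramMatrix P X F).mulVec (Pi.single j 1) := by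
    ext k
    simp [gramMatrix, covFun_comm (P := P) (j : ℝ)]
  rw [regCoeff, h1, Matrix.mulVec_mulVec, Matrix.nonsing_inv_mul _ h.isUnit_det, Matrix.one_mulVec,
    Pi.single_apply]

omit [IsProbabilityMeasure P] in
lemma IsRegular.analyticOnNhd_regCoeff (i : F) :
    AnalyticOnNhd ℝ (fun t => regCoeff P X F t i) Set.univ := by
  simp only [regCoeff_eq_sum]
  refine Finset.analyticOnNhd_fun_sum _ fun j _ => ?_
  exact analyticOnNhd_const.mul (h.analytic j)

omit [IsProbabilityMeasure P] in
lemma IsRegular.continuous_regCoeff (i : F) : Continuous (fun t => regCoeff P X F t i) :=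
  continuousOn_univ.mp (h.analyticOnNhd_regCoeff i).continuousOn

omit [IsProbabilityMeasure P] in
lemma IsRegular.differentiable_regCoeff (i : F) : Differentiable ℝ (fun t => regCoeff P X F t i) :=
  fun t => (h.analyticOnNhd_regCoeff i t trivial).differentiableAt

omit [IsProbabilityMeasure P] in
lemma IsRegular.continuous_residual (ω : Ω) : Continuous fun t => residual P X F t ω := by
  have h1 := h.continuous_regCoeff (F := F)
  have h2 := h.gaussian.continuous ω
  unfold residual
  fun_prop

omit [IsProbabilityMeasure P] in
lemma IsRegular.measurable_residual (t : ℝ) : Measurable (residual P X F t) := by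
  have h1 := h.gaussian.measurable
  unfold residual
  fun_prop

omit [IsProbabilityMeasure P] in
lemma IsRegular.residual_apply_mem (i : F) (ω : Ω) : residual P X F i ω = 0 := by
  simp [residual, h.regCoeff_apply_mem]

omit [IsProbabilityMeasure P] in
lemma IsRegular.memLp_residual (t : ℝ) : MemLp (residual P X F t) 2 P :=
  (h.gaussian.memLp t).sub (memLp_finsetSum _ fun i _ => (h.gaussian.memLp i).const_mul _)

lemma IsRegular.integral_residual (t : ℝ) : ∫ ω, residual P X F t ω ∂P = 0 := by
  have hi : ∀ t, Integrable (X t) P := fun t => (h.gaussian.memLp t).integrable (by norm_num)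
  have hi' : ∀ i : F, Integrable (fun ω => regCoeff P X F t i * X i ω) P := fun i =>
    (hi i).const_mul _
  unfold residual
  rw [integral_sub (hi t) (integrable_finsetSum _ fun i _ => hi' i),
    integral_finsetSum _ fun i _ => hi' i]
  simp [integral_const_mul, h.gaussian.centered]

omit [IsProbabilityMeasure P] in
-- These are the normal equations: the coefficients are `G⁻¹` applied to the covariances with `X_t`.
lemma IsRegular.integral_mul_residual (i : F) (t : ℝ) :
    ∫ ω, X i ω * residual P X F t ω ∂P = 0 := by
  have hL := h.gaussian.memLp
  have e : ∀ ω, X i ω * residual P X F t ω =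
      X i ω * X t ω - ∑ j : F, regCoeff P X F t j * (X i ω * X j ω) := by
    intro ω
    rw [residual, mul_sub, Finset.mul_sum]
    congr 1
    exact Finset.sum_congr rfl fun j _ => by ring
  simp_rw [e]
  have hi : ∀ t, Integrable (fun ω => X i ω * X t ω) P := fun t => (hL i).integrable_mul (hL t)
  have hi' : ∀ j : F, Integrable (fun ω => regCoeff P X F t j * (X i ω * X j ω)) P := fun j =>
    (hi j).const_mul _
  rw [integral_sub (hi t) (integrable_finsetSum _ fun j _ => hi' j),
    integral_finsetSum _ fun j _ => hi' j]
  simp_rw [integral_const_mul]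
  have h1 : ∑ j : F, regCoeff P X F t j * ∫ ω, X i ω * X j ω ∂P =
      (gramMatrix P X F).mulVec (regCoeff P X F t) i := by
    simp only [Matrix.mulVec, dotProduct, gramMatrix, Matrix.of_apply, covFun, mul_comm]
  have h2 : regCoeff P X F t = (gramMatrix P X F)⁻¹.mulVec (fun j => covFun P X t j) := rfl
  rw [h1, h2, Matrix.mulVec_mulVec, Matrix.mul_nonsing_inv _ h.isUnit_det, Matrix.one_mulVec,
    covFun_comm, covFun, sub_self]

/-- The residual process is independent of the regressors. -/
lemma IsRegular.indepFun_residual :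
    IndepFun (fun ω (i : F) => X i ω) (fun ω t => residual P X F t ω) P := by
  classical
  refine IsGaussianProcess.indepFun_of_covariance_eq_zero (X := fun i : F => X i)
    (Y := residual P X F) ?_ (fun i => (h.gaussian.measurable i).aemeasurable)
    (fun t => (h.measurable_residual t).aemeasurable) fun i t => ?_
  · refine isGaussianProcess_of_sum h.gaussian.gaussian ?_
    rintro (i | t)
    · exact ⟨{(i : ℝ)}, fun _ => 1, fun ω => by simp⟩
    -- Coefficients are subtracted so that the formula also covers `t ∈ F`, where both terms live at
    -- the same time.
    · refine ⟨insert t F, fun s => (if s = t then 1 else 0) -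
        if hs : s ∈ F then regCoeff P X F t ⟨s, hs⟩ else 0, fun ω => ?_⟩
      simp only [Sum.elim_inr, residual, sub_mul, Finset.sum_sub_distrib]
      congr 1
      · simp
      · rw [Finset.sum_insert_of_eq_zero_if_notMem (fun ht => by simp [ht]), ← Finset.sum_coe_sort F]
        exact Finset.sum_congr rfl fun i _ => by simp
  · rw [covariance_eq_sub (h.gaussian.memLp i) (h.memLp_residual t), h.gaussian.centered, zero_mul,
      sub_zero]
    exact h.integral_mul_residual i t

/-- The residual process as a random continuous function. -/
noncomputable def IsRegular.residualPath (F : Finset ℝ) (ω : Ω) : {y : ℝ → ℝ // Continuous y} :=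
  ⟨fun t => residual P X F t ω, h.continuous_residual ω⟩

omit [IsProbabilityMeasure P] in
lemma IsRegular.measurable_residualPath : Measurable (h.residualPath F) :=
  Measurable.subtype_mk (measurable_pi_lambda _ fun t => h.measurable_residual t)

lemma IsRegular.indepFun_residualPath :
    IndepFun (fun ω (i : F) => X i ω) (h.residualPath F) P := by
  have h1 := h.indepFun_residual (F := F)
  rw [IndepFun_iff_Indep] at h1 ⊢
  convert h1 using 1
  exact MeasurableSpace.comap_comp

/-- The regression function at one. -/
lemma IsRegular.isCondMeanAtOne (t : ℝ) :
    IsCondMeanAtOne P X F t (∑ i : F, regCoeff P X F t i) := by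
  refine ⟨fun x => ∑ i : F, regCoeff P X F t i * x i, by fun_prop, ?_, by simp⟩
  have hXF : Measurable (fun (ω : Ω) (s : F) => X s ω) :=
    measurable_pi_lambda _ fun s => h.gaussian.measurable s
  have hi : ∀ t, Integrable (X t) P := fun t => (h.gaussian.memLp t).integrable (by norm_num)
  have hdec : X t = (fun ω => ∑ i : F, regCoeff P X F t i * X i ω) + residual P X F t := by
    ext ω
    simp [residual]
  have hlin : StronglyMeasurable[MeasurableSpace.comap (fun (ω : Ω) (s : F) => X s ω)
      MeasurableSpace.pi] (fun ω => ∑ i : F, regCoeff P X F t i * X i ω) := by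
    have h1 : Measurable fun x : F → ℝ => ∑ i : F, regCoeff P X F t i * x i := by fun_prop
    exact (h1.comp (comap_measurable _)).stronglyMeasurable
  have hind : Indep (MeasurableSpace.comap (residual P X F t) inferInstance)
      (MeasurableSpace.comap (fun (ω : Ω) (s : F) => X s ω) MeasurableSpace.pi) P := by
    have h1 := (h.indepFun_residual (F := F)).symm.comp (measurable_pi_apply t) measurable_id
    exact (IndepFun_iff_Indep _ _ _).mp h1
  have h1 := condExp_add_indep hXF.comap_le hlin
    (integrable_finsetSum _ fun i _ => (hi i).const_mul _) (h.measurable_residual t)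
    ((h.memLp_residual t).integrable (by norm_num)) hind
  rw [← hdec, h.integral_residual] at h1
  simpa using h1

omit [IsProbabilityMeasure P] in
lemma IsRegular.hasGaussianLaw (F : Finset ℝ) : HasGaussianLaw (fun ω (i : F) => X i ω) P :=
  h.gaussian.gaussian.hasGaussianLaw F

/-- Two continuous versions agree almost everywhere for the law of `(X_s)`, hence for Lebesgue
measure, hence everywhere and in particular at the point of ones. -/
lemma IsRegular.condMean_unique {t c : ℝ} (hc : IsCondMeanAtOne P X F t c) :
    c = ∑ i : F, regCoeff P X F t i := by
  obtain ⟨m, hm, h1, rfl⟩ := hc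
  obtain ⟨m', hm', h1', hc'⟩ := h.isCondMeanAtOne (F := F) t
  rw [hc']
  have hac := volume_absolutelyContinuous_gaussian (h.hasGaussianLaw F)
    (fun i => h.gaussian.centered i) (G := gramMatrix P X F) (fun i j => rfl) h.posDef
  have hXF : Measurable (fun (ω : Ω) (s : F) => X s ω) :=
    measurable_pi_lambda _ fun s => h.gaussian.measurable s
  have h2 : m =ᵐ[P.map fun (ω : Ω) (s : F) => X s ω] m' := by
    rw [Filter.EventuallyEq, ae_map_iff hXF.aemeasurable
      (measurableSet_eq_fun hm.measurable hm'.measurable)]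
    filter_upwards [h1, h1'] with ω e1 e2
    rw [← e1, e2]
  exact congrFun ((hm.ae_eq_iff_eq volume hm').mp (hac.ae_le h2)) _

lemma IsRegular.condMeanAtOne_eq (t : ℝ) :
    condMeanAtOne P X (F : Set ℝ) t = ∑ i : F, regCoeff P X F t i := by
  have hex : ∃ c : ℝ, ∃ F' : Finset ℝ, (F' : Set ℝ) = F ∧ IsCondMeanAtOne P X F' t c :=
    ⟨_, F, rfl, h.isCondMeanAtOne t⟩
  obtain ⟨F', hF', hc⟩ := Classical.epsilon_spec hex
  rw [Finset.coe_inj] at hF'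
  subst hF'
  exact h.condMean_unique hc

/-- The derivative of the residual. -/
noncomputable def residualDeriv (P : Measure Ω) (X : ℝ → Ω → ℝ) (F : Finset ℝ) (t : ℝ) (ω : Ω) : ℝ :=
  deriv (fun s => X s ω) t - ∑ i : F, deriv (fun s => regCoeff P X F s i) t * X i ω

omit [IsProbabilityMeasure P] in
lemma IsRegular.hasDerivAt_residual (t : ℝ) :
    ∀ᵐ ω ∂P, HasDerivAt (fun s => residual P X F s ω) (residualDeriv P X F t ω) t := by
  filter_upwards [h.differentiable t] with ω hω
  refine hω.hasDerivAt.sub (HasDerivAt.fun_sum fun i _ => ?_)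
  exact ((h.differentiable_regCoeff i t).hasDerivAt).mul_const _

end Residual

/-! ### Signs of the residual at contact points and end points -/

section Nondegenerate

variable {Ω : Type*} [MeasurableSpace Ω] {P : Measure Ω} {X : ℝ → Ω → ℝ} {F : Finset ℝ} {a b : ℝ}

lemma residual_eq_sum {T : Finset ℝ} (hF : F ⊆ T) {t : ℝ} (ht : t ∈ T) (ω : Ω) :
    residual P X F t ω = ∑ s ∈ T, ((if s = t then 1 else 0) -
      if hs : s ∈ F then regCoeff P X F t ⟨s, hs⟩ else 0) * X s ω := by
  simp only [residual, sub_mul, Finset.sum_sub_distrib]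
  congr 1
  · simp [ht]
  · rw [← Finset.sum_subset hF (fun s _ hs => by simp [hs]), ← Finset.sum_coe_sort F]
    exact Finset.sum_congr rfl fun i _ => by simp

lemma residualDeriv_eq_sum {T : Finset ℝ} (hF : F ⊆ T) {t : ℝ} (ht : t ∈ T) (ω : Ω) :
    residualDeriv P X F t ω = ∑ s ∈ T, ((if s = t then 1 else 0) * deriv (fun r => X r ω) s -
      (if hs : s ∈ F then deriv (fun r => regCoeff P X F r ⟨s, hs⟩) t else 0) * X s ω) := by
  simp only [residualDeriv, Finset.sum_sub_distrib]
  congr 1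
  · simp [ht]
  · rw [← Finset.sum_subset hF (fun s _ hs => by simp [hs]), ← Finset.sum_coe_sort F]
    exact Finset.sum_congr rfl fun i _ => by simp

/-- The variables deciding which of the contact points contribute. -/
noncomputable def boundaryVariables (P : Measure Ω) (X : ℝ → Ω → ℝ) (F Z : Finset ℝ) (a b : ℝ) :
    Z ⊕ Bool → Ω → ℝ
  | Sum.inl z => residual P X F z
  | Sum.inr true => residualDeriv P X F a
  | Sum.inr false => fun ω => -residualDeriv P X F b ω

variable [IsProbabilityMeasure P]

/-- The boundary variables form a non-degenerate Gaussian vector. -/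
theorem IsRegular.boundaryVariables_nondegenerate (h : IsRegular P X a b) (hab : a < b)
    {Z : Finset ℝ} (hZ : ∀ z ∈ Z, z ∉ F) :
    (∀ᵐ ω ∂P, ∀ k, boundaryVariables P X F Z a b k ω ≠ 0) ∧
      P {ω | ∀ k, 0 < boundaryVariables P X F Z a b k ω} ≠ 0 := by
  classical
  set ζ := boundaryVariables P X F Z a b with hζ
  obtain ⟨hW, hD0⟩ := h.gaussian.with_deriv h.differentiable
  set W := Sum.elim X fun t ω => deriv (fun s => X s ω) t with hWdef
  have hW0 : ∀ p, ∫ ω, W p ω ∂P = 0 := by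
    rintro (t | t)
    · exact h.gaussian.centered t
    · exact hD0 t
  set T : Finset ℝ := F ∪ Z ∪ {a, b} with hT
  have hFT : F ⊆ T := fun x hx => by simp [hT, hx]
  have hZT : ∀ z ∈ Z, z ∈ T := fun x hx => by simp [hT, hx]
  have haT : a ∈ T := by simp [hT]
  have hbT : b ∈ T := by simp [hT]
  set e : ℝ → ℝ → ℝ := fun t s => if hs : s ∈ F then regCoeff P X F t ⟨s, hs⟩ else 0 with he
  set e' : ℝ → ℝ → ℝ := fun t s =>
    if hs : s ∈ F then deriv (fun r => regCoeff P X F r ⟨s, hs⟩) t else 0 with he'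
  let γ : Z ⊕ Bool → ℝ → ℝ := fun k s => match k with
    | Sum.inl z => (if s = z then 1 else 0) - e z s
    | Sum.inr true => - e' a s
    | Sum.inr false => e' b s
  let δ : Z ⊕ Bool → ℝ → ℝ := fun k s => match k with
    | Sum.inl _ => 0
    | Sum.inr true => if s = a then 1 else 0
    | Sum.inr false => - if s = b then 1 else 0
  have hrep : ∀ k ω, ζ k ω = ∑ s ∈ T, (γ k s * X s ω + δ k s * deriv (fun r => X r ω) s) := by
    rintro (z | _ | _) ω
    · simp only [hζ, boundaryVariables, residual_eq_sum hFT (hZT z z.2), γ, δ, e, zero_mul, add_zero]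
    · simp only [hζ, boundaryVariables, residualDeriv_eq_sum hFT hbT, γ, δ, e',
        ← Finset.sum_neg_distrib]
      exact Finset.sum_congr rfl fun s _ => by ring
    · simp only [hζ, boundaryVariables, residualDeriv_eq_sum hFT haT, γ, δ, e']
      exact Finset.sum_congr rfl fun s _ => by ring
  have hrepW : ∀ k ω, ζ k ω = ∑ p ∈ T.disjSum T, Sum.elim (γ k) (δ k) p * W p ω := by
    intro k ω
    rw [hrep, Finset.sum_disjSum, ← Finset.sum_add_distrib]
    rfl
  have hG : IsGaussianProcess ζ P := isGaussianProcess_of_sum hW fun k => ⟨_, _, hrepW k⟩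
  have hGl : HasGaussianLaw (fun ω k => ζ k ω) P := by
    have h1 := hG.hasGaussianLaw Finset.univ
    let L : ({k // k ∈ (Finset.univ : Finset (Z ⊕ Bool))} → ℝ) →L[ℝ] (Z ⊕ Bool → ℝ) :=
      ContinuousLinearMap.pi fun k =>
        ContinuousLinearMap.proj (R := ℝ) (φ := fun _ => ℝ) ⟨k, Finset.mem_univ k⟩
    exact h1.map_fun L
  have hWi : ∀ p, Integrable (W p) P := fun p => (hW.hasGaussianLaw_eval p).integrable
  have hζ0 : ∀ k, ∫ ω, ζ k ω ∂P = 0 := by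
    intro k
    simp_rw [hrepW]
    rw [integral_finsetSum _ fun p _ => (hWi p).const_mul _]
    simp [integral_const_mul, hW0]
  -- Each boundary variable owns a coordinate: the value at `z ∉ F` occurs only in the residual at
  -- `z`, and the derivatives at `a ≠ b` only in the respective end point variable.
  have hlin : ∀ c : Z ⊕ Bool → ℝ, (∀ᵐ ω ∂P, ∑ k, c k * ζ k ω = 0) → c = 0 := by
    intro c hc
    have h1 := h.indep T (fun s => ∑ k, c k * γ k s) (fun s => ∑ k, c k * δ k s) (by
      filter_upwards [hc] with ω hω
      refine Eq.trans ?_ hω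
      simp_rw [hrep, Finset.mul_sum]
      rw [Finset.sum_comm]
      refine Finset.sum_congr rfl fun s _ => ?_
      rw [Finset.sum_mul, Finset.sum_mul, ← Finset.sum_add_distrib]
      exact Finset.sum_congr rfl fun k _ => by ring)
    ext k
    rcases k with z | _ | _
    · have h2 := (h1 z (hZT z z.2)).1
      simp only [Fintype.sum_sum_type, γ, e, e', hZ z z.2, dite_false, sub_zero, neg_zero, mul_zero,
        add_zero, Fintype.sum_bool] at h2
      have h3 : ∑ x : Z, c (Sum.inl x) * (if (z : ℝ) = (x : ℝ) then 1 else 0) = c (Sum.inl z) := by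
        rw [Finset.sum_eq_single z]
        · simp
        · intro x _ hx
          have : (z : ℝ) ≠ x := fun hh => hx (Subtype.ext hh.symm)
          simp [this]
        · simp
      rw [h3] at h2
      simpa using h2
    · have h2 := (h1 b hbT).2
      simpa [Fintype.sum_sum_type, δ, hab.ne'] using h2
    · have h2 := (h1 a haT).2
      simpa [Fintype.sum_sum_type, δ, hab.ne] using h2
  have hL2 : ∀ k, MemLp (ζ k) 2 P := fun k => (hG.hasGaussianLaw_eval k).memLp_two
  set G : Matrix (Z ⊕ Bool) (Z ⊕ Bool) ℝ := Matrix.of fun i j => ∫ ω, ζ i ω * ζ j ω ∂P with hGdef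
  have hpd : G.PosDef := posDef_gram hL2 (fun i j => rfl) hlin
  have hac := volume_absolutelyContinuous_gaussian hGl hζ0 (G := G) (fun i j => rfl) hpd
  have hac' : P.map (fun ω k => ζ k ω) ≪ volume := by
    obtain ⟨C, -, hC⟩ := exists_gaussian_density hGl hζ0 (G := G) (fun i j => rfl) hpd
    rw [hC]
    exact withDensity_absolutelyContinuous _ _
  constructor
  · have h1 : ∀ᵐ v ∂(P.map fun ω k => ζ k ω), ∀ i, v i ≠ 0 :=
      hac'.ae_le ((ae_no_ties (0 : Z ⊕ Bool → ℝ)).mono fun v hv => hv.1)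
    exact ae_of_ae_map hGl.aemeasurable h1
  · intro h0
    have h1 : P.map (fun ω k => ζ k ω) (orthant (Z ⊕ Bool)) = 0 := by
      rw [Measure.map_apply_of_aemeasurable hGl.aemeasurable measurableSet_orthant]
      exact h0
    have ho : IsOpen (orthant (Z ⊕ Bool)) := by
      have : orthant (Z ⊕ Bool) = Set.univ.pi fun _ => Set.Ioi 0 := by ext; simp [orthant]
      rw [this]
      exact isOpen_set_pi Set.finite_univ fun _ _ => isOpen_Ioi
    exact (ho.measure_pos volume ⟨fun _ => 1, fun _ => one_pos⟩).ne' (hac h1)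

end Nondegenerate

/-! ### The cost at a contact point -/

section CostExistence

variable {a b z : ℝ} {q y : ℝ → ℝ}

lemma isLittleO_second_order (hq : ContDiff ℝ 2 q) (hqz : q z = 0) :
    (fun t => q t - (deriv q z * (t - z) + iteratedDeriv 2 q z / 2 * (t - z) ^ 2)) =o[𝓝 z]
      fun t => (t - z) ^ 2 := by
  have h := taylor_isLittleO_univ (n := 2) (x₀ := z) hq
  refine h.congr_left fun t => ?_
  rw [taylorWithinEval_succ, taylorWithinEval_succ, taylor_within_zero_eval]
  simp only [iteratedDerivWithin_univ, iteratedDeriv_one, hqz, smul_eq_mul, zero_add]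
  norm_num
  ring

/-- Evaluate at `z + e / u`: `u q` tends to `e * q1`, and if `q1 = 0` then `u² q` tends to `κ / 2`.
-/
lemma coefficients_nonneg {K : Set ℝ} (e q1 κ : ℝ) (he : e * e = 1)
    (hK' : ∀ᶠ u in atTop, z + e / u ∈ K) (hq0 : ∀ t ∈ K, 0 ≤ q t)
    (hq : (fun t => q t - (q1 * (t - z) + κ / 2 * (t - z) ^ 2)) =o[𝓝[K] z] fun t => (t - z) ^ 2)
    (hq' : (fun t => q t - q1 * (t - z)) =o[𝓝[K] z] fun t => t - z) :
    0 ≤ e * q1 ∧ (q1 = 0 → 0 ≤ κ) := by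
  have he0 : e ≠ 0 := by rintro rfl; simp at he
  have hlim : Tendsto (fun u : ℝ => z + e / u) atTop (𝓝[K] z) := by
    refine tendsto_nhdsWithin_iff.mpr ⟨?_, hK'⟩
    simpa using (tendsto_const_nhds (x := e)).div_atTop tendsto_id |>.const_add z
  constructor
  · have h1 := (hq'.tendsto_div_nhds_zero.comp hlim).const_mul e
    refine ge_of_tendsto (a := e * q1) (b := 0) (f := fun u : ℝ => u * q (z + e / u)) (x := atTop) ?_ ?_
    · have h2 := h1.add_const (e * q1)
      simp only [mul_zero, zero_add] at h2
      refine h2.congr' ?_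
      filter_upwards [eventually_gt_atTop 0] with u hu
      simp only [Function.comp_apply, add_sub_cancel_left]
      field_simp
      ring
    · filter_upwards [hK', eventually_gt_atTop 0] with u h3 h4
      exact mul_nonneg h4.le (hq0 _ h3)
  · rintro rfl
    have h1 := hq.tendsto_div_nhds_zero.comp hlim
    have : 0 ≤ κ / 2 := by
      refine ge_of_tendsto (a := κ / 2) (b := 0) (f := fun u : ℝ => u ^ 2 * q (z + e / u)) (x := atTop) ?_ ?_
      · have h2 := h1.add_const (κ / 2)
        simp only [zero_add] at h2
        refine h2.congr' ?_
        filter_upwards [eventually_gt_atTop 0] with u hu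
        simp only [Function.comp_apply, add_sub_cancel_left]
        have he2 : e ^ 2 = 1 := by rw [sq, he]
        rw [div_pow, he2]
        field_simp
        ring
      · filter_upwards [hK', eventually_gt_atTop 0] with u h3 h4
        exact mul_nonneg (by positivity) (hq0 _ h3)
    linarith

/-- The local minimum at a contact point. -/
theorem exists_cost (hab : a < b) (hz : z ∈ Set.Icc a b) (hq : ContDiff ℝ 2 q)
    (hq0 : ∀ t ∈ Set.Icc a b, 0 ≤ q t) (hqz : q z = 0) (hyz : y z = 0) {Z : ℝ}
    (hy : HasDerivAt y Z z) (hint : z ∈ Set.Ioo a b → 0 < iteratedDeriv 2 q z)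
    (hZ : z = a ∨ z = b → Z ≠ 0) :
    (∃ c, LocalLimit (fun u t => u ^ 2 * q t + u * y t) (Set.Icc a b) z (-c)) ∨
    (((z = a ∧ Z < 0) ∨ (z = b ∧ 0 < Z)) ∧
      ∀ m, LocalUpper (fun u t => u ^ 2 * q t + u * y t) (Set.Icc a b) z m) := by
  have h1 := isLittleO_second_order hq hqz
  have h2 : (fun t => q t - deriv q z * (t - z)) =o[𝓝 z] fun t => t - z := by
    have := (hq.differentiable two_ne_zero z).hasDerivAt.isLittleO
    simpa [hqz, mul_comm] using this
  have h3 : (fun t => y t - Z * (t - z)) =o[𝓝 z] fun t => t - z := by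
    have := hy.isLittleO
    simpa [hyz, mul_comm] using this
  have hle : 𝓝[Set.Icc a b] z ≤ 𝓝 z := nhdsWithin_le_nhds
  have hlim : ∀ x : ℝ, Tendsto (fun u : ℝ => z + x / u) atTop (𝓝 z) := fun x => by
    simpa using (tendsto_const_nhds (x := x)).div_atTop tendsto_id |>.const_add z
  rcases eq_or_lt_of_le hz.1 with rfl | hza
  · have hK' : ∀ x ≥ (0 : ℝ), ∀ᶠ u in atTop, a + (1 * x) / u ∈ Set.Icc a b := by
      intro x hx
      filter_upwards [(hlim (1 * x)).eventually_le_const hab, eventually_gt_atTop 0] with u h4 h5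
      exact ⟨by have : 0 ≤ (1 * x) / u := by positivity
                linarith, h4⟩
    obtain ⟨c1, c2⟩ := coefficients_nonneg 1 _ _ (by norm_num)
      (by simpa using hK' 1 zero_le_one) hq0 (h1.mono hle) (h2.mono hle)
    rcases endpoint_cost 1 Z _ _ hz hqz hyz (fun t ht => by linarith [ht.1]) (by norm_num) hK' hq0
      (h1.mono hle) (h2.mono hle) (h3.mono hle) (hZ (Or.inl rfl)) c1 c2 with ⟨c, -, hc⟩ | ⟨hc, h'⟩
    · exact Or.inl ⟨c, hc⟩
    · exact Or.inr ⟨Or.inl ⟨rfl, by linarith⟩, h'⟩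
  rcases eq_or_lt_of_le hz.2 with rfl | hzb
  · have hK' : ∀ x ≥ (0 : ℝ), ∀ᶠ u in atTop, z + (-1 * x) / u ∈ Set.Icc a z := by
      intro x hx
      filter_upwards [(hlim (-1 * x)).eventually_const_le hab, eventually_gt_atTop 0] with u h4 h5
      refine ⟨h4, ?_⟩
      have : 0 ≤ x / u := by positivity
      have : (-1 * x) / u = - (x / u) := by ring
      linarith
    obtain ⟨c1, c2⟩ := coefficients_nonneg (-1) _ _ (by norm_num)
      (by simpa using hK' 1 zero_le_one) hq0 (h1.mono hle) (h2.mono hle)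
    rcases endpoint_cost (-1) Z _ _ hz hqz hyz (fun t ht => by linarith [ht.2]) (by norm_num) hK' hq0
      (h1.mono hle) (h2.mono hle) (h3.mono hle) (hZ (Or.inr rfl)) c1 c2 with ⟨c, -, hc⟩ | ⟨hc, h'⟩
    · exact Or.inl ⟨c, hc⟩
    · exact Or.inr ⟨Or.inr ⟨rfl, by linarith⟩, h'⟩
  · left
    have hnhds : Set.Icc a b ∈ 𝓝 z := Icc_mem_nhds hza hzb
    have hmin : IsLocalMin q z := by
      filter_upwards [hnhds] with t ht
      rw [hqz]
      exact hq0 t ht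
    rw [hmin.deriv_eq_zero] at h1
    refine ⟨Z ^ 2 / (2 * iteratedDeriv 2 q z),
      localLimit_of_quadratic _ Z (hint ⟨hza, hzb⟩) (h1.mono hle) (h3.mono hle) ?_⟩
    exact (hlim _).eventually hnhds

end CostExistence

/-! ### The substitution `x = u + v / u` -/

section ChangeOfVariables

variable {Ω : Type*} [MeasurableSpace Ω] {P : Measure Ω} [IsProbabilityMeasure P]
  {X : ℝ → Ω → ℝ} {F : Finset ℝ} {a b : ℝ}

/-- The excess of the regression function at one. -/
noncomputable def regExcess (P : Measure Ω) (X : ℝ → Ω → ℝ) (F : Finset ℝ) (t : ℝ) : ℝ :=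
  ∑ i : F, regCoeff P X F t i - 1

/-- The exponential rates of the rescaled vector. -/
noncomputable def minRate (P : Measure Ω) (X : ℝ → Ω → ℝ) (F : Finset ℝ) : F → ℝ :=
  (gramMatrix P X F)⁻¹.mulVec 1

/-- The quadratic form of the density of `(X_s)_{s ∈ F}`. -/
noncomputable def gramForm (P : Measure Ω) (X : ℝ → Ω → ℝ) (F : Finset ℝ) (x : F → ℝ) : ℝ :=
  x ⬝ᵥ (gramMatrix P X F)⁻¹.mulVec x

omit [IsProbabilityMeasure P] in
lemma continuous_gramForm : Continuous (gramForm P X F) := by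
  unfold gramForm
  simp only [dotProduct, Matrix.mulVec]
  fun_prop

omit [IsProbabilityMeasure P] in
lemma IsRegular.gramForm_nonneg (h : IsRegular P X a b) (x : F → ℝ) : 0 ≤ gramForm P X F x := by
  have := (h.posDef (F := F)).inv.posSemidef.dotProduct_mulVec_nonneg x
  simpa [gramForm] using this

omit [IsProbabilityMeasure P] in
-- The scale `1 / u` makes the cross term independent of `u`. After halving it gives the exponential
-- rates, while the last term vanishes in the limit.
lemma IsRegular.gramForm_rescaled (h : IsRegular P X a b) {u : ℝ} (hu : 0 < u) (v : F → ℝ) :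
    gramForm P X F (u • 1 + u⁻¹ • v) =
      u ^ 2 * gramForm P X F 1 + 2 * ∑ i, minRate P X F i * v i + gramForm P X F v / u ^ 2 := by
  have hsym : ∀ x y : F → ℝ, x ⬝ᵥ (gramMatrix P X F)⁻¹.mulVec y =
      y ⬝ᵥ (gramMatrix P X F)⁻¹.mulVec x := by
    intro x y
    have h1 : (gramMatrix P X F)⁻¹.transpose = (gramMatrix P X F)⁻¹ := by
      simpa [Matrix.IsHermitian] using (h.posDef (F := F)).inv.isHermitian
    rw [Matrix.dotProduct_mulVec, ← Matrix.mulVec_transpose, h1, dotProduct_comm]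
  have h2 : ∑ i, minRate P X F i * v i = v ⬝ᵥ (gramMatrix P X F)⁻¹.mulVec 1 := by
    rw [dotProduct_comm]
    rfl
  simp only [gramForm, Matrix.mulVec_add, Matrix.mulVec_smul, add_dotProduct, dotProduct_add,
    smul_dotProduct, dotProduct_smul, smul_eq_mul, h2]
  rw [hsym 1 v]
  field_simp
  ring

/-- Exceedances of the level `u`, expressed through the rescaled paths. -/
theorem IsRegular.integral_exceedanceValue (h : IsRegular P X a b) (hab : a ≤ b) (F : Finset ℝ)
    {u : ℝ} (hu : 0 < u) : ∃ K > 0, ∀ (f : ℝ →ᵇ ℝ),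
      AEStronglyMeasurable (fun ω => ∫ v : F → ℝ, innerIntegrand a b (regExcess P X F)
        (fun t => residual P X F t ω) (regCoeff P X F) (minRate P X F) (gramForm P X F) f u v) P ∧
      ∫ ω, exceedanceValue a b u f (fun t => X t ω) ∂P =
        K * ∫ ω, (∫ v : F → ℝ, innerIntegrand a b (regExcess P X F) (fun t => residual P X F t ω)
          (regCoeff P X F) (minRate P X F) (gramForm P X F) f u v) ∂P := by
  obtain ⟨C, hC, hlaw⟩ := exists_gaussian_density (h.hasGaussianLaw F)
    (fun i => h.gaussian.centered i) (G := gramMatrix P X F) (fun i j => rfl) h.posDef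
  set k := Module.finrank ℝ (F → ℝ)
  -- Jacobian times the part of the density not involving `v`. It is independent of `f` and thus
  -- cancels in conditional expectations.
  set K := (u ^ k)⁻¹ * (C * Real.exp (-(u ^ 2 * gramForm P X F 1) / 2)) with hK
  have hK0 : 0 < K := by positivity
  refine ⟨K, hK0, fun f => ?_⟩
  have hAc := h.continuous_regCoeff (F := F)
  -- Residuals range over continuous functions only, since measurability of the exceedance
  -- functional needs every path to be continuous.
  set H : (F → ℝ) × {y : ℝ → ℝ // Continuous y} → ℝ := fun p =>
    exceedanceValue a b u f (fun t => ∑ i, p.1 i * regCoeff P X F t i + p.2.1 t) with hH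
  have hpath : ∀ p : (F → ℝ) × {y : ℝ → ℝ // Continuous y},
      Continuous fun t => ∑ i, p.1 i * regCoeff P X F t i + p.2.1 t := by
    intro p
    have := p.2.2
    fun_prop
  have hHm : Measurable H := by
    refine measurable_exceedanceValue
      (Z := fun t (p : (F → ℝ) × {y : ℝ → ℝ // Continuous y}) =>
        ∑ i, p.1 i * regCoeff P X F t i + p.2.1 t) hab (fun t => ?_) hpath u f.continuous.measurable
    have h1 : Measurable fun p : (F → ℝ) × {y : ℝ → ℝ // Continuous y} => p.2.1 t :=
      (measurable_pi_apply t).comp (measurable_subtype_coe.comp measurable_snd)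
    fun_prop
  have hXF : Measurable (fun ω (i : F) => X i ω) :=
    measurable_pi_lambda _ fun s => h.gaussian.measurable s
  obtain ⟨hm, hint⟩ := integral_of_indepFun hXF h.measurable_residualPath
    h.indepFun_residualPath hHm (C := ‖f‖) fun p => abs_exceedanceValue_le fun t => f.norm_coe_le_norm t
  have hinner : ∀ ω, ∫ x, H (x, h.residualPath F ω) ∂(P.map fun ω (i : F) => X i ω) =
      K * ∫ v : F → ℝ, innerIntegrand a b (regExcess P X F) (fun t => residual P X F t ω)
          (regCoeff P X F) (minRate P X F) (gramForm P X F) f u v := by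
    intro ω
    set Y := fun t => residual P X F t ω with hY
    have hd : Measurable fun x : F → ℝ =>
        ENNReal.ofReal (C * Real.exp (-(x ⬝ᵥ (gramMatrix P X F)⁻¹.mulVec x) / 2)) := by
      have := (continuous_gramForm (P := P) (X := X) (F := F)).measurable
      unfold gramForm at this
      fun_prop
    rw [hlaw, integral_withDensity_eq_integral_toReal_smul hd (ae_of_all _ fun _ => ENNReal.ofReal_lt_top)]
    set g : (F → ℝ) → ℝ := fun x => (ENNReal.ofReal (C * Real.exp
      (-(x ⬝ᵥ (gramMatrix P X F)⁻¹.mulVec x) / 2))).toReal • H (x, h.residualPath F ω) with hg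
    have hsub : ∫ x, g x = (u ^ k)⁻¹ * ∫ v, g (u • 1 + u⁻¹ • v) := by
      have h1 := Measure.integral_comp_smul (volume : Measure (F → ℝ)) (fun x => g (u • 1 + x)) u⁻¹
      rw [integral_add_left_eq_self (μ := volume) g] at h1
      rw [h1, inv_pow, inv_inv, abs_of_pos (pow_pos hu _), smul_eq_mul, ← mul_assoc,
        inv_mul_cancel₀ (pow_pos hu _).ne', one_mul]
    rw [hsub, hK, mul_assoc]
    congr 1
    rw [← integral_const_mul]
    refine integral_congr_ae (ae_of_all _ fun v => ?_)
    simp only [hg]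
    have hQ : (u • (1 : F → ℝ) + u⁻¹ • v) ⬝ᵥ (gramMatrix P X F)⁻¹.mulVec (u • 1 + u⁻¹ • v) =
        gramForm P X F (u • 1 + u⁻¹ • v) := rfl
    rw [hQ, h.gramForm_rescaled hu, ENNReal.toReal_ofReal (by positivity), innerIntegrand, smul_eq_mul]
    have hpath' := hpath (u • (1 : F → ℝ) + u⁻¹ • v, h.residualPath F ω)
    have hHv : H (u • (1 : F → ℝ) + u⁻¹ • v, h.residualPath F ω) =
        exceedanceValue a b 0 f (rescaledPath (regExcess P X F) Y (regCoeff P X F) u v) := by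
      simp only [hH]
      rw [exceedanceValue_affine hab hpath' hu]
      congr 1
      ext t
      have h3 : ∑ i, (u • (1 : F → ℝ) + u⁻¹ • v) i * regCoeff P X F t i =
          u * ∑ i, regCoeff P X F t i + u⁻¹ * ∑ i, v i * regCoeff P X F t i := by
        simp only [Pi.add_apply, Pi.smul_apply, Pi.one_apply, smul_eq_mul, mul_one, add_mul,
          Finset.sum_add_distrib, Finset.mul_sum, mul_assoc]
      simp only [h3, rescaledPath, regExcess, IsRegular.residualPath, hY]
      field_simp
      ring
    rw [hHv]
    have hE : Real.exp (-(u ^ 2 * gramForm P X F 1 + 2 * ∑ i, minRate P X F i * v i +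
        gramForm P X F v / u ^ 2) / 2) = Real.exp (-(u ^ 2 * gramForm P X F 1) / 2) *
        (Real.exp (-∑ i, minRate P X F i * v i) * Real.exp (-(gramForm P X F v) / (2 * u ^ 2))) := by
      rw [← Real.exp_add, ← Real.exp_add]
      congr 1
      field_simp
      ring
    rw [hE]
    ring
  constructor
  · have h1 := hm
    simp_rw [hinner] at h1
    have h2 := h1.const_mul K⁻¹
    simp_rw [← mul_assoc, inv_mul_cancel₀ hK0.ne', one_mul] at h2
    exact h2.aestronglyMeasurable
  · have h1 : ∫ ω, exceedanceValue a b u f (fun t => X t ω) ∂P =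
        ∫ ω, H (fun i => X i ω, h.residualPath F ω) ∂P := by
      refine integral_congr_ae (ae_of_all _ fun ω => ?_)
      simp only [hH, IsRegular.residualPath, residual]
      congr 1
      ext t
      simp_rw [mul_comm (X _ ω)]
      ring
    rw [h1, hint]
    simp_rw [hinner]
    rw [integral_const_mul]

end ChangeOfVariables

/-! ### Measures with finite support -/

section FiniteSupport

variable {ν : Measure ℝ} {T : Finset ℝ}

lemma integral_eq_sum_of_support_subset {E : Type*} [NormedAddCommGroup E] [NormedSpace ℝ E]
    [CompleteSpace E] [IsFiniteMeasure ν] (hT : ν.support ⊆ T) (f : ℝ → E) :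
    ∫ t, f t ∂ν = ∑ t ∈ T, ν.real {t} • f t := by
  have h1 : ∀ᵐ t ∂ν, t ∈ (T : Set ℝ) := by
    filter_upwards [Measure.support_mem_ae (μ := ν)] with t ht using hT ht
  conv_lhs => rw [← Measure.restrict_eq_self_of_ae_mem h1]
  exact setIntegral_finset _ (IntegrableOn.of_finite T.finite_toSet)

lemma sum_real_singleton [IsProbabilityMeasure ν] (hT : ν.support ⊆ T) :
    ∑ t ∈ T, ν.real {t} = 1 := by
  have := integral_eq_sum_of_support_subset hT fun _ => (1 : ℝ)
  simpa using this.symm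

lemma real_singleton_pos [IsFiniteMeasure ν] (hT : ν.support = T) {t : ℝ} (ht : t ∈ T) :
    0 < ν.real {t} := by
  have hO : ((T.erase t : Finset ℝ) : Set ℝ)ᶜ ∈ 𝓝 t :=
    (T.erase t).finite_toSet.isClosed.isOpen_compl.mem_nhds (by simp)
  have h1 := (Measure.mem_support_iff_forall t).mp (by rw [hT]; exact ht) _ hO
  have h2 : ν ((T.erase t : Finset ℝ) : Set ℝ)ᶜ ≤ ν {t} := by
    refine measure_mono_ae ?_
    filter_upwards [Measure.support_mem_ae (μ := ν)] with s hs hs'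
    rw [hT] at hs
    by_contra hne
    exact hs' (Finset.mem_coe.mpr (Finset.mem_erase.mpr ⟨hne, hs⟩))
  exact ENNReal.toReal_pos (h1.trans_le h2).ne' (measure_ne_top _ _)

lemma ext_of_real_singleton {ν' : Measure ℝ} [IsFiniteMeasure ν] [IsFiniteMeasure ν']
    (hT : ν.support ⊆ T) (hT' : ν'.support ⊆ T) (h : ∀ t ∈ T, ν'.real {t} = ν.real {t}) :
    ν' = ν := by
  refine ext_of_forall_integral_eq_of_IsFiniteMeasure fun f => ?_
  rw [integral_eq_sum_of_support_subset hT, integral_eq_sum_of_support_subset hT']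
  exact Finset.sum_congr rfl fun t ht => by rw [h t ht]

end FiniteSupport

/-! ### A finitely supported minimizer and its contact set -/

section Minimizer

variable {Ω : Type*} [MeasurableSpace Ω] {P : Measure Ω} [IsProbabilityMeasure P]
  {X : ℝ → Ω → ℝ} {F T : Finset ℝ} {a b : ℝ} {ν : Measure ℝ}

omit [IsProbabilityMeasure P] in
lemma IsRegular.eq_zero_of_sum_curve (h : IsRegular P X a b) {c : ℝ → ℝ}
    (hc : ∑ t ∈ T, c t • h.gaussian.curve t = 0) {t : ℝ} (ht : t ∈ T) : c t = 0 := by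
  refine (h.indep T c 0 ?_ t ht).1
  have h1 : ∀ t, (h.gaussian.curve t : Ω → ℝ) =ᵐ[P] X t := fun t => (h.gaussian.memLp t).coeFn_toLp
  have h2 : (∑ t ∈ T, c t • h.gaussian.curve t : Lp ℝ 2 P) =ᵐ[P] fun ω => ∑ t ∈ T, c t * X t ω := by
    have : ∀ t ∈ T, ∀ᵐ ω ∂P, (c t • h.gaussian.curve t : Lp ℝ 2 P) ω = c t * X t ω := fun t _ => by
      filter_upwards [Lp.coeFn_smul (c t) (h.gaussian.curve t), h1 t] with ω e1 e2
      rw [e1, Pi.smul_apply, e2, smul_eq_mul]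
    filter_upwards [(T.eventually_all).mpr this, Lp.coeFn_fun_finsetSum T fun t => c t • h.gaussian.curve t]
      with ω hω e
    rw [e]
    exact Finset.sum_congr rfl hω
  rw [hc] at h2
  filter_upwards [h2, Lp.coeFn_zero ℝ 2 P] with ω e1 e2
  rw [e2] at e1
  simpa using e1.symm

omit [IsProbabilityMeasure P] in
lemma IsCenteredContinuousGaussian.barycenter_eq_sum (hX : IsCenteredContinuousGaussian P X)
    [IsFiniteMeasure ν] (hT : ν.support ⊆ T) :
    ∫ t, hX.curve t ∂ν = ∑ t ∈ T, ν.real {t} • hX.curve t :=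
  integral_eq_sum_of_support_subset hT _

omit [IsProbabilityMeasure P] in
lemma IsCenteredContinuousGaussian.inner_barycenter (hX : IsCenteredContinuousGaussian P X)
    [IsFiniteMeasure ν] (hT : ν.support ⊆ T) (s : ℝ) :
    inner ℝ (hX.curve s) (∫ t, hX.curve t ∂ν) = ∑ t ∈ T, ν.real {t} * covFun P X s t := by
  rw [hX.barycenter_eq_sum hT, inner_sum]
  exact Finset.sum_congr rfl fun t _ => by rw [inner_smul_right, hX.covFun_eq_inner]

variable (h : IsRegular P X a b) (hν : IsMinimizer (covFun P X) a b ν) (hF : ν.support = F)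
include h hν hF

omit [IsProbabilityMeasure P] in
lemma IsRegular.barycenter_norm_pos : 0 < ‖∫ t, h.gaussian.curve t ∂ν‖ ^ 2 := by
  have := hν.1.1
  refine sq_pos_of_pos (norm_pos_iff.mpr fun h0 => ?_)
  rw [h.gaussian.barycenter_eq_sum hF.le] at h0
  have h1 := sum_real_singleton (ν := ν) hF.le
  rw [Finset.sum_eq_zero fun t ht => h.eq_zero_of_sum_curve h0 ht] at h1
  exact zero_ne_one h1

/-- Equality in the first order condition says that the Gram matrix maps the weights of `ν` to a
constant vector; inverting it identifies the rates with these weights. -/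
lemma IsRegular.minRate_eq (i : F) :
    minRate P X F i = ν.real {(i : ℝ)} / ‖∫ t, h.gaussian.curve t ∂ν‖ ^ 2 := by
  have := hν.1.1
  set σ := ‖∫ t, h.gaussian.curve t ∂ν‖ ^ 2 with hσ
  have hpos : 0 < σ := h.barycenter_norm_pos hν hF
  have h1 : (gramMatrix P X F).mulVec (fun i : F => ν.real {(i : ℝ)} / σ) = 1 := by
    ext i
    have e := hν.eq_on_support h.gaussian.continuous_curve h.gaussian.covFun_eq_inner
      (s := i) (by rw [hF]; exact i.2)
    rw [h.gaussian.inner_barycenter hF.le, ← Finset.sum_coe_sort F] at e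
    simp only [Matrix.mulVec, dotProduct, gramMatrix, Matrix.of_apply, Pi.one_apply]
    rw [← hσ] at e
    rw [← div_self hpos.ne']
    conv_rhs => enter [1]; rw [← e]
    rw [Finset.sum_div]
    exact Finset.sum_congr rfl fun j _ => by ring
  unfold minRate
  rw [← h1, Matrix.mulVec_mulVec, Matrix.nonsing_inv_mul _ h.isUnit_det, Matrix.one_mulVec]

/-- By symmetry of `G⁻¹`, summing the regression coefficients applies `G⁻¹ 1` to the covariances.
This links the regression to the variational problem. -/
lemma IsRegular.regExcess_eq (t : ℝ) : regExcess P X F t =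
    (∑ s ∈ F, ν.real {s} * covFun P X t s) / ‖∫ t, h.gaussian.curve t ∂ν‖ ^ 2 - 1 := by
  have h1 : (gramMatrix P X F)⁻¹.transpose = (gramMatrix P X F)⁻¹ := by
    simpa [Matrix.IsHermitian] using (h.posDef (F := F)).inv.isHermitian
  have h2 : ∀ i, minRate P X F i = ∑ j, (gramMatrix P X F)⁻¹ j i := fun i => by
    simp only [minRate, Matrix.mulVec, dotProduct, Pi.one_apply, mul_one]
    refine Finset.sum_congr rfl fun j _ => ?_
    conv_lhs => rw [← h1, Matrix.transpose_apply]
  rw [regExcess]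
  congr 1
  simp_rw [regCoeff_eq_sum]
  rw [Finset.sum_comm]
  simp_rw [← Finset.sum_mul, ← h2, h.minRate_eq hν hF]
  rw [← Finset.sum_coe_sort F, Finset.sum_div]
  exact Finset.sum_congr rfl fun j _ => by ring

omit h [IsProbabilityMeasure P] in
lemma IsMinimizer.mem_Icc : ∀ i ∈ F, i ∈ Set.Icc a b := fun i hi =>
  Measure.support_subset_of_isClosed isClosed_Icc hν.1.ae_mem (by rw [hF]; exact hi)

lemma IsRegular.regExcess_nonneg {t : ℝ} (ht : t ∈ Set.Icc a b) : 0 ≤ regExcess P X F t := by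
  have := hν.1.1
  rw [h.regExcess_eq hν hF, ← h.gaussian.inner_barycenter hF.le, sub_nonneg,
    one_le_div (h.barycenter_norm_pos hν hF)]
  exact hν.norm_sq_le h.gaussian.continuous_curve h.gaussian.covFun_eq_inner ht

lemma IsRegular.regExcess_eq_zero_iff {t : ℝ} : regExcess P X F t = 0 ↔
    inner ℝ (h.gaussian.curve t) (∫ t, h.gaussian.curve t ∂ν) =
      ‖∫ t, h.gaussian.curve t ∂ν‖ ^ 2 := by
  have := hν.1.1
  rw [h.regExcess_eq hν hF, ← h.gaussian.inner_barycenter hF.le, sub_eq_zero,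
    div_eq_one_iff_eq (h.barycenter_norm_pos hν hF).ne']

omit hν hF in
omit [IsProbabilityMeasure P] in
lemma IsRegular.analyticOnNhd_regExcess : AnalyticOnNhd ℝ (regExcess P X F) Set.univ := by
  intro t _
  have h1 : ∀ i : F, AnalyticAt ℝ (fun t => regCoeff P X F t i) t := fun i =>
    h.analyticOnNhd_regCoeff i t trivial
  have := (Finset.univ.analyticAt_fun_sum fun i _ => h1 i).sub (analyticAt_const (v := (1 : ℝ)))
  exact this

/-- Infinitely many zeros in a compact interval accumulate, so the analytic excess would vanish on
the whole line, contrary to `nonconst`. -/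
lemma IsRegular.finite_zeros : {t | t ∈ Set.Icc a b ∧ regExcess P X F t = 0}.Finite := by
  have := hν.1.1
  by_contra hinf
  obtain ⟨z, -, hz⟩ := Set.Infinite.exists_accPt_of_subset_isCompact hinf isCompact_Icc
    fun t ht => ht.1
  have h1 : ∃ᶠ t in 𝓝[≠] z, regExcess P X F t = 0 :=
    (accPt_iff_frequently_nhdsNE.mp hz).mono fun t ht => ht.2
  have h2 := h.analyticOnNhd_regExcess.eqOn_of_preconnected_of_frequently_eq analyticOnNhd_const
    isPreconnected_univ (Set.mem_univ z) h1
  obtain ⟨s, hs⟩ := h.nonconst F (fun t => ν.real {t}) (hν.mem_Icc hF)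
    (fun t ht => real_singleton_pos hF ht) (sum_real_singleton hF.le) _
    (h.barycenter_norm_pos hν hF)
  rw [← h.gaussian.inner_barycenter hF.le] at hs
  exact hs ((h.regExcess_eq_zero_iff hν hF).mp (h2 (Set.mem_univ s)))

/-- Minimizers are unique if one of them is finitely supported. -/
theorem IsRegular.isMinimizer_unique {ν' : Measure ℝ} (hν' : IsMinimizer (covFun P X) a b ν') :
    ν' = ν := by
  have := hν.1.1
  have := hν'.1.1
  set T := (h.finite_zeros hν hF).toFinset
  -- With equal barycenters both minimizers live on the same finite contact set, where linear
  -- independence determines the weights.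
  have hb := hν.barycenter_eq h.gaussian.continuous_curve h.gaussian.covFun_eq_inner hν'
  have hT : ν.support ⊆ T := fun t ht => by
    have h1 := hν.eq_on_support h.gaussian.continuous_curve h.gaussian.covFun_eq_inner ht
    rw [← h.regExcess_eq_zero_iff hν hF] at h1
    simpa [T, h1] using hν.mem_Icc hF t (by rw [hF] at ht; exact ht)
  have hT' : ν'.support ⊆ T := fun t ht => by
    have h1 := hν'.eq_on_support h.gaussian.continuous_curve h.gaussian.covFun_eq_inner ht
    rw [hb, ← h.regExcess_eq_zero_iff hν hF] at h1
    simpa [T, h1] using Measure.support_subset_of_isClosed isClosed_Icc hν'.1.ae_mem ht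
  refine ext_of_real_singleton hT hT' fun t ht => ?_
  rw [h.gaussian.barycenter_eq_sum hT, h.gaussian.barycenter_eq_sum hT', ← sub_eq_zero,
    ← Finset.sum_sub_distrib] at hb
  simp_rw [← sub_smul] at hb
  exact sub_eq_zero.mp (h.eq_zero_of_sum_curve (c := fun t => ν'.real {t} - ν.real {t}) hb ht)

end Minimizer

/-! ### Averaging over the residual -/

section Limit

variable {Ω : Type*} [MeasurableSpace Ω] {P : Measure Ω} [IsProbabilityMeasure P]
  {X : ℝ → Ω → ℝ} {F : Finset ℝ} {a b : ℝ}

omit [IsProbabilityMeasure P] in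
lemma IsRegular.rescaledSetup (h : IsRegular P X a b) (hab : a < b) (hFI : ∀ i ∈ F, i ∈ Set.Icc a b)
    (hq0 : ∀ t ∈ Set.Icc a b, 0 ≤ regExcess P X F t) (hqF : ∀ i : F, regExcess P X F i = 0)
    (hrate : ∀ i, 0 < minRate P X F i) (ω : Ω) :
    RescaledSetup a b F (regExcess P X F) (fun t => residual P X F t ω) (regCoeff P X F)
      (minRate P X F) (gramForm P X F) where
  lt := hab
  mem_Icc := hFI
  continuous_q := h.analyticOnNhd_regExcess.continuous
  continuous_y := h.continuous_residual ω
  continuous_A := h.continuous_regCoeff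
  q_nonneg := hq0
  q_eq_zero := hqF
  y_eq_zero i := h.residual_apply_mem i ω
  A_apply i j := h.regCoeff_apply_mem i j
  rate_pos := hrate
  Q_nonneg := h.gramForm_nonneg
  measurable_Q := continuous_gramForm.measurable

/-- For almost every residual the inner limit is `J ω` times a sum free of `ω`; dominated
convergence gives `κ` as the mean of `J`. It is positive because all boundary variables are positive
together with positive probability. -/
theorem IsRegular.exists_tendsto_integral (h : IsRegular P X a b) (hab : a < b)
    (hF : F.Nonempty) (hFI : ∀ i ∈ F, i ∈ Set.Icc a b)
    (hq0 : ∀ t ∈ Set.Icc a b, 0 ≤ regExcess P X F t) (hqF : ∀ i : F, regExcess P X F i = 0)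
    (hrate : ∀ i, 0 < minRate P X F i)
    (hint : ∀ i ∈ F, i ∈ Set.Ioo a b → 0 < iteratedDeriv 2 (regExcess P X F) i)
    (hfin : {t | t ∈ Set.Icc a b ∧ regExcess P X F t = 0}.Finite)
    (hmeas : ∀ᶠ u in atTop, ∀ f : ℝ →ᵇ ℝ, AEStronglyMeasurable (fun ω => ∫ v : F → ℝ,
      innerIntegrand a b (regExcess P X F) (fun t => residual P X F t ω) (regCoeff P X F)
        (minRate P X F) (gramForm P X F) f u v) P) :
    ∃ κ > 0, ∀ f : ℝ →ᵇ ℝ, Tendsto (fun u => ∫ ω, (∫ v : F → ℝ,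
      innerIntegrand a b (regExcess P X F) (fun t => residual P X F t ω) (regCoeff P X F)
        (minRate P X F) (gramForm P X F) f u v) ∂P) atTop
      (𝓝 (κ * ∑ i : F, minRate P X F i * f i)) := by
  classical
  have hs := h.rescaledSetup hab hFI hq0 hqF hrate
  have hFn : Nonempty F := hF.to_subtype
  set I : (ℝ →ᵇ ℝ) → ℝ → Ω → ℝ := fun f u ω => ∫ v : F → ℝ,
      innerIntegrand a b (regExcess P X F) (fun t => residual P X F t ω) (regCoeff P X F)
        (minRate P X F) (gramForm P X F) f u v with hI
  set B := ∫ v, (orthant F).indicator (fun v => Real.exp (-∑ i, minRate P X F i * v i)) v with hB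
  have hbound : ∀ f u ω, |I f u ω| ≤ ‖f‖ * B := by
    intro f u ω
    rw [hB, ← integral_const_mul, ← Real.norm_eq_abs]
    exact norm_integral_le_of_norm_le ((integrable_indicator_orthant_exp hrate).const_mul _)
      (ae_of_all _ fun v => (hs ω).abs_innerIntegrand_le (fun t => f.norm_coe_le_norm t) u v)
  set Z := hfin.toFinset \ F with hZ
  have hmemZ : ∀ z, z ∈ Z ↔ (z ∈ Set.Icc a b ∧ regExcess P X F z = 0) ∧ z ∉ F := fun z => by
    simp [hZ]
  obtain ⟨hne, hposs⟩ := h.boundaryVariables_nondegenerate hab (F := F) (Z := Z)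
    fun z hz => ((hmemZ z).mp hz).2
  set Good : Ω → Prop := fun ω => (∀ k, boundaryVariables P X F Z a b k ω ≠ 0) ∧
    ∀ i : F, HasDerivAt (fun s => residual P X F s ω) (residualDeriv P X F i ω) i with hGood
  have hgood : ∀ᵐ ω ∂P, Good ω := by
    have h1 : ∀ᵐ ω ∂P, ∀ i : F,
        HasDerivAt (fun s => residual P X F s ω) (residualDeriv P X F i ω) i :=
      ae_all_iff.mpr fun i => h.hasDerivAt_residual (F := F) (i : ℝ)
    filter_upwards [hne, h1] with ω h1 h2 using ⟨h1, h2⟩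
  -- The implication from `Good ω` lets `J` be chosen for every `ω`; its measurability is recovered
  -- afterwards.
  have hex : ∀ ω, ∃ J : ℝ, Good ω → 0 ≤ J ∧
      ((∀ k, 0 < boundaryVariables P X F Z a b k ω) → 0 < J) ∧
      ∀ f : ℝ →ᵇ ℝ, Tendsto (fun u => I f u ω) atTop (𝓝 (J * ∑ i : F, minRate P X F i * f i)) := by
    intro ω
    by_cases hω : Good ω
    swap
    · exact ⟨0, fun h => absurd h hω⟩
    have hcost := fun i : F => exists_cost hab (hFI i i.2)
      (h.analyticOnNhd_regExcess (F := F)).contDiff hq0 (hqF i) ((hs ω).y_eq_zero i) (hω.2 i)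
      (hint i i.2) (by
        rintro (hi | hi)
        · have := hω.1 (Sum.inr true)
          simpa [boundaryVariables, hi] using this
        · have := hω.1 (Sum.inr false)
          simpa [boundaryVariables, hi] using this)
    obtain ⟨J, hJ0, hJpos, hJ⟩ := (hs ω).exists_tendsto_integral hFn
      (fun i => (hcost i).imp_right fun h => h.2)
      fun z hz hzF hz0 => hω.1 (Sum.inl ⟨z, (hmemZ z).mpr ⟨⟨hz, hz0⟩, hzF⟩⟩)
    refine ⟨J, fun _ => ⟨hJ0, fun hp => hJpos ⟨fun z hz hzF hz0 =>
      hp (Sum.inl ⟨z, (hmemZ z).mpr ⟨⟨hz, hz0⟩, hzF⟩⟩), fun i => ?_⟩, hJ⟩⟩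
    -- Unbounded cost needs the residual to decrease into the interval at an end point, which
    -- positive boundary variables exclude.
    rcases hcost i with h1 | ⟨⟨hi, h1⟩ | ⟨hi, h1⟩, -⟩
    · exact h1
    · have := hp (Sum.inr true)
      rw [hi] at h1
      exact absurd h1 (not_lt.mpr this.le)
    · have := hp (Sum.inr false)
      simp only [boundaryVariables] at this
      rw [hi] at h1
      linarith
  choose J hJ using hex
  set L := ∑ i : F, minRate P X F i with hL
  have hL0 : 0 < L := Finset.sum_pos (fun i _ => hrate i) Finset.univ_nonempty
  have hlim1 : ∀ᵐ ω ∂P, Tendsto (fun u => I 1 u ω) atTop (𝓝 (J ω * L)) := by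
    filter_upwards [hgood] with ω hω
    simpa only [BoundedContinuousFunction.coe_one, Pi.one_apply, mul_one] using (hJ ω hω).2.2 1
  -- With `f = 1`, `J` is up to the constant `L` a limit along a sequence of measurable inner
  -- integrals.
  have hJm : AEMeasurable J P := by
    obtain ⟨u₀, hu₀⟩ := eventually_atTop.mp hmeas
    have h1 : AEMeasurable (fun ω => J ω * L) P := by
      refine aemeasurable_of_tendsto_metrizable_ae (atTop : Filter ℕ)
        (f := fun (n : ℕ) ω => I 1 (u₀ + n) ω)
        (fun n => (hu₀ _ (by simp) 1).aemeasurable) ?_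
      filter_upwards [hlim1] with ω hω
      exact hω.comp (tendsto_atTop_add_const_left _ _ tendsto_natCast_atTop_atTop)
    have h2 := h1.mul_const L⁻¹
    simpa [mul_assoc, hL0.ne'] using h2
  have hJb : ∀ᵐ ω ∂P, ‖J ω‖ ≤ ‖(1 : ℝ →ᵇ ℝ)‖ * B / L := by
    filter_upwards [hgood, hlim1] with ω hω h1
    rw [Real.norm_eq_abs, abs_of_nonneg (hJ ω hω).1, le_div_iff₀ hL0]
    exact le_of_tendsto h1 (Eventually.of_forall fun u => (le_abs_self _).trans (hbound 1 u ω))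
  have hJi : Integrable J P := Integrable.of_bound hJm.aestronglyMeasurable _ hJb
  refine ⟨∫ ω, J ω ∂P, ?_, fun f => ?_⟩
  · have h0 : 0 ≤ᵐ[P] J := by
      filter_upwards [hgood] with ω hω using (hJ ω hω).1
    refine (integral_pos_iff_support_of_nonneg_ae h0 hJi).mpr ?_
    refine (pos_iff_ne_zero.mpr hposs).trans_le (measure_mono_ae ?_)
    filter_upwards [hgood] with ω hω hp
    exact ((hJ ω hω).2.1 hp).ne'
  · rw [← integral_mul_const]
    refine tendsto_integral_filter_of_dominated_convergence (fun _ => ‖f‖ * B)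
      (hmeas.mono fun u hu => hu f)
      (Eventually.of_forall fun u => ae_of_all _ fun ω => hbound f u ω) (integrable_const _) ?_
    filter_upwards [hgood] with ω hω using (hJ ω hω).2.2 f

end Limit

/-! ### Weak convergence for regular processes -/

section Conclusion

variable {Ω : Type*} [MeasurableSpace Ω] {P : Measure Ω} [IsProbabilityMeasure P]
  {X : ℝ → Ω → ℝ} {F : Finset ℝ} {a b : ℝ} {ν : Measure ℝ}

omit [IsProbabilityMeasure P] in
-- No finite set represents `S`, so the choice operator is applied to the empty predicate, whatever
-- the time.
lemma condMeanAtOne_of_infinite {S : Set ℝ} (hS : S.Infinite) :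
    condMeanAtOne P X S = fun _ => condMeanAtOne P X S 0 := by
  ext t
  unfold condMeanAtOne
  have h : ∀ t, (fun c : ℝ => ∃ F : Finset ℝ, (F : Set ℝ) = S ∧ IsCondMeanAtOne P X F t c) =
      fun _ => False := by
    intro t
    ext c
    refine iff_false_intro ?_
    rintro ⟨F, rfl, -⟩
    exact hS F.finite_toSet
  rw [h t, h 0]

omit [IsProbabilityMeasure P] in
-- An infinite support contains a point of `(a,b)`, where the conventional constant would need a
-- positive second derivative.
lemma finite_support_of_convex (hν : IsProbOn a b ν)
    (hconv : ∀ t ∈ ν.support ∩ Set.Ioo a b, 0 < iteratedDeriv 2 (condMeanAtOne P X ν.support) t) :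
    ν.support.Finite := by
  by_contra hinf
  have h1 : ν.support \ {a, b} ⊆ Set.Ioo a b := by
    intro t ht
    have h2 := Measure.support_subset_of_isClosed isClosed_Icc hν.ae_mem ht.1
    have h3 := ht.2
    simp only [Set.mem_insert_iff, Set.mem_singleton_iff, not_or] at h3
    exact ⟨lt_of_le_of_ne h2.1 (Ne.symm h3.1), lt_of_le_of_ne h2.2 h3.2⟩
  obtain ⟨t, ht⟩ := (Set.Infinite.sdiff hinf (Set.toFinite {a, b})).nonempty
  have h4 := hconv t ⟨ht.1, h1 ht⟩
  rw [condMeanAtOne_of_infinite hinf, iteratedDeriv_const] at h4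
  simp at h4

lemma IsRegular.iteratedDeriv_regExcess (h : IsRegular P X a b) (t : ℝ) :
    iteratedDeriv 2 (regExcess P X F) t = iteratedDeriv 2 (condMeanAtOne P X F) t := by
  have h1 : condMeanAtOne P X F = fun t => 1 + regExcess P X F t := by
    ext t
    rw [h.condMeanAtOne_eq, regExcess]
    ring
  rw [h1, iteratedDeriv_const_add (by norm_num)]

omit [IsProbabilityMeasure P] in
lemma integral_cond_highEvent (hX : IsCenteredContinuousGaussian P X) (hab : a ≤ b) (u : ℝ)
    (f : ℝ →ᵇ ℝ) :
    P.real (highEvent X a b u) = ∫ ω, exceedanceValue a b u (1 : ℝ →ᵇ ℝ) (fun t => X t ω) ∂P ∧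
    ∫ ω, f (argminLoc X a b ω) ∂(cond P (highEvent X a b u)) =
      (∫ ω, exceedanceValue a b u (1 : ℝ →ᵇ ℝ) (fun t => X t ω) ∂P)⁻¹ *
        ∫ ω, exceedanceValue a b u f (fun t => X t ω) ∂P := by
  have hB : MeasurableSet (highEvent X a b u) :=
    measurableSet_lt measurable_const (measurable_minOn hab hX.measurable hX.continuous)
  have h1 : ∀ f : ℝ →ᵇ ℝ, ∫ ω, exceedanceValue a b u f (fun t => X t ω) ∂P =
      ∫ ω in highEvent X a b u, f (argminLoc X a b ω) ∂P := fun f => by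
    rw [← integral_indicator hB]
    refine integral_congr_ae (ae_of_all _ fun ω => ?_)
    by_cases hω : ω ∈ highEvent X a b u
    · rw [Set.indicator_of_mem hω]
      exact if_pos hω
    · rw [Set.indicator_of_notMem hω]
      exact if_neg hω
  have h2 : P.real (highEvent X a b u) =
      ∫ ω, exceedanceValue a b u (1 : ℝ →ᵇ ℝ) (fun t => X t ω) ∂P := by
    rw [h1]
    simp
  refine ⟨h2, ?_⟩
  rw [h1 f, ← h2, ProbabilityTheory.cond, integral_smul_measure, ENNReal.toReal_inv, smul_eq_mul]
  rfl

/-- The location of a high minimum of a regular process. -/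
theorem IsRegular.tendsto_argminLoc (h : IsRegular P X a b) (hab : a < b)
    (hν : IsMinimizer (covFun P X) a b ν)
    (hconv : ∀ t ∈ ν.support ∩ Set.Ioo a b,
      0 < iteratedDeriv 2 (condMeanAtOne P X ν.support) t) :
    (∀ ν' : Measure ℝ, IsMinimizer (covFun P X) a b ν' → ν' = ν) ∧
      Measurable (argminLoc X a b) ∧
      (∀ᶠ u : ℝ in atTop, 0 < P (highEvent X a b u)) ∧
      ∀ f : ℝ →ᵇ ℝ, Tendsto (fun u : ℝ => ∫ ω, f (argminLoc X a b ω)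
        ∂(ProbabilityTheory.cond P (highEvent X a b u))) atTop (𝓝 (∫ t, f t ∂ν)) := by
  have := hν.1.1
  have hfinS := finite_support_of_convex hν.1 hconv
  obtain ⟨F, hF⟩ : ∃ F : Finset ℝ, ν.support = F := ⟨hfinS.toFinset, by simp⟩
  have hp := fun t (ht : t ∈ F) => real_singleton_pos hF ht
  have hsum := sum_real_singleton (ν := ν) hF.le
  have hσ := h.barycenter_norm_pos hν hF
  have hFne : F.Nonempty := by
    rw [Finset.nonempty_iff_ne_empty]
    rintro rfl
    simp at hsum
  have hrate : ∀ i, 0 < minRate P X F i := fun i => by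
    rw [h.minRate_eq hν hF]
    exact div_pos (hp i i.2) hσ
  have hqF : ∀ i : F, regExcess P X F i = 0 := fun i =>
    (h.regExcess_eq_zero_iff hν hF).mpr (hν.eq_on_support h.gaussian.continuous_curve
      h.gaussian.covFun_eq_inner (by rw [hF]; exact i.2))
  have hint : ∀ i ∈ F, i ∈ Set.Ioo a b → 0 < iteratedDeriv 2 (regExcess P X F) i :=
    fun i hi hi' => by
      rw [h.iteratedDeriv_regExcess, ← hF]
      exact hconv i ⟨by rw [hF]; exact hi, hi'⟩
  obtain ⟨κ, hκ, hlim⟩ := h.exists_tendsto_integral hab hFne (hν.mem_Icc hF)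
    (fun t ht => h.regExcess_nonneg hν hF ht) hqF hrate hint (h.finite_zeros hν hF) (by
      filter_upwards [eventually_gt_atTop 0] with u hu f
      obtain ⟨K, -, hK⟩ := h.integral_exceedanceValue hab.le F hu
      exact (hK f).1)
  set E : (ℝ →ᵇ ℝ) → ℝ → ℝ := fun f u => ∫ ω, (∫ v : F → ℝ,
      innerIntegrand a b (regExcess P X F) (fun t => residual P X F t ω) (regCoeff P X F)
        (minRate P X F) (gramForm P X F) f u v) ∂P
  have hsumf : ∀ f : ℝ →ᵇ ℝ, ∑ i : F, minRate P X F i * f i =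
      (∫ t, f t ∂ν) / ‖∫ t, h.gaussian.curve t ∂ν‖ ^ 2 := fun f => by
    rw [integral_eq_sum_of_support_subset hF.le, ← Finset.sum_coe_sort F, Finset.sum_div]
    exact Finset.sum_congr rfl fun i _ => by rw [h.minRate_eq hν hF, smul_eq_mul]; ring
  simp_rw [hsumf] at hlim
  have hlim1 := hlim 1
  simp only [BoundedContinuousFunction.coe_one, Pi.one_apply, integral_const, probReal_univ,
    smul_eq_mul, mul_one] at hlim1
  have hpos : ∀ᶠ u in atTop, 0 < E 1 u := hlim1.eventually_const_lt (by positivity)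
  refine ⟨fun ν' hν' => h.isMinimizer_unique hν hF hν',
    measurable_leftArgmin hab.le h.gaussian.measurable h.gaussian.continuous, ?_, fun f => ?_⟩
  · filter_upwards [hpos, eventually_gt_atTop 0] with u h1 hu
    obtain ⟨K, hK0, hK⟩ := h.integral_exceedanceValue hab.le F hu
    have h2 := (integral_cond_highEvent h.gaussian hab.le u 1).1
    rw [(hK 1).2] at h2
    have h3 : 0 < P.real (highEvent X a b u) := h2 ▸ mul_pos hK0 h1
    exact (ENNReal.toReal_pos_iff.mp h3).1
  -- Both `κ` and `‖w‖²` cancel in the quotient of the limits for `f` and for `1`.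
  · have h1 := (hlim1.inv₀ (by positivity)).mul (hlim f)
    have h2 : (κ * (1 / ‖∫ t, h.gaussian.curve t ∂ν‖ ^ 2))⁻¹ *
        (κ * ((∫ t, f t ∂ν) / ‖∫ t, h.gaussian.curve t ∂ν‖ ^ 2)) = ∫ t, f t ∂ν := by
      generalize ‖∫ t, h.gaussian.curve t ∂ν‖ ^ 2 = σ at hσ
      field_simp
    rw [h2] at h1
    refine h1.congr' ?_
    filter_upwards [eventually_gt_atTop 0] with u hu
    obtain ⟨K, hK0, hK⟩ := h.integral_exceedanceValue hab.le F hu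
    rw [(integral_cond_highEvent h.gaussian hab.le u f).2, (hK 1).2, (hK f).2, mul_inv,
      mul_mul_mul_comm, inv_mul_cancel₀ hK0.ne', one_mul]
    rfl

end Conclusion

/-! ### Regularity under the general assumption -/

/-- An everywhere convergent power series is an entire function. -/
lemma analyticOnNhd_of_hasSum_pow {f : ℝ → ℝ} {c : ℕ → ℝ}
    (h : ∀ s, HasSum (fun n => c n * s ^ n) (f s)) : AnalyticOnNhd ℝ f Set.univ := by
  have hr : (FormalMultilinearSeries.ofScalars ℝ c).radius = ⊤ := by
    refine FormalMultilinearSeries.radius_eq_top_of_summable_norm _ fun r => ?_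
    refine (h r).summable.norm.congr fun n => ?_
    simp
  have hf : HasFPowerSeriesOnBall f (FormalMultilinearSeries.ofScalars ℝ c) 0 ⊤ :=
    { r_le := hr.ge
      r_pos := ENNReal.zero_lt_top
      hasSum := fun {y} _ => by
        simpa [FormalMultilinearSeries.ofScalars_apply_eq, mul_comm] using h y }
  simpa using hf.analyticOnNhd

lemma HasPowerExpansion.analyticOnNhd {R : ℝ → ℝ → ℝ} (h : HasPowerExpansion R) (t : ℝ) :
    AnalyticOnNhd ℝ (fun s => R s t) Set.univ := by
  obtain ⟨r, hr⟩ := h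
  have h1 : ∀ m, Summable fun n => r m n * t ^ n := fun m => by
    simpa using (hr 1 t).summable.prod_factor m
  -- Summing first over `n` leaves a power series in `s`; the rows are summable by the expansion at
  -- `(1, t)`.
  refine analyticOnNhd_of_hasSum_pow (c := fun m => ∑' n, r m n * t ^ n) fun s => ?_
  refine (hr s t).prod_fiberwise fun m => ?_
  have h2 : (fun n => r m n * s ^ m * t ^ n) = fun n => r m n * t ^ n * s ^ m := by
    ext n
    ring
  change HasSum (fun n => r m n * s ^ m * t ^ n) _
  rw [h2]
  exact (h1 m).hasSum.mul_right (s ^ m)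

lemma LimsupNonpos.eventually_lt {R : ℝ → ℝ → ℝ} {a b : ℝ} (h : LimsupNonpos R a b) {s : ℝ}
    (hs : s ∈ Set.Icc a b) {ε : ℝ} (hε : 0 < ε) : ∀ᶠ t in atTop, R s t < ε := by
  have h1 : limsup (fun t : ℝ => ((R s t : ℝ) : EReal)) atTop < ((ε : ℝ) : EReal) :=
    (h s hs).trans_lt (by exact_mod_cast hε)
  filter_upwards [eventually_lt_of_limsup_lt h1] with t ht
  exact_mod_cast ht

section

variable {Ω : Type*} [MeasurableSpace Ω] {P : Measure Ω} [IsProbabilityMeasure P]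
  {X : ℝ → Ω → ℝ} {a b : ℝ}

omit [IsProbabilityMeasure P] in
lemma SmoothNondegenerate.differentiableAt (h : SmoothNondegenerate P X) (t : ℝ) :
    ∀ᵐ ω ∂P, DifferentiableAt ℝ (fun s => X s ω) t := by
  filter_upwards [h.1] with ω hω
  exact hω.differentiable (by simp) t

lemma SmoothNondegenerate.indep (h : SmoothNondegenerate P X)
    (hX : IsCenteredContinuousGaussian P X) (T : Finset ℝ) (c d : ℝ → ℝ)
    (hcd : ∀ᵐ ω ∂P, ∑ t ∈ T, (c t * X t ω + d t * deriv (fun s => X s ω) t) = 0) :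
    ∀ t ∈ T, c t = 0 ∧ d t = 0 := by
  classical
  obtain ⟨hW, -⟩ := hX.with_deriv h.differentiableAt
  set e : ℝ × ℕ → ℝ := fun k => if k.2 = 0 then c k.1 else d k.1 with he
  set T' : Finset (ℝ × ℕ) := T ×ˢ {0, 1} with hT'
  have hL : ∀ k ∈ T', MemLp (pathDeriv X k.2 k.1) 2 P := by
    rintro ⟨t, n⟩ hk
    simp only [hT', Finset.mem_product, Finset.mem_insert, Finset.mem_singleton] at hk
    rcases hk.2 with rfl | rfl
    · have := (hW.hasGaussianLaw_eval (Sum.inl t)).memLp_two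
      convert this using 1
      ext ω
      simp [pathDeriv]
    · have := (hW.hasGaussianLaw_eval (Sum.inr t)).memLp_two
      convert this using 1
      ext ω
      simp [pathDeriv, iteratedDeriv_one]
  have hsum : ∀ᵐ ω ∂P, ∑ k : T', e k * pathDeriv X k.1.2 k.1.1 ω = 0 := by
    filter_upwards [hcd] with ω hω
    rw [Finset.sum_coe_sort T' fun k => e k * pathDeriv X k.2 k.1 ω, hT', Finset.sum_product, ← hω]
    refine Finset.sum_congr rfl fun t _ => ?_
    simp [he, pathDeriv, iteratedDeriv_one]
  -- An almost surely vanishing combination has zero covariance with every member, so its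
  -- coefficients lie in the kernel of the covariance matrix.
  have hM := Matrix.eq_zero_of_mulVec_eq_zero (h.2 T') (v := fun k : T' => e k) (by
    ext i
    simp only [Matrix.mulVec, dotProduct, Matrix.of_apply, Pi.zero_apply]
    have h1 := covariance_fun_sum_right (μ := P) (X := fun (k : T') ω => e k * pathDeriv X k.1.2 k.1.1 ω)
      (Y := pathDeriv X i.1.2 i.1.1) (fun k => (hL k k.2).const_mul _) (hL i i.2)
    have h2 : cov[pathDeriv X i.1.2 i.1.1, fun ω => ∑ k : T', e k * pathDeriv X k.1.2 k.1.1 ω; P]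
        = 0 := by
      have h3 : ∫ ω, ∑ k : T', e k * pathDeriv X k.1.2 k.1.1 ω ∂P = 0 :=
        integral_eq_zero_of_ae hsum
      rw [covariance, h3]
      refine integral_eq_zero_of_ae ?_
      filter_upwards [hsum] with ω hω
      rw [hω]
      simp
    rw [h2] at h1
    rw [h1]
    refine Finset.sum_congr rfl fun k _ => ?_
    rw [covariance_const_mul_right, mul_comm])
  intro t ht
  have h0 := congrFun hM ⟨(t, 0), by simp [hT', ht]⟩
  have h1 := congrFun hM ⟨(t, 1), by simp [hT', ht]⟩
  simpa [he] using And.intro h0 h1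

omit [IsProbabilityMeasure P] in
-- For large `s` every covariance `R(s,t)` with `t ∈ T` is below `c > 0`, hence so is their convex
-- combination.
lemma LimsupNonpos.exists_sum_ne {a b : ℝ} (h : LimsupNonpos (covFun P X) a b)
    (T : Finset ℝ) (p : ℝ → ℝ) (hT : ∀ t ∈ T, t ∈ Set.Icc a b) (hp : ∀ t ∈ T, 0 < p t)
    (hsum : ∑ t ∈ T, p t = 1) (c : ℝ) (hc : 0 < c) :
    ∃ s, ∑ t ∈ T, p t * covFun P X s t ≠ c := by
  have h1 : ∀ᶠ s in atTop, ∀ t ∈ T, covFun P X t s < c :=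
    T.eventually_all.mpr fun t ht => h.eventually_lt (hT t ht) hc
  obtain ⟨s, hs⟩ := h1.exists
  refine ⟨s, ne_of_lt ?_⟩
  have hne : T.Nonempty := by
    rw [Finset.nonempty_iff_ne_empty]
    rintro rfl
    simp at hsum
  calc ∑ t ∈ T, p t * covFun P X s t < ∑ t ∈ T, p t * c :=
        Finset.sum_lt_sum_of_nonempty hne fun t ht => by
          rw [covFun_comm]
          exact mul_lt_mul_of_pos_left (hs t ht) (hp t ht)
    _ = c := by rw [← Finset.sum_mul, hsum, one_mul]

/-- The general assumption implies regularity. -/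
theorem AssumptionA.isRegular (hX : IsCenteredContinuousGaussian P X)
    (h : AssumptionA P X a b) : IsRegular P X a b where
  gaussian := hX
  analytic := h.power.analyticOnNhd
  differentiable := h.smooth_nondegenerate.differentiableAt
  indep := h.smooth_nondegenerate.indep hX
  nonconst := h.limsup_nonpos.exists_sum_ne

end

/-! ### Families with equal Gram matrices -/

section Isometry

variable {E H ι : Type*} [NormedAddCommGroup E] [InnerProductSpace ℝ E]
  [NormedAddCommGroup H] [InnerProductSpace ℝ H] {u : ι → E} {v : ι → H}

lemma norm_sum_smul_eq (h : ∀ i j, inner ℝ (u i) (u j) = inner ℝ (v i) (v j)) {κ : Type*}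
    (T : Finset κ) (τ : κ → ι) (c : κ → ℝ) :
    ‖∑ i ∈ T, c i • u (τ i)‖ = ‖∑ i ∈ T, c i • v (τ i)‖ := by
  rw [← sq_eq_sq₀ (norm_nonneg _) (norm_nonneg _), ← real_inner_self_eq_norm_sq,
    ← real_inner_self_eq_norm_sq]
  simp only [sum_inner, inner_sum, real_inner_smul_left, real_inner_smul_right, h]

/-- Families with the same Gram matrix are related by a continuous linear map. -/
theorem exists_clm_of_inner_eq [CompleteSpace E] [CompleteSpace H]
    (h : ∀ i j, inner ℝ (u i) (u j) = inner ℝ (v i) (v j)) :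
    ∃ A : E →L[ℝ] H, ∀ i, A (u i) = v i := by
  set Lu := Finsupp.linearCombination ℝ u
  set Lv := Finsupp.linearCombination ℝ v
  have hn : ∀ c, ‖Lv c‖ ≤ 1 * ‖Lu c‖ := fun c => by
    simp only [Lu, Lv, Finsupp.linearCombination_apply, Finsupp.sum, one_mul]
    exact (norm_sum_smul_eq h c.support id c).ge
  set K := (LinearMap.range Lu).topologicalClosure
  have hK : ∀ c, Lu c ∈ K := fun c => subset_closure ⟨c, rfl⟩
  set e : (ι →₀ ℝ) →ₗ[ℝ] K := Lu.codRestrict K hK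
  have hdense : DenseRange e := by
    refine (Subtype.dense_iff (s := (K : Set E))).mpr (subset_of_eq ?_)
    change closure _ = closure _
    congr 1
    ext y
    simp only [Set.mem_image, Set.mem_range, SetLike.mem_coe]
    constructor
    · rintro ⟨c, rfl⟩
      exact ⟨e c, ⟨c, rfl⟩, rfl⟩
    · rintro ⟨_, ⟨c, rfl⟩, rfl⟩
      exact ⟨c, rfl⟩
  have : CompleteSpace K := (Submodule.isClosed_topologicalClosure _).completeSpace_coe
  -- The map is extended from the span of `u` to its closure and then by zero on the orthogonal
  -- complement.
  refine ⟨(Lv.extendOfNorm e).comp K.orthogonalProjectionOnto, fun i => ?_⟩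
  have h1 : u i = ((e (Finsupp.single i 1) : K) : E) := by simp [e, Lu]
  rw [ContinuousLinearMap.comp_apply, h1, Submodule.orthogonalProjectionOnto_mem_subspace_eq_self,
    LinearMap.extendOfNorm_eq hdense ⟨1, hn⟩]
  simp [Lv]

end Isometry

/-! ### Waves in L² of the spectral measure -/

section Spectral

variable {R : ℝ → ℝ → ℝ} {F : Measure ℝ}

/-- The wave of frequency `x` at time `t`. -/
noncomputable def wave (t x : ℝ) : ℂ := Complex.exp (Complex.I * ((t * x : ℝ) : ℂ))

lemma norm_wave (t x : ℝ) : ‖wave t x‖ = 1 := by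
  rw [wave, mul_comm, Complex.norm_exp_ofReal_mul_I]

lemma continuous_wave (t : ℝ) : Continuous (wave t) := by
  unfold wave
  fun_prop

lemma wave_mul_conj (s t x : ℝ) : wave t x * (starRingEnd ℂ) (wave s x) = wave (t - s) x := by
  simp only [wave, ← Complex.exp_conj, ← Complex.exp_add, map_mul, Complex.conj_I,
    Complex.conj_ofReal]
  congr 1
  push_cast
  ring

lemma memLp_wave [IsFiniteMeasure F] (t : ℝ) : MemLp (wave t) 2 F :=
  MemLp.of_bound (continuous_wave t).aestronglyMeasurable 1
    (ae_of_all _ fun x => (norm_wave t x).le)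

/-- The waves as a curve in `L²`. -/
noncomputable def waveCurve (F : Measure ℝ) [IsFiniteMeasure F] (t : ℝ) : Lp ℂ 2 F :=
  (memLp_wave t).toLp (wave t)

lemma IsSpectralMeasure.inner_waveCurve (h : IsSpectralMeasure R F) [IsFiniteMeasure F] (s t : ℝ) :
    inner ℝ (waveCurve F s) (waveCurve F t) = R s t := by
  rw [L2.inner_def]
  have h1 : ∫ x, inner ℝ (waveCurve F s x) (waveCurve F t x) ∂F =
      ∫ x, RCLike.re (wave (t - s) x) ∂F := by
    refine integral_congr_ae ?_
    filter_upwards [(memLp_wave (F := F) s).coeFn_toLp, (memLp_wave (F := F) t).coeFn_toLp]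
      with x h1 h2
    rw [waveCurve, waveCurve, h1, h2, Complex.inner, wave_mul_conj]
    rfl
  have hi : Integrable (wave (t - s)) F := (memLp_wave (F := F) _).integrable (by norm_num)
  rw [h1, integral_re hi]
  have h2 := h.repr s t
  change _ = ∫ x, wave (t - s) x ∂F at h2
  rw [← h2]
  simp

lemma norm_toLp_sq_complex {f : ℝ → ℂ} (hf : MemLp f 2 F) :
    ‖hf.toLp f‖ ^ 2 = ∫ x, ‖f x‖ ^ 2 ∂F := by
  rw [← real_inner_self_eq_norm_sq (F := Lp ℂ 2 F), L2.inner_def]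
  refine integral_congr_ae ?_
  filter_upwards [hf.coeFn_toLp] with x h1
  rw [h1, real_inner_self_eq_norm_sq]

lemma memLp_exp_abs (hexp : ∀ t : ℝ, Integrable (fun x => Real.exp (t * x)) F) (c : ℝ) :
    MemLp (fun x : ℝ => Real.exp (c * |x|)) 2 F := by
  rw [memLp_two_iff_integrable_sq (by fun_prop)]
  refine ((hexp (2 * c)).add (hexp (-(2 * c)))).mono' (by fun_prop) (ae_of_all _ fun x => ?_)
  rw [Real.norm_of_nonneg (by positivity), ← Real.exp_nat_mul, Pi.add_apply]
  rcases abs_cases x with ⟨h, -⟩ | ⟨h, -⟩ <;> rw [h]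
  · have := Real.exp_pos (-(2 * c) * x)
    have e : ((2 : ℕ) : ℝ) * (c * x) = 2 * c * x := by push_cast; ring
    rw [e]
    linarith
  · have := Real.exp_pos (2 * c * x)
    have e : ((2 : ℕ) : ℝ) * (c * -x) = -(2 * c) * x := by push_cast; ring
    rw [e]
    linarith

/-- The Taylor coefficients of `t ↦ exp (i t x)`. -/
noncomputable def waveCoeff (n : ℕ) (x : ℝ) : ℂ := (Complex.I * x) ^ n / n.factorial

/-- One term of the exponential series of `c |x|` is at most the whole sum. The free parameter `c`
buys geometric decay in `n`, and the exponential factor is square integrable. -/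
lemma norm_waveCoeff_le (n : ℕ) {c : ℝ} (hc : 0 < c) (x : ℝ) :
    ‖waveCoeff n x‖ ≤ c⁻¹ ^ n * Real.exp (c * |x|) := by
  have h1 := Real.pow_div_factorial_le_exp (c * |x|) (by positivity) n
  have h2 : ‖waveCoeff n x‖ = c⁻¹ ^ n * ((c * |x|) ^ n / n.factorial) := by
    simp only [waveCoeff, norm_div, norm_pow, norm_mul, Complex.norm_I, one_mul, Complex.norm_real,
      Real.norm_eq_abs, Complex.norm_natCast]
    rw [← mul_div_assoc, ← mul_pow, inv_mul_cancel_left₀ hc.ne']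
  rw [h2]
  gcongr

lemma continuous_waveCoeff (n : ℕ) : Continuous (waveCoeff n) := by
  unfold waveCoeff
  fun_prop

lemma memLp_waveCoeff (hexp : ∀ t : ℝ, Integrable (fun x => Real.exp (t * x)) F) (n : ℕ) :
    MemLp (waveCoeff n) 2 F := by
  refine (memLp_exp_abs hexp 1).of_le (continuous_waveCoeff n).aestronglyMeasurable
    (ae_of_all _ fun x => ?_)
  simpa using norm_waveCoeff_le n one_pos x

lemma summable_norm_waveCoeff (hexp : ∀ t : ℝ, Integrable (fun x => Real.exp (t * x)) F) (t : ℝ) :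
    Summable fun n => ‖t ^ n • (memLp_waveCoeff hexp n).toLp (waveCoeff n)‖ := by
  -- Any `c > |t|` gives a convergent geometric series of ratio `|t| / c`.
  set c := |t| + 1 with hc
  have hc0 : 0 < c := by positivity
  set K := ‖(memLp_exp_abs hexp c).toLp _‖
  have h1 : ∀ n, ‖(memLp_waveCoeff hexp n).toLp (waveCoeff n)‖ ≤ c⁻¹ ^ n * K := fun n => by
    refine Lp.norm_le_mul_norm_of_ae_le_mul ?_
    filter_upwards [(memLp_waveCoeff hexp n).coeFn_toLp, (memLp_exp_abs hexp c).coeFn_toLp]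
      with x e1 e2
    rw [e1, e2, Real.norm_of_nonneg (by positivity)]
    exact norm_waveCoeff_le n hc0 x
  refine Summable.of_nonneg_of_le (fun n => norm_nonneg _) (fun n => ?_)
    ((summable_geometric_of_lt_one (r := |t| / c) (by positivity) (by
      rw [div_lt_one hc0, hc]
      linarith)).mul_right K)
  rw [norm_smul, norm_pow, Real.norm_eq_abs, div_eq_mul_inv, mul_pow, mul_assoc]
  exact mul_le_mul_of_nonneg_left (h1 n) (by positivity)

/-- The Taylor expansion of the waves in `L²`. -/
theorem waveCurve_eq_tsum [IsFiniteMeasure F]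
    (hexp : ∀ t : ℝ, Integrable (fun x => Real.exp (t * x)) F) (t : ℝ) :
    waveCurve F t = ∑' n, t ^ n • (memLp_waveCoeff hexp n).toLp (waveCoeff n) := by
  have h1 := Lp.hasSum_coeFn_tsum
    (tsum_enorm_ne_top_iff_summable_norm.mpr (summable_norm_waveCoeff hexp t))
  refine Lp.ext ?_
  have h2 : ∀ᵐ x ∂F, ∀ n, (t ^ n • (memLp_waveCoeff hexp n).toLp (waveCoeff n) : Lp ℂ 2 F) x =
      t ^ n • waveCoeff n x := ae_all_iff.mpr fun n => by
    filter_upwards [(memLp_waveCoeff hexp n).coeFn_toLp,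
      Lp.coeFn_smul (t ^ n) ((memLp_waveCoeff hexp n).toLp (waveCoeff n))] with x e1 e2
    rw [e2, Pi.smul_apply, e1]
  filter_upwards [h1, h2, (memLp_wave (F := F) t).coeFn_toLp] with x e1 e2 e3
  rw [waveCurve, e3]
  simp_rw [e2] at e1
  refine HasSum.unique ?_ e1
  have h3 := NormedSpace.expSeries_div_hasSum_exp (Complex.I * ((t * x : ℝ) : ℂ))
  rw [← Complex.exp_eq_exp_ℂ] at h3
  have h4 : (fun n => t ^ n • waveCoeff n x) =
      fun n => (Complex.I * ((t * x : ℝ) : ℂ)) ^ n / n.factorial := by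
    ext n
    rw [waveCoeff, Complex.real_smul, Complex.ofReal_pow, ← mul_div_assoc, ← mul_pow]
    push_cast
    ring
  rw [h4]
  exact h3

end Spectral

/-! ### Analyticity from rational points and independence of waves -/

section Deterministic

/-- A continuous function with a power expansion at all rational points is analytic. -/
lemma analyticOnNhd_of_hasSum_rat {x : ℝ → ℝ} (hx : Continuous x) {c : ℕ → ℝ}
    (h : ∀ q : ℚ, HasSum (fun n => c n * (q : ℝ) ^ n) (x q)) : AnalyticOnNhd ℝ x Set.univ := by
  have hs : ∀ s : ℝ, Summable fun n => c n * s ^ n := fun s => by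
    obtain ⟨q, hq⟩ := exists_rat_gt |s|
    refine (h q).summable.norm.of_norm_bounded fun n => ?_
    rw [norm_mul, norm_mul, norm_pow, norm_pow, Real.norm_eq_abs s]
    gcongr
    exact hq.le.trans (le_abs_self _)
  have hy := analyticOnNhd_of_hasSum_pow fun s => (hs s).hasSum
  have : x = fun s => ∑' n, c n * s ^ n := by
    refine Continuous.ext_on Rat.denseRange_cast hx hy.continuous ?_
    rintro _ ⟨q, rfl⟩
    exact (h q).tsum_eq.symm
  rwa [this]

lemma tendsto_affine_mul_exp_neg (c d : ℝ) {k : ℝ} (hk : 0 < k) :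
    Tendsto (fun y => (c + y * d) * Real.exp (-(k * y))) atTop (𝓝 0) := by
  have h0 : Tendsto (fun y : ℝ => k * y) atTop atTop := tendsto_id.const_mul_atTop hk
  have h1 := (Real.tendsto_pow_mul_exp_neg_atTop_nhds_zero 0).comp h0
  have h2 := (Real.tendsto_pow_mul_exp_neg_atTop_nhds_zero 1).comp h0
  have h3 := (h1.const_mul c).add (h2.const_mul (d / k))
  simp only [mul_zero, add_zero] at h3
  refine h3.congr fun y => ?_
  simp only [Function.comp_apply, pow_zero, pow_one, one_mul]
  field_simp

/-- Exponentials with affine coefficients are linearly independent. -/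
lemma eq_zero_of_sum_affine_mul_exp (T : Finset ℝ) (c d : ℝ → ℝ)
    (h : ∀ y : ℝ, ∑ t ∈ T, (c t + y * d t) * Real.exp (t * y) = 0) :
    ∀ t ∈ T, c t = 0 ∧ d t = 0 := by
  induction T using Finset.induction_on_max with
  | empty => simp
  | insert a s hs ih =>
    have ha : a ∉ s := fun h => lt_irrefl _ (hs a h)
    -- Divide by the exponential with the largest exponent; all other terms decay.
    have hlim : Tendsto (fun y => c a + y * d a) atTop (𝓝 0) := by
      have h1 : Tendsto (fun y => ∑ t ∈ s, (c t + y * d t) * Real.exp (-((a - t) * y))) atTop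
          (𝓝 (∑ t ∈ s, 0)) :=
        tendsto_finsetSum _ fun t ht => tendsto_affine_mul_exp_neg _ _ (sub_pos.mpr (hs t ht))
      rw [Finset.sum_const_zero] at h1
      have h2 := h1.neg
      rw [neg_zero] at h2
      refine h2.congr fun y => ?_
      have h3 := h y
      rw [Finset.sum_insert ha] at h3
      have h4 : ∑ t ∈ s, (c t + y * d t) * Real.exp (-((a - t) * y)) =
          Real.exp (-(a * y)) * ∑ t ∈ s, (c t + y * d t) * Real.exp (t * y) := by
        rw [Finset.mul_sum]
        refine Finset.sum_congr rfl fun t _ => ?_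
        rw [mul_left_comm, ← Real.exp_add]
        congr 2
        ring
      rw [h4, eq_neg_of_add_eq_zero_right h3, mul_neg, neg_neg, mul_left_comm, ← Real.exp_add]
      simp
    have hd : d a = 0 := by
      have h1 := (hlim.comp (tendsto_atTop_add_const_right atTop (1 : ℝ) tendsto_id)).sub hlim
      rw [sub_zero] at h1
      refine tendsto_nhds_unique (tendsto_const_nhds.congr fun y => ?_) h1
      simp only [Function.comp_apply, id_eq]
      ring
    have hc : c a = 0 := by
      simp only [hd, mul_zero, add_zero] at hlim
      exact tendsto_nhds_unique tendsto_const_nhds hlim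
    intro t ht
    rcases Finset.mem_insert.mp ht with rfl | ht
    · exact ⟨hc, hd⟩
    · refine ih (fun y => ?_) t ht
      have h3 := h y
      rwa [Finset.sum_insert ha, hc, hd, mul_zero, add_zero, zero_mul, zero_add] at h3

lemma hasDerivAt_wave (t x : ℝ) :
    HasDerivAt (fun s => wave s x) (Complex.I * x * wave t x) t := by
  have h1 : HasDerivAt (fun s : ℝ => Complex.I * ((s * x : ℝ) : ℂ)) (Complex.I * x) t := by
    have := ((hasDerivAt_id t).mul_const x).ofReal_comp.const_mul Complex.I
    simpa using this
  have h2 := h1.cexp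
  rwa [mul_comm] at h2

lemma tendsto_difference_quotient_wave (t x : ℝ) :
    Tendsto (fun n : ℕ => ((n : ℝ) + 1) • (wave (t + 1 / ((n : ℝ) + 1)) x - wave t x)) atTop
      (𝓝 (Complex.I * x * wave t x)) := by
  have h := (hasDerivAt_wave t x).tendsto_slope_zero_right
  have h1 : Tendsto (fun n : ℕ => 1 / ((n : ℝ) + 1)) atTop (𝓝[>] 0) :=
    tendsto_nhdsWithin_iff.mpr ⟨tendsto_one_div_add_atTop_nhds_zero_nat,
      Eventually.of_forall fun n => by simp only [Set.mem_Ioi]; positivity⟩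
  refine (h.comp h1).congr fun n => ?_
  simp

/-- Waves with affine coefficients are linearly independent over a set of frequencies with an
accumulation point. -/
lemma eq_zero_of_sum_wave_eq_zero {S : Set ℝ} {x₀ : ℝ} (hS : AccPt x₀ (𝓟 S)) (T : Finset ℝ)
    (c d : ℝ → ℝ)
    (h : ∀ x ∈ S, ∑ t ∈ T, (c t • wave t x + d t • (Complex.I * x * wave t x)) = 0) :
    ∀ t ∈ T, c t = 0 ∧ d t = 0 := by
  set φ : ℂ → ℂ := fun z => ∑ t ∈ T, ((c t : ℂ) + Complex.I * z * d t) *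
    Complex.exp (t * (Complex.I * z)) with hφ
  have hφr : ∀ x : ℝ, φ x = ∑ t ∈ T, (c t • wave t x + d t • (Complex.I * x * wave t x)) := by
    intro x
    refine Finset.sum_congr rfl fun t _ => ?_
    have e : (t : ℂ) * (Complex.I * x) = Complex.I * ((t * x : ℝ) : ℂ) := by push_cast; ring
    rw [e, wave, Complex.real_smul, Complex.real_smul]
    ring
  have han : AnalyticOnNhd ℂ φ Set.univ := fun z _ => by
    have : Differentiable ℂ φ := by
      simp only [hφ]
      fun_prop
    exact this.analyticAt z
  have hfreq : ∃ᶠ z in 𝓝[≠] (x₀ : ℂ), φ z = 0 := by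
    have h1 : Tendsto (fun x : ℝ => (x : ℂ)) (𝓝[≠] x₀) (𝓝[≠] (x₀ : ℂ)) :=
      tendsto_nhdsWithin_of_tendsto_nhds_of_eventually_within _
        (Complex.continuous_ofReal.continuousAt.mono_left nhdsWithin_le_nhds)
        (by filter_upwards [self_mem_nhdsWithin] with x hx; simpa using hx)
    refine h1.frequently ((accPt_iff_frequently_nhdsNE.mp hS).mono fun x hx => ?_)
    rw [hφr, h x hx]
  have h0 := han.eqOn_of_preconnected_of_frequently_eq analyticOnNhd_const isPreconnected_univ
    (Set.mem_univ _) hfreq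
  refine eq_zero_of_sum_affine_mul_exp T c d fun y => ?_
  -- On the imaginary axis the entire function becomes a sum of real exponentials with affine
  -- coefficients.
  have h2 := h0 (Set.mem_univ (-Complex.I * y))
  have h3 : Complex.I * (-Complex.I * y) = y := by
    rw [← mul_assoc, mul_neg, Complex.I_mul_I, neg_neg, one_mul]
  simp only [hφ, h3] at h2
  exact_mod_cast h2

end Deterministic

/-! ### Regularity under the stationary assumption -/

section

variable {Ω : Type*} [MeasurableSpace Ω] {P : Measure Ω} {X : ℝ → Ω → ℝ} {F : Measure ℝ}

lemma sum_smul_toLp {α κ E : Type*} [MeasurableSpace α] {μ : Measure α} [NormedAddCommGroup E]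
    [NormedSpace ℝ E] (T : Finset κ) (c : κ → ℝ) {f : κ → α → E} (hf : ∀ k, MemLp (f k) 2 μ) :
    ∑ k ∈ T, c k • (hf k).toLp (f k) =
      (memLp_finsetSum T fun k _ => (hf k).const_smul (c k)).toLp
        (fun ω => ∑ k ∈ T, (c k • f k) ω) := by
  refine Lp.ext ?_
  have h1 : ∀ k ∈ T, ∀ᵐ ω ∂μ, (c k • (hf k).toLp (f k) : Lp E 2 μ) ω = (c k • f k) ω :=
    fun k _ => by
      filter_upwards [Lp.coeFn_smul (c k) ((hf k).toLp (f k)), (hf k).coeFn_toLp] with ω e1 e2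
      rw [e1, Pi.smul_apply, Pi.smul_apply, e2]
  filter_upwards [Lp.coeFn_fun_finsetSum T fun k => c k • (hf k).toLp (f k),
    T.eventually_all.mpr h1,
    (memLp_finsetSum T fun k _ => (hf k).const_smul (c k)).coeFn_toLp] with ω e1 e2 e3
  rw [e1, e3]
  exact Finset.sum_congr rfl e2

variable (hX : IsCenteredContinuousGaussian P X) (hF : IsSpectralMeasure (covFun P X) F)
include hX hF

lemma IsSpectralMeasure.inner_eq [IsFiniteMeasure F] (s t : ℝ) :
    inner ℝ (waveCurve F s) (waveCurve F t) = inner ℝ (hX.curve s) (hX.curve t) := by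
  rw [hF.inner_waveCurve, hX.covFun_eq_inner]

/-- The spectral isometry. -/
lemma IsSpectralMeasure.integral_sq_sum [IsFiniteMeasure F] {κ : Type*} (T : Finset κ)
    (τ c : κ → ℝ) :
    ∫ ω, (∑ k ∈ T, c k * X (τ k) ω) ^ 2 ∂P = ∫ x, ‖∑ k ∈ T, c k • wave (τ k) x‖ ^ 2 ∂F := by
  have h1 := norm_sum_smul_eq (hF.inner_eq hX) T τ c
  have h2 := sum_smul_toLp T c fun k => memLp_wave (F := F) (τ k)
  have h3 := sum_smul_toLp T c fun k => hX.memLp (τ k)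
  unfold waveCurve IsCenteredContinuousGaussian.curve at h1
  rw [h2, h3] at h1
  have h4 := congrArg (· ^ 2) h1
  simp only [norm_toLp_sq, norm_toLp_sq_complex] at h4
  exact h4.symm

omit hX in
-- The covariance is the complex moment generating function of the spectral measure at `i (t - s)`,
-- which is entire because all exponential moments exist.
lemma IsSpectralMeasure.analyticOnNhd
    (hexp : ∀ t : ℝ, Integrable (fun x => Real.exp (t * x)) F) (t : ℝ) :
    AnalyticOnNhd ℝ (fun s => covFun P X s t) Set.univ := by
  have h1 : (fun s => covFun P X s t) =
      fun s => Complex.reCLM (complexMGF id F (((t - s : ℝ) : ℂ) * Complex.I)) := by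
    ext s
    have h2 := hF.repr s t
    have h3 : complexMGF id F (((t - s : ℝ) : ℂ) * Complex.I) = (covFun P X s t : ℂ) := by
      rw [h2, complexMGF]
      refine integral_congr_ae (ae_of_all _ fun x => ?_)
      simp only [id_eq]
      congr 1
      push_cast
      ring
    rw [h3]
    simp
  rw [h1]
  intro s _
  have h2 : integrableExpSet id F = Set.univ := by
    ext u
    simpa [integrableExpSet] using hexp u
  have h3 : AnalyticAt ℝ (complexMGF id F) (((t - s : ℝ) : ℂ) * Complex.I) :=
    (analyticAt_complexMGF (by rw [h2, interior_univ]; trivial)).restrictScalars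
  have h4 : AnalyticAt ℝ (fun s : ℝ => ((t - s : ℝ) : ℂ) * Complex.I) s := by
    have h5 : AnalyticAt ℝ (fun s : ℝ => ((t - s : ℝ) : ℂ)) s :=
      (Complex.ofRealCLM.analyticAt _).comp (analyticAt_const.sub analyticAt_id)
    exact h5.mul analyticAt_const
  exact (Complex.reCLM.analyticAt _).comp (h3.comp (f := fun s : ℝ => ((t - s : ℝ) : ℂ) * Complex.I) h4)

/-- The paths of the process are almost surely analytic. -/
theorem IsSpectralMeasure.ae_analyticOnNhd
    (hexp : ∀ t : ℝ, Integrable (fun x => Real.exp (t * x)) F) :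
    ∀ᵐ ω ∂P, AnalyticOnNhd ℝ (fun t => X t ω) Set.univ := by
  have := hF.finite
  -- `A` carries the L² Taylor series of the waves to one for the process. Absolute convergence in
  -- L² gives pointwise convergence off a null set; countably many rational times need only one such
  -- set, and path continuity does the rest.
  obtain ⟨A, hA⟩ := exists_clm_of_inner_eq (hF.inner_eq hX)
  set g : ℕ → Lp ℂ 2 F := fun n => (memLp_waveCoeff hexp n).toLp (waveCoeff n)
  have hsum : ∀ t : ℝ, Summable fun n => ‖t ^ n • A (g n)‖ := fun t => by
    refine Summable.of_nonneg_of_le (fun n => norm_nonneg _) (fun n => ?_)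
      ((summable_norm_waveCoeff hexp t).mul_left ‖A‖)
    rw [← map_smul]
    exact A.le_opNorm _
  have hcurve : ∀ t : ℝ, hX.curve t = ∑' n, t ^ n • A (g n) := fun t => by
    rw [← hA, waveCurve_eq_tsum hexp, A.map_tsum (summable_norm_waveCoeff hexp t).of_norm]
    simp_rw [map_smul]
    rfl
  have hpt : ∀ q : ℚ, ∀ᵐ ω ∂P, HasSum (fun n => A (g n) ω * (q : ℝ) ^ n) (X q ω) := fun q => by
    have h1 := Lp.hasSum_coeFn_tsum (tsum_enorm_ne_top_iff_summable_norm.mpr (hsum q))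
    rw [← hcurve] at h1
    have h2 : ∀ᵐ ω ∂P, ∀ n, ((q : ℝ) ^ n • A (g n) : Lp ℝ 2 P) ω = A (g n) ω * (q : ℝ) ^ n :=
      ae_all_iff.mpr fun n => by
        filter_upwards [Lp.coeFn_smul ((q : ℝ) ^ n) (A (g n))] with ω e
        rw [e, Pi.smul_apply, smul_eq_mul, mul_comm]
    filter_upwards [h1, h2, (hX.memLp q).coeFn_toLp] with ω e1 e2 e3
    simp_rw [e2] at e1
    rw [← e3]
    exact e1
  filter_upwards [ae_all_iff.mpr hpt] with ω hω
  exact analyticOnNhd_of_hasSum_rat (hX.continuous ω) hω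

lemma IsSpectralMeasure.differentiableAt
    (hexp : ∀ t : ℝ, Integrable (fun x => Real.exp (t * x)) F) (t : ℝ) :
    ∀ᵐ ω ∂P, DifferentiableAt ℝ (fun s => X s ω) t := by
  filter_upwards [hF.ae_analyticOnNhd hX hexp] with ω hω
  exact (hω t trivial).differentiableAt

variable [IsProbabilityMeasure P]

/-- Replace derivatives by difference quotients. The combinations tend to zero almost surely, so
their Gaussian variances do too, and by the isometry so do the L² norms of the same combinations of
waves. Fatou's lemma kills the limiting wave combination on the support, and the accumulation point
kills its coefficients. -/
lemma IsSpectralMeasure.indep (hexp : ∀ t : ℝ, Integrable (fun x => Real.exp (t * x)) F)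
    {x₀ : ℝ} (hacc : AccPt x₀ (𝓟 F.support)) (T : Finset ℝ) (c d : ℝ → ℝ)
    (h : ∀ᵐ ω ∂P, ∑ t ∈ T, (c t * X t ω + d t * deriv (fun s => X s ω) t) = 0) :
    ∀ t ∈ T, c t = 0 ∧ d t = 0 := by
  have := hF.finite
  set τ : ℕ → ℝ ⊕ ℝ → ℝ := fun n => Sum.elim id fun t => t + 1 / ((n : ℝ) + 1) with hτ
  set e : ℕ → ℝ ⊕ ℝ → ℝ := fun n => Sum.elim (fun t => c t - d t * ((n : ℝ) + 1))
    fun t => d t * ((n : ℝ) + 1) with he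
  set T' : Finset (ℝ ⊕ ℝ) := T.disjSum T with hT'
  set D : ℕ → Ω → ℝ := fun n ω => ∑ k ∈ T', e n k * X (τ n k) ω with hD
  set φ : ℕ → ℝ → ℂ := fun n x => ∑ k ∈ T', e n k • wave (τ n k) x with hφ
  have hDlim : ∀ᵐ ω ∂P, Tendsto (fun n => D n ω) atTop (𝓝 0) := by
    have h1 : ∀ᵐ ω ∂P, ∀ t ∈ T, DifferentiableAt ℝ (fun s => X s ω) t :=
      T.eventually_all.mpr fun t _ => hF.differentiableAt hX hexp t
    filter_upwards [h, h1] with ω hω h1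
    rw [← hω]
    have h2 : ∀ n, D n ω = ∑ t ∈ T, (c t * X t ω + d t *
        (((n : ℝ) + 1) * (X (t + 1 / ((n : ℝ) + 1)) ω - X t ω))) := fun n => by
      simp only [hD, hT', Finset.sum_disjSum, he, hτ, Sum.elim_inl, Sum.elim_inr, id_eq]
      rw [← Finset.sum_add_distrib]
      exact Finset.sum_congr rfl fun t _ => by ring
    simp_rw [h2]
    exact tendsto_finsetSum _ fun t ht =>
      ((tendsto_difference_quotient (h1 t ht)).const_mul _).const_add _
  have hφlim : ∀ x, Tendsto (fun n => φ n x) atTop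
      (𝓝 (∑ t ∈ T, (c t • wave t x + d t • (Complex.I * x * wave t x)))) := fun x => by
    have h2 : ∀ n, φ n x = ∑ t ∈ T, (c t • wave t x + d t •
        (((n : ℝ) + 1) • (wave (t + 1 / ((n : ℝ) + 1)) x - wave t x))) := fun n => by
      simp only [hφ, hT', Finset.sum_disjSum, he, hτ, Sum.elim_inl, Sum.elim_inr, id_eq]
      rw [← Finset.sum_add_distrib]
      refine Finset.sum_congr rfl fun t _ => ?_
      rw [sub_smul, mul_smul, mul_smul, smul_sub, smul_sub]
      abel
    simp_rw [h2]
    exact tendsto_finsetSum _ fun t ht =>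
      ((tendsto_difference_quotient_wave t x).const_smul _).const_add _
  have hG : ∀ n, HasGaussianLaw (D n) P ∧ ∫ ω, D n ω ∂P = 0 := fun n => by
    have h1 : IsGaussianProcess (fun k => X (τ n k)) P :=
      isGaussianProcess_of_sum hX.gaussian fun k => ⟨{τ n k}, fun _ => 1, fun ω => by simp⟩
    have h2 : IsGaussianProcess (fun _ : Unit => D n) P :=
      isGaussianProcess_of_sum h1 fun _ => ⟨T', e n, fun ω => rfl⟩
    refine ⟨h2.hasGaussianLaw_eval (), ?_⟩
    rw [integral_finsetSum _ fun k _ => ((hX.memLp (τ n k)).integrable (by norm_num)).const_mul _]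
    simp [integral_const_mul, hX.centered]
  have hvar := (hasGaussianLaw_of_tendsto (fun n => (hG n).1) (fun n => (hG n).2) hDlim).2.2
  have hvar' : ∀ n, Var[D n; P] = ∫ x, ‖φ n x‖ ^ 2 ∂F := fun n => by
    rw [variance_of_integral_eq_zero (hG n).1.aemeasurable (hG n).2]
    exact hF.integral_sq_sum hX T' (τ n) (e n)
  have hφc : ∀ n, Continuous (φ n) := fun n =>
    continuous_finsetSum _ fun k _ => (continuous_wave (τ n k)).const_smul (e n k)
  have hzero : ∀ᵐ x ∂F, ∑ t ∈ T, (c t • wave t x + d t • (Complex.I * x * wave t x)) = 0 := by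
    have h1 : ∀ n, ∫⁻ x, ENNReal.ofReal (‖φ n x‖ ^ 2) ∂F = ENNReal.ofReal Var[D n; P] := fun n => by
      rw [hvar', ofReal_integral_eq_lintegral_ofReal _ (ae_of_all _ fun x => by positivity)]
      have h2 := memLp_finsetSum T' fun k _ => (memLp_wave (F := F) (τ n k)).const_smul (e n k)
      exact h2.integrable_norm_pow two_ne_zero
    have h2 : Tendsto (fun n => ∫⁻ x, ENNReal.ofReal (‖φ n x‖ ^ 2) ∂F) atTop (𝓝 0) := by
      simp_rw [h1]
      have h3 := ENNReal.tendsto_ofReal hvar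
      have h4 : Var[fun _ : Ω => (0 : ℝ); P] = 0 := variance_zero P
      rwa [h4, ENNReal.ofReal_zero] at h3
    have hm : ∀ n, Measurable fun x => ENNReal.ofReal (‖φ n x‖ ^ 2) := fun n =>
      ((hφc n).norm.pow 2).measurable.ennreal_ofReal
    have h3 := lintegral_liminf_le (μ := F) (u := atTop) hm
    rw [h2.liminf_eq, nonpos_iff_eq_zero, lintegral_eq_zero_iff (.liminf hm)] at h3
    filter_upwards [h3] with x hx
    rw [((ENNReal.tendsto_ofReal ((hφlim x).norm.pow 2))).liminf_eq] at hx
    simpa using hx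
  refine eq_zero_of_sum_wave_eq_zero hacc T c d ?_
  have hcl : IsClosed {x : ℝ | ∑ t ∈ T, (c t • wave t x + d t • (Complex.I * x * wave t x)) = 0} :=
    isClosed_eq (continuous_finsetSum _ fun t _ => by
      have := continuous_wave t
      fun_prop) continuous_const
  exact fun x hx => Measure.support_subset_of_isClosed hcl hzero hx

lemma IsSpectralMeasure.exists_sum_ne (hexp : ∀ t : ℝ, Integrable (fun x => Real.exp (t * x)) F)
    {x₀ : ℝ} (hacc : AccPt x₀ (𝓟 F.support)) {a b : ℝ} (T : Finset ℝ) (p : ℝ → ℝ)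
    (hT : ∀ t ∈ T, t ∈ Set.Icc a b) (hp : ∀ t ∈ T, 0 < p t) (hsum : ∑ t ∈ T, p t = 1)
    (c : ℝ) : ∃ s, ∑ t ∈ T, p t * covFun P X s t ≠ c := by
  classical
  by_contra! hc
  obtain ⟨t₀, ht₀⟩ : T.Nonempty := by
    rw [Finset.nonempty_iff_ne_empty]
    rintro rfl
    simp at hsum
  -- A shift longer than the interval makes `T` and `T + r` disjoint.
  set r := b - a + 1 with hr
  set w := ∑ t ∈ T, p t • hX.curve t with hw
  set w' := ∑ t ∈ T, p t • hX.curve (t + r) with hw'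
  have hin : ∀ s, inner ℝ (hX.curve s) w = c := fun s => by
    rw [hw, inner_sum, ← hc s]
    exact Finset.sum_congr rfl fun t _ => by rw [real_inner_smul_right, hX.covFun_eq_inner]
  have hin' : ∀ σ : ℝ → ℝ, inner ℝ (∑ t ∈ T, p t • hX.curve (σ t)) w = c := fun σ => by
    rw [sum_inner]
    simp_rw [real_inner_smul_left, hin]
    rw [← Finset.sum_mul, hsum, one_mul]
  have hstat : ∀ s t, inner ℝ (hX.curve (s + r)) (hX.curve (t + r)) =
      inner ℝ (hX.curve s) (hX.curve t) := fun s t => by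
    rw [← hX.covFun_eq_inner, ← hX.covFun_eq_inner]
    have h1 := hF.repr (s + r) (t + r)
    rw [add_sub_add_right_eq_sub, ← hF.repr s t] at h1
    exact_mod_cast h1
  have hnorm : ‖w'‖ = ‖w‖ := norm_sum_smul_eq hstat T id p
  -- If `⟨x s, w⟩` were constant, the shifted combination, of equal norm by stationarity, would also
  -- have inner product `‖w‖²` with `w`; equality in Cauchy–Schwarz gives a forbidden linear
  -- relation.
  have hww : w' = w := by
    have h1 := norm_sub_sq_real w' w
    have h2 : inner ℝ w' w = ‖w‖ ^ 2 := by
      rw [← real_inner_self_eq_norm_sq]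
      exact (hin' fun t => t + r).trans (hin' id).symm
    rw [h2, hnorm] at h1
    have h3 : ‖w' - w‖ ^ 2 = 0 := by linarith
    exact sub_eq_zero.mp (norm_eq_zero.mp (pow_eq_zero_iff two_ne_zero |>.mp h3))
  have hae : ∀ σ : ℝ → ℝ, ∀ᵐ ω ∂P, (∑ t ∈ T, p t • hX.curve (σ t) : Lp ℝ 2 P) ω =
      ∑ t ∈ T, p t * X (σ t) ω := fun σ => by
    have h1 : ∀ t ∈ T, ∀ᵐ ω ∂P, (p t • hX.curve (σ t) : Lp ℝ 2 P) ω = p t * X (σ t) ω :=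
      fun t _ => by
        filter_upwards [Lp.coeFn_smul (p t) (hX.curve (σ t)), (hX.memLp (σ t)).coeFn_toLp]
          with ω e1 e2
        rw [e1, Pi.smul_apply, IsCenteredContinuousGaussian.curve, e2, smul_eq_mul]
    filter_upwards [T.eventually_all.mpr h1,
      Lp.coeFn_fun_finsetSum T fun t => p t • hX.curve (σ t)] with ω e1 e2
    rw [e2]
    exact Finset.sum_congr rfl e1
  have hnot : ∀ t ∈ T, t + r ∉ T := fun t ht h => by
    have h1 := (hT t ht).1
    have h2 := (hT _ h).2
    linarith
  set T' := T.image (· + r)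
  have hdisj : Disjoint T T' := by
    rw [Finset.disjoint_left]
    intro t ht ht'
    obtain ⟨s, hs, rfl⟩ := Finset.mem_image.mp ht'
    exact hnot s hs ht
  have h0 := (hF.indep hX hexp hacc (T ∪ T') (fun t => if t ∈ T then p t else -p (t - r))
    (fun _ => 0) (by
      filter_upwards [hae id, hae (· + r)] with ω e1 e2
      rw [Finset.sum_union hdisj, Finset.sum_image fun s _ t _ h => add_right_cancel h]
      have h1 : ∑ t ∈ T, ((if t ∈ T then p t else -p (t - r)) * X t ω +
          0 * deriv (fun s => X s ω) t) = ∑ t ∈ T, p t * X t ω :=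
        Finset.sum_congr rfl fun t ht => by simp [ht]
      have h2 : ∑ t ∈ T, ((if t + r ∈ T then p (t + r) else -p (t + r - r)) * X (t + r) ω +
          0 * deriv (fun s => X s ω) (t + r)) = -∑ t ∈ T, p t * X (t + r) ω := by
        rw [← Finset.sum_neg_distrib]
        exact Finset.sum_congr rfl fun t ht => by simp [hnot t ht]
      rw [h1, h2]
      change w ω = ∑ t ∈ T, p t * X t ω at e1
      change w' ω = ∑ t ∈ T, p t * X (t + r) ω at e2
      rw [← e1, ← e2, hww, add_neg_cancel]) t₀ (Finset.mem_union_left _ ht₀)).1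
  simp only [ht₀, if_true] at h0
  exact (hp t₀ ht₀).ne' h0

end

/-- The stationary assumption implies regularity. -/
theorem AssumptionB.isRegular {Ω : Type*} [MeasurableSpace Ω] {P : Measure Ω}
    [IsProbabilityMeasure P] {X : ℝ → Ω → ℝ} (hX : IsCenteredContinuousGaussian P X)
    (h : AssumptionB P X) (a b : ℝ) : IsRegular P X a b := by
  obtain ⟨F, hF, hexp, x₀, hacc⟩ := h
  exact
    { gaussian := hX
      analytic := hF.analyticOnNhd hexp
      differentiable := hF.differentiableAt hX hexp
      indep := hF.indep hX hexp hacc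
      nonconst := fun T p hT hp hsum c _ => hF.exists_sum_ne hX hexp hacc T p hT hp hsum c }

end HighMinima

/-- Existence of an optimal measure `ν`; if moreover `μ'' > 0` at the points of its support in
`(a,b)`, then `ν` is the unique minimizer, and the conditional law of the location of the
minimum given that the minimum exceeds `u` converges weakly to `ν` as `u → ∞`. -/
theorem theorem4p4 {Ω : Type*} [MeasurableSpace Ω] (P : Measure Ω) [IsProbabilityMeasure P]
    (X : ℝ → Ω → ℝ) (hX : HighMinima.IsCenteredContinuousGaussian P X)
    (a b : ℝ) (hab : a < b)
    (hAB : HighMinima.AssumptionA P X a b ∨ HighMinima.AssumptionB P X) :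
    (∃ ν : Measure ℝ, HighMinima.IsMinimizer (HighMinima.covFun P X) a b ν) ∧
    ∀ ν : Measure ℝ, HighMinima.IsMinimizer (HighMinima.covFun P X) a b ν →
      (∀ t ∈ ν.support ∩ Set.Ioo a b,
        0 < iteratedDeriv 2 (HighMinima.condMeanAtOne P X ν.support) t) →
      (∀ ν' : Measure ℝ, HighMinima.IsMinimizer (HighMinima.covFun P X) a b ν' → ν' = ν) ∧
      Measurable (HighMinima.argminLoc X a b) ∧
      (∀ᶠ u : ℝ in atTop, 0 < P (HighMinima.highEvent X a b u)) ∧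
      ∀ f : ℝ →ᵇ ℝ,
        Tendsto
          (fun u : ℝ => ∫ ω, f (HighMinima.argminLoc X a b ω)
            ∂(ProbabilityTheory.cond P (HighMinima.highEvent X a b u)))
          atTop (𝓝 (∫ t, f t ∂ν)) := by
  have hreg : HighMinima.IsRegular P X a b :=
    hAB.elim (fun h => h.isRegular hX) fun h => h.isRegular hX a b
  exact ⟨HighMinima.exists_isMinimizer hX.continuous_curve hX.covFun_eq_inner hab.le,
    fun ν hν hconv => hreg.tendsto_argminLoc hab hν hconv⟩
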